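/- **Setting.** Fix infinite sets of constants, labeled nulls and variables (pairwise disjoint) and a finite relational schema; a position is a pair $(R,i)$ with $1\le i\le \mathrm{ar}(R)$. A (database) instance $I$ is a finite set of atoms over constants and nulls, and $\mathrm{dom}(I)$ is the set of values occurring in it. A constraint is a TGD $\forall \bar x(\varphi\to\exists\bar y\,\psi)$ or an EGD $\forall\bar x(\varphi\to x_i=x_j)$, where $\varphi,\psi$ are conjunctions of relational atoms, possibly with constants, $\psi$ is non-empty, $\varphi$ may be empty for a TGD, all universally quantified variables of the head (of the conclusion) occur in the body $\varphi$. $\mathrm{pos}(\Sigma)$ is the set of positions in bodies of constraints of $\Sigma$. $\alpha(\bar a)$ denotes $\alpha$ with the values $\bar a$ (constants, nulls) as parameters for its universally quantified variables. **Chase.** An *oblivious step* $I\xrightarrow{*,\alpha,\bar a}J$ requires that $\bar a$ maps the body of $\alpha$ into $I$. For a TGD, $J$ is $I$ together with the head atoms, the existential variables being instantiated by pairwise distinct fresh nulls. For an EGD, the two equated values must be distinct, and $J$ is $I$ with one of them, which must be a null, replaced everywhere by the other (if both are constants there is no step; if both are nulls either may be replaced). A *chase step* is an oblivious step with $I\not\models\alpha(\bar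 a)$. A *chase sequence* of $I$ with $\Sigma$ is a finite or infinite sequence of successive chase steps with constraints of $\Sigma$, starting in $I$ (not necessarily exhaustive); its length is the number of steps. **Safety.** The affected positions of $\Sigma$ are the least set of positions such that, for every TGD of $\Sigma$, every head position of an existential variable is affected, and every head position of a universally quantified variable all of whose body positions are affected is affected. The propagation graph has, for each TGD in $\Sigma$, each universally quantified variable $x$ that occurs in the head and occurs in the body only in affected positions, and each body position $\pi_1$ of $x$: an edge from $\pi_1$ to every head position of $x$, and a special edge from $\pi_1$ to every head position of an existential variable. $\Sigma$ is *safe* if no cycle goes through a special edge. **Restriction systems.** Let $k\ge2$ and let $P\subseteq\mathrm{pos}(\Sigma)$. For $\alpha_1,\dots,\alpha_k\in\Sigma$ write $\prec_{k,P}(\alpha_1,\dots,\alpha_k)$ if there are an instance $I_0$, tuples $\bar a_1,\dots,\bar a_k$ and oblivious steps $I_{i-1}\xrightarrow{*,\alpha_i,\bar a_i}I_i$ $(1\le i\le k-1)$, using nulls not used before, such that (i) $I_{k-1}\not\models\alpha_k(\bar a_k)$; (ii) some null $n$ is the parameter of a universally quantified variable in the head of $\alpha_k(\bar a_k)$, and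 all positions of $\mathrm{pos}(\Sigma)$ in which $n$ occurs in $I_0$ lie in $P$; (iii) $I_0\models\alpha_k(\bar a_k)$; (iv) for every $i\in\{1,\dots,k-1\}$: if, omitting the $i$-th step, the other $k-2$ steps (with the same parameters, the same new nulls and the same replacements) can still be performed from $I_0$, then their result satisfies $\alpha_k(\bar a_k)$. For a TGD $\alpha$, $\mathrm{aff\text{-}cl}(\alpha,P)$ is the set of head positions of $\alpha$ in which there occurs an existential variable, or a universally quantified variable all of whose body positions are in $P$; for an EGD it is empty. A *$k$-restriction system* of $\Sigma$ is a directed graph $(\Sigma,E)$ with a set $f\subseteq\mathrm{pos}(\Sigma)$ such that (a) for all $(\alpha,\beta)\in E$, $\mathrm{aff\text{-}cl}(\alpha,f)\cap\mathrm{pos}(\Sigma)\subseteq f$ and $\mathrm{aff\text{-}cl}(\beta,f)\cap\mathrm{pos}(\Sigma)\subseteq f$; (b) whenever $\prec_{k,f}(\alpha_1,\dots,\alpha_k)$, the pairs $(\alpha_1,\alpha_2),\dots,(\alpha_{k-1},\alpha_k)$ are in $E$. There is a least one, the minimal $k$-restriction system. **The T-hierarchy.** A strongly connected component is a maximal set of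 vertices that pairwise (each with itself included) reach each other by paths with at least one edge. Let $\mathrm{part}(\Sigma,k)=\{\Sigma\}$ if $\Sigma$ is itself a strongly connected component of its minimal $k$-restriction system; otherwise $\mathrm{part}(\Sigma,k)$ is the union of $\mathrm{part}(C,k)$ over the strongly connected components $C$ of that system ($\emptyset$ if there are none). $\Sigma\in T[k]$ if for some $k'\in\{2,\dots,k\}$ all members of $\mathrm{part}(\Sigma,k')$ are safe. $\Sigma$ is *inductively restricted* if all members of $\mathrm{part}(\Sigma,2)$ are safe. **Theorem.** Let $\Sigma$ be a finite set of TGDs and EGDs. If $k\ge2$ and $\Sigma\in T[k]$, then there is a polynomial $Q\in\mathbb N[X]$ such that for every database instance $I$, every chase sequence of $I$ with $\Sigma$ is finite and has length at most $Q(|\mathrm{dom}(I)|)$. In particular (the case $k=2$), this holds for every inductively restricted $\Sigma$. -/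

import Mathlib

namespace Chase

/-! ### Schemas, atoms, instances

`Rel` is the set of relation symbols, `ar` their arities, `C` the constants, `N` the labeled nulls
and `V` the variables. -/

/-- Terms occurring in constraints: constants and variables. -/
inductive Term (C V : Type*)
  | const (c : C)
  | var (x : V)

/-- Values occurring in instances: constants and labeled nulls. -/
inductive Value (C N : Type*)
  | const (c : C)
  | null (n : N)

/-- Relational atoms with arguments in `T`. -/
@[ext]
structure RAtom {Rel : Type*} (ar : Rel → ℕ) (T : Type*) where
  rel : Rel
  args : Fin (ar rel) → T

/-- Positions `(R, i)` with `i` an argument place of `R`. -/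
abbrev Position {Rel : Type*} (ar : Rel → ℕ) := (r : Rel) × Fin (ar r)

/-- Apply a map to all arguments of an atom. -/
def RAtom.map {Rel T T' : Type*} {ar : Rel → ℕ} (g : T → T') (a : RAtom ar T) : RAtom ar T' :=
  ⟨a.rel, fun i => g (a.args i)⟩

/-- Evaluation of a term under an assignment; constants are fixed. -/
def Term.eval {C N V : Type*} (μ : V → Value C N) : Term C V → Value C N
  | .const c => .const c
  | .var x => μ x

/-- Sets of facts. A database instance is a finite one (finiteness is assumed where it is used). -/
abbrev Inst {Rel : Type*} (ar : Rel → ℕ) (C N : Type*) := Set (RAtom ar (Value C N))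

/-- The set of values occurring in an instance. -/
def dom {Rel C N : Type*} {ar : Rel → ℕ} (I : Inst ar C N) : Set (Value C N) :=
  {v | ∃ a ∈ I, ∃ i, a.args i = v}

/-- Conjunctions of atoms. -/
abbrev Conj {Rel : Type*} (ar : Rel → ℕ) (C V : Type*) := List (RAtom ar (Term C V))

/-- The variable `x` occurs in the conjunction `l` in position `p`. -/
def OccursAt {Rel C V : Type*} {ar : Rel → ℕ} (l : Conj ar C V) (x : V) (p : Position ar) : Prop :=
  ∃ a ∈ l, ∃ i : Fin (ar a.rel), p = ⟨a.rel, i⟩ ∧ a.args i = Term.var x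

/-- The variables occurring in a conjunction. -/
def vars {Rel C V : Type*} {ar : Rel → ℕ} (l : Conj ar C V) : Set V :=
  {x | ∃ p, OccursAt l x p}

/-- The positions of a conjunction. -/
def positions {Rel C V : Type*} {ar : Rel → ℕ} (l : Conj ar C V) : Set (Position ar) :=
  {p | ∃ a ∈ l, ∃ i : Fin (ar a.rel), p = ⟨a.rel, i⟩}

/-- All atoms of `l`, evaluated under `μ`, are facts of `I`; that is, `μ` is a homomorphism
from `l` to `I`. -/
def Holds {Rel C N V : Type*} {ar : Rel → ℕ} (I : Inst ar C N) (l : Conj ar C V)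
    (μ : V → Value C N) : Prop :=
  ∀ a ∈ l, a.map (Term.eval μ) ∈ I

/-! ### Constraints -/

/-- A TGD `∀ x (body → ∃ y head)`. The existentially quantified variables are the variables of
the head that do not occur in the body. -/
structure TGD {Rel : Type*} (ar : Rel → ℕ) (C V : Type*) where
  body : Conj ar C V
  head : Conj ar C V
  head_ne : head ≠ []

/-- An EGD `∀ x (body → lhs = rhs)`. -/
structure EGD {Rel : Type*} (ar : Rel → ℕ) (C V : Type*) where
  body : Conj ar C V
  lhs : V
  rhs : V
  lhs_mem : lhs ∈ vars body
  rhs_mem : rhs ∈ vars body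

/-- A constraint is a TGD or an EGD. -/
inductive Constraint {Rel : Type*} (ar : Rel → ℕ) (C V : Type*)
  | tgd (t : TGD ar C V)
  | egd (e : EGD ar C V)

/-- The existentially quantified variables of a TGD. -/
def TGD.exVars {Rel C V : Type*} {ar : Rel → ℕ} (t : TGD ar C V) : Set V :=
  vars t.head \ vars t.body

/-- The body of a constraint. -/
def Constraint.body {Rel C V : Type*} {ar : Rel → ℕ} : Constraint ar C V → Conj ar C V
  | .tgd t => t.body
  | .egd e => e.body

/-- The universally quantified variables that occur in the head of a constraint. -/
def Constraint.headUniv {Rel C V : Type*} {ar : Rel → ℕ} : Constraint ar C V → Set V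
  | .tgd t => vars t.head ∩ vars t.body
  | .egd e => {e.lhs, e.rhs}

/-- `pos(S)`: the positions in the bodies of the constraints of `S`. -/
def pos {Rel C V : Type*} {ar : Rel → ℕ} (S : Set (Constraint ar C V)) : Set (Position ar) :=
  {p | ∃ α ∈ S, p ∈ positions α.body}

/-- `I ⊨ α(a)`, where the parameters `a` are the values of `μ` on the universally quantified
variables of `α` (the other values of `μ` are irrelevant). -/
def Sat {Rel C N V : Type*} {ar : Rel → ℕ} (I : Inst ar C N) (α : Constraint ar C V)
    (μ : V → Value C N) : Prop :=
  match α with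
  | .tgd t => Holds I t.body μ →
      ∃ ν : V → Value C N, (∀ x ∈ vars t.body, ν x = μ x) ∧ Holds I t.head ν
  | .egd e => Holds I e.body μ → μ e.lhs = μ e.rhs

/-! ### Chase steps -/

/-- The data of a chase step: a constraint, the values of its universally quantified variables
and, for a TGD, the nulls chosen for its existentially quantified variables. For an EGD, `swap`
tells which of the two sides is replaced by the other. -/
structure Step {Rel : Type*} (ar : Rel → ℕ) (C N V : Type*) where
  constraint : Constraint ar C V
  val : V → Value C N
  swap : Bool

/-- For an EGD step, the value that is replaced. -/
def EGD.old {Rel C N V : Type*} {ar : Rel → ℕ} (e : EGD ar C V) (μ : V → Value C N) :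
    Bool → Value C N
  | false => μ e.rhs
  | true => μ e.lhs

/-- For an EGD step, the value that is put in place of the replaced one. -/
def EGD.new {Rel C N V : Type*} {ar : Rel → ℕ} (e : EGD ar C V) (μ : V → Value C N) :
    Bool → Value C N
  | false => μ e.lhs
  | true => μ e.rhs

open Classical in
/-- Replace all occurrences of `u` in `I` by `w`. -/
noncomputable def replaceValue {Rel C N : Type*} {ar : Rel → ℕ} (u w : Value C N)
    (I : Inst ar C N) : Inst ar C N :=
  (fun a => a.map (fun v => if v = u then w else v)) '' I

/-- The nulls chosen by the step do not occur in `I`. -/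
def Step.Fresh {Rel C N V : Type*} {ar : Rel → ℕ} (s : Step ar C N V) (I : Inst ar C N) : Prop :=
  match s.constraint with
  | .tgd t => ∀ y ∈ t.exVars, s.val y ∉ dom I
  | .egd _ => True

/-- The step can be performed on `I` as an oblivious chase step. -/
def Step.Enabled {Rel C N V : Type*} {ar : Rel → ℕ} (s : Step ar C N V) (I : Inst ar C N) : Prop :=
  s.Fresh I ∧
  match s.constraint with
  | .tgd t => Holds I t.body s.val ∧ (∀ y ∈ t.exVars, ∃ n, s.val y = Value.null n) ∧
      Set.InjOn s.val t.exVars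
  | .egd e => Holds I e.body s.val ∧ s.val e.lhs ≠ s.val e.rhs ∧
      ∃ n, e.old s.val s.swap = Value.null n

/-- The result of the step on `I`. -/
noncomputable def Step.apply {Rel C N V : Type*} {ar : Rel → ℕ} (s : Step ar C N V)
    (I : Inst ar C N) : Inst ar C N :=
  match s.constraint with
  | .tgd t => I ∪ {f | ∃ a ∈ t.head, f = a.map (Term.eval s.val)}
  | .egd e => replaceValue (e.old s.val s.swap) (e.new s.val s.swap) I

/-- A (standard) chase step from `I` to `J` with a constraint of `S`: the constraint is violated
by its parameters and the step is performed. -/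
def ChaseStep {Rel C V : Type*} (N : Type*) {ar : Rel → ℕ} (S : Set (Constraint ar C V))
    (I J : Inst ar C N) : Prop :=
  ∃ s : Step ar C N V, s.constraint ∈ S ∧ s.Enabled I ∧ ¬ Sat I s.constraint s.val ∧ J = s.apply I

/-- `run 0 → run 1 → ⋯` is a chase sequence of `I` with `S` of length `L`; it may be
infinite (`L = ⊤`). Sequences that stop before the result satisfies `S` are included. -/
def IsChaseSequence {Rel C N V : Type*} {ar : Rel → ℕ} (S : Set (Constraint ar C V))
    (I : Inst ar C N) (L : ℕ∞) (run : ℕ → Inst ar C N) : Prop :=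
  run 0 = I ∧ ∀ i : ℕ, (i : ℕ∞) < L → ChaseStep N S (run i) (run (i + 1))

/-- One polynomial in `|dom I|` bounds the length of every chase sequence of every database
instance `I` with `S`. -/
def ChasePolynomiallyBounded {Rel C V : Type*} (N : Type*) {ar : Rel → ℕ}
    (S : Set (Constraint ar C V)) : Prop :=
  ∃ Q : Polynomial ℕ, ∀ I : Inst ar C N, I.Finite →
    ∀ (L : ℕ∞) (run : ℕ → Inst ar C N), IsChaseSequence S I L run →
      L ≤ ((Q.eval (dom I).ncard : ℕ) : ℕ∞)

/-! ### Safety -/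

/-- Affected positions. -/
inductive Affected {Rel C V : Type*} {ar : Rel → ℕ} (S : Set (Constraint ar C V)) :
    Position ar → Prop
  | exist (t : TGD ar C V) (y : V) (p : Position ar) :
      Constraint.tgd t ∈ S → y ∈ t.exVars → OccursAt t.head y p → Affected S p
  | univ (t : TGD ar C V) (x : V) (p : Position ar) :
      Constraint.tgd t ∈ S → x ∈ vars t.body → OccursAt t.head x p →
      (∀ q, OccursAt t.body x q → Affected S q) → Affected S p

/-- Normal edges of the propagation graph. -/
def PropEdge {Rel C V : Type*} {ar : Rel → ℕ} (S : Set (Constraint ar C V))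
    (p q : Position ar) : Prop :=
  ∃ t : TGD ar C V, Constraint.tgd t ∈ S ∧ ∃ x : V, OccursAt t.body x p ∧
    (∀ r, OccursAt t.body x r → Affected S r) ∧ OccursAt t.head x q

/-- Special edges of the propagation graph. -/
def PropSpecial {Rel C V : Type*} {ar : Rel → ℕ} (S : Set (Constraint ar C V))
    (p q : Position ar) : Prop :=
  ∃ t : TGD ar C V, Constraint.tgd t ∈ S ∧ ∃ x ∈ vars t.head, OccursAt t.body x p ∧
    (∀ r, OccursAt t.body x r → Affected S r) ∧ ∃ y ∈ t.exVars, OccursAt t.head y q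

/-- `S` is safe: no cycle of the propagation graph goes through a special edge. -/
def Safe {Rel C V : Type*} {ar : Rel → ℕ} (S : Set (Constraint ar C V)) : Prop :=
  ∀ p q, PropSpecial S p q →
    ¬ Relation.ReflTransGen (fun u v => PropEdge S u v ∨ PropSpecial S u v) q p

/-! ### Restriction systems -/

/-- `null-pos(A, I)` relative to `S`. -/
def nullPos {Rel C N V : Type*} {ar : Rel → ℕ} (S : Set (Constraint ar C V)) (A : Set N)
    (I : Inst ar C N) : Set (Position ar) :=
  {p | p ∈ pos S ∧ ∃ n ∈ A, ∃ a ∈ I, ∃ i : Fin (ar a.rel),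
    p = ⟨a.rel, i⟩ ∧ a.args i = Value.null n}

/-- The instance obtained by performing the steps in order. -/
noncomputable def runSteps {Rel C N V : Type*} {ar : Rel → ℕ} (I : Inst ar C N)
    (l : List (Step ar C N V)) : Inst ar C N :=
  l.foldl (fun J s => s.apply J) I

/-- All steps can be performed in order, as oblivious chase steps, starting from `I`. -/
def Executable {Rel C N V : Type*} {ar : Rel → ℕ} :
    Inst ar C N → List (Step ar C N V) → Prop
  | _, [] => True
  | I, s :: l => s.Enabled I ∧ Executable (s.apply I) l

/-- The relation `≺_{k,P}` on lists `[α₁, …, α_k]` of constraints of `S`. The first `k - 1`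
constraints are fired obliviously from `I₀`, with nulls that were not used before; this makes
`α_k(μ)` violated, although it was satisfied in `I₀`, and every one of the `k - 1` steps is
necessary for that: if the other steps can still be performed without it, then they leave `α_k(μ)`
satisfied. -/
def Prec {Rel C V : Type*} (N : Type*) {ar : Rel → ℕ} (S : Set (Constraint ar C V)) (k : ℕ)
    (P : Set (Position ar)) (αs : List (Constraint ar C V)) : Prop :=
  (∀ α ∈ αs, α ∈ S) ∧
  ∃ (I₀ : Inst ar C N) (steps : List (Step ar C N V)) (β : Constraint ar C V)
    (μ : V → Value C N),
    I₀.Finite ∧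
    steps.length + 1 = k ∧
    αs = steps.map Step.constraint ++ [β] ∧
    Executable I₀ steps ∧
    (∀ (i : ℕ) (h : i < steps.length), ∀ j ≤ i, steps[i].Fresh (runSteps I₀ (steps.take j))) ∧
    ¬ Sat (runSteps I₀ steps) β μ ∧
    (∃ x ∈ β.headUniv, ∃ n : N, μ x = Value.null n ∧ nullPos S {n} I₀ ⊆ P) ∧
    Sat I₀ β μ ∧
    ∀ i < steps.length, Executable I₀ (steps.eraseIdx i) →
      Sat (runSteps I₀ (steps.eraseIdx i)) β μ

/-- `aff-cl(α, P)`: the positions of the head in which an existentially quantified variable occurs,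
or a universally quantified variable all of whose positions in the body are in `P`. -/
def affCl {Rel C V : Type*} {ar : Rel → ℕ} (α : Constraint ar C V) (P : Set (Position ar)) :
    Set (Position ar) :=
  match α with
  | .tgd t => {p | ∃ x, OccursAt t.head x p ∧
      (x ∈ t.exVars ∨ (x ∈ vars t.body ∧ ∀ q, OccursAt t.body x q → q ∈ P))}
  | .egd _ => ∅

/-- `((S, E), f)` is a `k`-restriction system for `S`. -/
structure IsRestrictionSystem {Rel C V : Type*} (N : Type*) {ar : Rel → ℕ}
    (S : Set (Constraint ar C V)) (k : ℕ) (E : Constraint ar C V → Constraint ar C V → Prop)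
    (f : Set (Position ar)) : Prop where
  edge_mem : ∀ α β, E α β → α ∈ S ∧ β ∈ S
  pos_sub : f ⊆ pos S
  closed : ∀ α β, E α β → affCl α f ∩ pos S ⊆ f ∧ affCl β f ∩ pos S ⊆ f
  prec : ∀ αs, Prec N S k f αs → αs.IsChain E

/-- The edges of the minimal `k`-restriction system: those of all `k`-restriction systems. -/
def minEdge {Rel C V : Type*} (N : Type*) {ar : Rel → ℕ} (S : Set (Constraint ar C V)) (k : ℕ)
    (α β : Constraint ar C V) : Prop :=
  ∀ E f, IsRestrictionSystem N S k E f → E α β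

/-- The positions of the minimal `k`-restriction system. -/
def minPos {Rel C V : Type*} (N : Type*) {ar : Rel → ℕ} (S : Set (Constraint ar C V)) (k : ℕ) :
    Set (Position ar) :=
  {p | ∀ E f, IsRestrictionSystem N S k E f → p ∈ f}

theorem Prec.mono {Rel C V N : Type*} {ar : Rel → ℕ} {S : Set (Constraint ar C V)} {k : ℕ}
    {P P' : Set (Position ar)} (hP : P ⊆ P') {αs : List (Constraint ar C V)}
    (h : Prec N S k P αs) : Prec N S k P' αs := by
  obtain ⟨h0, I₀, steps, β, μ, h1, h2, h3, h4, h5, h6, ⟨x, hx, n, hn, hs⟩, h8, h9⟩ := h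
  exact ⟨h0, I₀, steps, β, μ, h1, h2, h3, h4, h5, h6, ⟨x, hx, n, hn, hs.trans hP⟩, h8, h9⟩

theorem affCl_mono {Rel C V : Type*} {ar : Rel → ℕ} (α : Constraint ar C V)
    {P P' : Set (Position ar)} (hP : P ⊆ P') : affCl α P ⊆ affCl α P' := by
  cases α with
  | tgd t =>
    rintro p ⟨x, hx, h | ⟨h, h'⟩⟩
    · exact ⟨x, hx, Or.inl h⟩
    · exact ⟨x, hx, Or.inr ⟨h, fun q hq => hP (h' q hq)⟩⟩
  | egd e => exact fun p hp => hp

/-- All constraints and all body positions form a restriction system. -/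
theorem isRestrictionSystem_top {Rel C V : Type*} (N : Type*) {ar : Rel → ℕ}
    (S : Set (Constraint ar C V)) (k : ℕ) :
    IsRestrictionSystem N S k (fun α β => α ∈ S ∧ β ∈ S) (pos S) where
  edge_mem := fun _ _ h => h
  pos_sub := subset_rfl
  closed := fun _ _ _ => ⟨fun _ h => h.2, fun _ h => h.2⟩
  prec := fun _ h => List.isChain_iff_getElem.2 fun _ _ =>
    ⟨h.1 _ (List.getElem_mem _), h.1 _ (List.getElem_mem _)⟩

theorem minPos_subset {Rel C V N : Type*} {ar : Rel → ℕ} {S : Set (Constraint ar C V)} {k : ℕ}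
    {E : Constraint ar C V → Constraint ar C V → Prop} {f : Set (Position ar)}
    (hE : IsRestrictionSystem N S k E f) : minPos N S k ⊆ f :=
  fun _ hp => hp E f hE

/-- The minimal restriction system is a restriction system, hence the least one. -/
theorem isRestrictionSystem_min {Rel C V : Type*} (N : Type*) {ar : Rel → ℕ}
    (S : Set (Constraint ar C V)) (k : ℕ) :
    IsRestrictionSystem N S k (minEdge N S k) (minPos N S k) where
  edge_mem := fun _ _ h => h _ _ (isRestrictionSystem_top N S k)
  pos_sub := fun _ h => h _ _ (isRestrictionSystem_top N S k)
  closed := fun α β h =>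
    ⟨fun _ hp E f hE => (hE.closed α β (h E f hE)).1
        ⟨affCl_mono α (minPos_subset hE) hp.1, hp.2⟩,
      fun _ hp E f hE => (hE.closed α β (h E f hE)).2
        ⟨affCl_mono β (minPos_subset hE) hp.1, hp.2⟩⟩
  prec := fun αs h => List.isChain_iff_getElem.2 fun i hi E f hE =>
    List.isChain_iff_getElem.1 (hE.prec αs (h.mono (minPos_subset hE))) i hi

/-! ### The T-hierarchy -/

/-- `D` is (the vertex set of) a strongly connected component of the graph `(S, E)`: a maximal set
of vertices that reach each other by paths with at least one edge. -/
def IsSCC {A : Type*} (S : Set A) (E : A → A → Prop) (D : Set A) : Prop :=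
  ∃ α ∈ S, Relation.TransGen E α α ∧
    D = {β | β ∈ S ∧ Relation.TransGen E α β ∧ Relation.TransGen E β α}

/-- `S' ∈ part(S, k)`. If `S` itself is a strongly connected component of its minimal
`k`-restriction system (it is then the only one), `part(S, k) = {S}`; otherwise `part(S, k)` is the
union of `part(D, k)` over the strongly connected components `D`, so it is empty if there are
none. -/
inductive InPart {Rel C V : Type*} (N : Type*) {ar : Rel → ℕ} (k : ℕ) :
    Set (Constraint ar C V) → Set (Constraint ar C V) → Prop
  | self (S : Set (Constraint ar C V)) : IsSCC S (minEdge N S k) S → InPart N k S S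
  | comp (S D S' : Set (Constraint ar C V)) : IsSCC S (minEdge N S k) D → D ≠ S →
      InPart N k D S' → InPart N k S S'

/-- Level `T[k]` of the T-hierarchy. -/
def InT {Rel C V : Type*} (N : Type*) {ar : Rel → ℕ} (k : ℕ) (S : Set (Constraint ar C V)) : Prop :=
  ∃ k', 2 ≤ k' ∧ k' ≤ k ∧ ∀ S', InPart N k' S S' → Safe S'

/-- Inductively restricted constraint sets. -/
def InductivelyRestricted {Rel C V : Type*} (N : Type*) {ar : Rel → ℕ}
    (S : Set (Constraint ar C V)) : Prop :=
  ∀ S', InPart N 2 S S' → Safe S'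

end Chase

open Chase

/-! A chase is bounded by counting violated constraint instances. Steps are recorded in a `Trace`,
in which nothing is ever replaced: facts accumulate, equations generate an equivalence `eqv`, and
bodies and heads are matched up to it, so that values keep their names throughout. A violated step
never has the same constraint and equal head values as an earlier step (`IsRun.eq_of_eqv`). If the
head values all come, up to equality, from a set `Y`, there are thus at most a power of `|Y|` steps
for each constraint. Hence the steps whose values arise from the base values `X` in a bounded number
of rounds of null creation (`level`, `stage`) are polynomially many in `|X|`.

The statement proved by induction is `Good`. It concerns runs that have, besides the counted
internal steps, any number of external steps with head values in `X`; the bound depends on `|X|`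
alone. This makes it possible to treat the effects of other constraints as input. For a safe set, a
value not equal to one of level `r` occurs only at ends of paths with `r` special edges
(`affected_depth`). In a safe set the special edges of a path have distinct sources, so the level is
bounded by the number of positions.

For an arbitrary set, let `E` and `f` form the minimal restriction system. The core is
`enables_support`: apart from polynomially many low steps, every step is enabled by external steps,
low steps and steps with an `E`-path to it. If this fails for `i`, adding the other steps in order
yields a step `j` that is indispensable for `i`, and `transGen_of_needed` finds a witness of `≺`
that contains `j` and ends with `i`. Such a witness must consist of exactly `k - 1` steps before
`i`, all of them necessary. Moving the starting instance back by one step changes the least number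
of steps needed by at most one, so a discrete intermediate value argument gives the exact number;
steps that are reached too quickly even from the base are counted as low. The condition on positions
of nulls is provided by `confined`, since edges into a copying step and out of a creating step keep
high-level nulls inside `f`. To obtain honest instances and steps, values are replaced by the least
members of their classes for a well-order with constants first (`Canonical`, `exact`).

The components are then treated in topological order, the low steps and those of strict ancestors
being declared external (`run_comp`); a constraint on no cycle has all its remaining steps enabled
by external ones. If the set is not itself a component, its components are proper subsets and are
good by induction. Finally, every finite chase sequence is lifted to a run (`exists_run_of_chase`).
-/

namespace Chase

variable {Rel C N V : Type*} {ar : Rel → ℕ}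

/-! ### Atoms up to an equivalence of values -/

/-- The value `v` stands in position `p` of the atom `a`. -/
def RAtom.AtPos {T : Type*} (a : RAtom ar T) (p : Position ar) (v : T) : Prop :=
  ∃ i : Fin (ar a.rel), p = ⟨a.rel, i⟩ ∧ a.args i = v

/-- The atoms agree up to the relation `r` on their arguments. -/
def RAtom.Sim {T : Type*} (r : T → T → Prop) (a b : RAtom ar T) : Prop :=
  ∃ (R : Rel) (u w : Fin (ar R) → T), a = ⟨R, u⟩ ∧ b = ⟨R, w⟩ ∧ ∀ i, r (u i) (w i)

theorem RAtom.Sim.mono {T : Type*} {r s : T → T → Prop} (h : ∀ v w, r v w → s v w)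
    {a b : RAtom ar T} : a.Sim r b → a.Sim s b := by
  rintro ⟨R, u, w, ha, hb, hr⟩
  exact ⟨R, u, w, ha, hb, fun i => h _ _ (hr i)⟩

theorem RAtom.Sim.refl {T : Type*} {r : T → T → Prop} (h : ∀ v, r v v) (a : RAtom ar T) :
    a.Sim r a := ⟨a.rel, a.args, a.args, rfl, rfl, fun _ => h _⟩

theorem RAtom.Sim.symm {T : Type*} {r : T → T → Prop} (h : ∀ v w, r v w → r w v)
    {a b : RAtom ar T} : a.Sim r b → b.Sim r a := by
  rintro ⟨R, u, w, ha, hb, hr⟩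
  exact ⟨R, w, u, hb, ha, fun i => h _ _ (hr i)⟩

theorem RAtom.Sim.trans {T : Type*} {r : T → T → Prop} (h : ∀ u v w, r u v → r v w → r u w)
    {a b c : RAtom ar T} : a.Sim r b → b.Sim r c → a.Sim r c := by
  rintro ⟨R, u, w, rfl, rfl, hr⟩ ⟨R', u', w', h1, rfl, hr'⟩
  obtain ⟨rfl, h1⟩ := RAtom.mk.inj h1
  obtain rfl := eq_of_heq h1
  exact ⟨R, u, w', rfl, rfl, fun i => h _ _ _ (hr i) (hr' i)⟩

theorem RAtom.Sim.map_eq {T T' : Type*} {r : T → T → Prop} {g : T → T'}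
    (h : ∀ v w, r v w → g v = g w) {a b : RAtom ar T} : a.Sim r b → a.map g = b.map g := by
  rintro ⟨R, u, w, rfl, rfl, hr⟩
  simp only [RAtom.map, RAtom.mk.injEq, heq_eq_eq, true_and]
  funext i
  exact h _ _ (hr i)

theorem RAtom.sim_map {T T' : Type*} {r : T' → T' → Prop} {g g' : T → T'} (a : RAtom ar T)
    (h : ∀ p v, a.AtPos p v → r (g v) (g' v)) : (a.map g).Sim r (a.map g') :=
  ⟨a.rel, _, _, rfl, rfl, fun i => h ⟨a.rel, i⟩ _ ⟨i, rfl, rfl⟩⟩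

theorem RAtom.map_congr {T T' : Type*} {g g' : T → T'} (a : RAtom ar T)
    (h : ∀ p v, a.AtPos p v → g v = g' v) : a.map g = a.map g' := by
  simp only [RAtom.map, RAtom.mk.injEq, heq_eq_eq, true_and]
  funext i
  exact h ⟨a.rel, i⟩ _ ⟨i, rfl, rfl⟩

theorem RAtom.map_map {T T' T'' : Type*} (g : T → T') (g' : T' → T'') (a : RAtom ar T) :
    (a.map g).map g' = a.map (g' ∘ g) := rfl

theorem RAtom.Sim.atPos {T : Type*} {r : T → T → Prop} {a b : RAtom ar T} (h : a.Sim r b)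
    {p : Position ar} {v : T} (hv : a.AtPos p v) : ∃ w, b.AtPos p w ∧ r v w := by
  obtain ⟨R, u, w, rfl, rfl, hr⟩ := h
  obtain ⟨i, rfl, rfl⟩ := hv
  exact ⟨w i, ⟨i, rfl, rfl⟩, hr i⟩

theorem RAtom.atPos_map {T T' : Type*} {g : T → T'} {a : RAtom ar T} {p : Position ar} {v : T'} :
    (a.map g).AtPos p v ↔ ∃ u, a.AtPos p u ∧ g u = v := by
  constructor
  · rintro ⟨i, hp, hv⟩
    exact ⟨a.args i, ⟨i, hp, rfl⟩, hv⟩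
  · rintro ⟨u, ⟨i, hp, hi⟩, hv⟩
    exact ⟨i, hp, by simp only [RAtom.map]; rw [hi]; exact hv⟩

theorem occursAt_iff {l : Conj ar C V} {x : V} {p : Position ar} :
    OccursAt l x p ↔ ∃ a ∈ l, a.AtPos p (Term.var x) := Iff.rfl

theorem mem_dom_iff {I : Inst ar C N} {v : Value C N} :
    v ∈ dom I ↔ ∃ a ∈ I, ∃ p, a.AtPos p v := by
  constructor
  · rintro ⟨a, ha, i, hi⟩
    exact ⟨a, ha, ⟨a.rel, i⟩, i, rfl, hi⟩
  · rintro ⟨a, ha, p, i, _, hi⟩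
    exact ⟨a, ha, i, hi⟩

theorem mem_vars_of_atPos {l : Conj ar C V} {a : RAtom ar (Term C V)} (ha : a ∈ l)
    {p : Position ar} {x : V} (h : a.AtPos p (Term.var x)) : x ∈ vars l := ⟨p, a, ha, h⟩

/-! ### Effects of constraints -/

/-- The existentially quantified variables of a constraint. -/
def Constraint.exVars : Constraint ar C V → Set V
  | .tgd t => t.exVars
  | .egd _ => ∅

/-- The facts stated by the head of a constraint. -/
def Constraint.headFacts (α : Constraint ar C V) (μ : V → Value C N) : Inst ar C N :=
  match α with
  | .tgd t => {f | ∃ a ∈ t.head, f = a.map (Term.eval μ)}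
  | .egd _ => ∅

/-- The equation stated by the head of a constraint. -/
def Constraint.Equates (α : Constraint ar C V) (μ : V → Value C N) (v w : Value C N) : Prop :=
  match α with
  | .tgd _ => False
  | .egd e => v = μ e.lhs ∧ w = μ e.rhs

/-- The constants in the head of a constraint. -/
def Constraint.headConsts (α : Constraint ar C V) : Set C :=
  match α with
  | .tgd t => {c | ∃ a ∈ t.head, ∃ p, a.AtPos p (Term.const c)}
  | .egd _ => ∅

theorem Constraint.headUniv_subset (α : Constraint ar C V) : α.headUniv ⊆ vars α.body := by
  cases α with
  | tgd t => exact fun x hx => hx.2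
  | egd e =>
    rintro x (rfl | rfl)
    · exact e.lhs_mem
    · exact e.rhs_mem

theorem Constraint.notMem_body_of_exVars {α : Constraint ar C V} {y : V} (hy : y ∈ α.exVars) :
    y ∉ vars α.body := by
  cases α with
  | tgd t => exact hy.2
  | egd e => exact hy.elim

theorem Constraint.Equates.exists_left {α : Constraint ar C V} {μ : V → Value C N}
    {v w : Value C N} (h : α.Equates μ v w) : ∃ x ∈ α.headUniv, v = μ x := by
  cases α with
  | tgd t => exact h.elim
  | egd e => exact ⟨e.lhs, Or.inl rfl, h.1⟩

theorem Constraint.Equates.exists_right {α : Constraint ar C V} {μ : V → Value C N}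
    {v w : Value C N} (h : α.Equates μ v w) : ∃ x ∈ α.headUniv, w = μ x := by
  cases α with
  | tgd t => exact h.elim
  | egd e => exact ⟨e.rhs, Or.inr rfl, h.2⟩

theorem Constraint.headFacts_cases {α : Constraint ar C V} {μ : V → Value C N}
    {f : RAtom ar (Value C N)} (hf : f ∈ α.headFacts μ) {p : Position ar} {v : Value C N}
    (hv : f.AtPos p v) :
    (∃ c ∈ α.headConsts, v = Value.const c) ∨ (∃ y ∈ α.exVars, v = μ y) ∨
      ∃ x ∈ α.headUniv, v = μ x := by
  cases α with
  | egd e => exact hf.elim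
  | tgd t =>
    obtain ⟨a, ha, rfl⟩ := hf
    obtain ⟨u, hu, rfl⟩ := RAtom.atPos_map.1 hv
    cases u with
    | const c => exact Or.inl ⟨c, ⟨a, ha, p, hu⟩, rfl⟩
    | var x =>
      have hx := mem_vars_of_atPos ha hu
      by_cases hb : x ∈ vars t.body
      · exact Or.inr (Or.inr ⟨x, ⟨hx, hb⟩, rfl⟩)
      · exact Or.inr (Or.inl ⟨x, ⟨hx, hb⟩, rfl⟩)

/-! ### Traces

A trace records the steps of a chase without performing replacements: equations are collected in an
equivalence relation, and constraints are matched up to that equivalence. -/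

/-- An initial instance, and the constraints and parameters of the steps. -/
structure Trace {Rel : Type*} (ar : Rel → ℕ) (C N V : Type*) where
  init : Inst ar C N
  con : ℕ → Constraint ar C V
  val : ℕ → V → Value C N

namespace Trace

variable (R : Trace ar C N V)

/-- The facts produced by the steps in `P`. -/
def facts (P : Set ℕ) : Inst ar C N :=
  {f | f ∈ R.init ∨ ∃ p ∈ P, f ∈ (R.con p).headFacts (R.val p)}

/-- The equivalence generated by the equations of the steps in `P`. -/
def eqv (P : Set ℕ) : Value C N → Value C N → Prop :=
  Relation.EqvGen fun v w => ∃ p ∈ P, (R.con p).Equates (R.val p) v w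

/-- The body of step `m` holds after the steps in `P`. -/
def Enables (P : Set ℕ) (m : ℕ) : Prop :=
  ∀ a ∈ (R.con m).body, ∃ f ∈ R.facts P, f.Sim (R.eqv P) (a.map (Term.eval (R.val m)))

/-- The head of step `m` does not hold after the steps in `P`. -/
def Violated (P : Set ℕ) (m : ℕ) : Prop :=
  match R.con m with
  | .tgd t => ∀ ν : V → Value C N, (∀ x ∈ vars t.body, R.eqv P (ν x) (R.val m x)) →
      ¬ ∀ a ∈ t.head, ∃ f ∈ R.facts P, f.Sim (R.eqv P) (a.map (Term.eval ν))
  | .egd e => ¬ R.eqv P (R.val m e.lhs) (R.val m e.rhs)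

/-- The nulls chosen by step `m`. -/
def born (m : ℕ) : Set (Value C N) := R.val m '' (R.con m).exVars

/-- The part of `P` before `m`. -/
abbrev _root_.Chase.before (P : Set ℕ) (m : ℕ) : Set ℕ := P ∩ Set.Iio m

variable {R}

theorem facts_mono {P Q : Set ℕ} (h : P ⊆ Q) : R.facts P ⊆ R.facts Q := by
  rintro f (hf | ⟨p, hp, hf⟩)
  · exact Or.inl hf
  · exact Or.inr ⟨p, h hp, hf⟩

theorem eqv_mono {P Q : Set ℕ} (h : P ⊆ Q) {v w : Value C N} (hvw : R.eqv P v w) :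
    R.eqv Q v w := by
  induction hvw with
  | rel _ _ h' => obtain ⟨p, hp, he⟩ := h'; exact Relation.EqvGen.rel _ _ ⟨p, h hp, he⟩
  | refl => exact Relation.EqvGen.refl _
  | symm _ _ _ ih => exact Relation.EqvGen.symm _ _ ih
  | trans _ _ _ _ _ ih ih' => exact Relation.EqvGen.trans _ _ _ ih ih'

theorem eqv_refl (P : Set ℕ) (v : Value C N) : R.eqv P v v := Relation.EqvGen.refl _

theorem eqv_symm {P : Set ℕ} {v w : Value C N} (h : R.eqv P v w) : R.eqv P w v :=
  Relation.EqvGen.symm _ _ h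

theorem eqv_trans {P : Set ℕ} {u v w : Value C N} (h : R.eqv P u v) (h' : R.eqv P v w) :
    R.eqv P u w := Relation.EqvGen.trans _ _ _ h h'

theorem eqv_of_equates {P : Set ℕ} {m : ℕ} (hm : m ∈ P) {v w : Value C N}
    (h : (R.con m).Equates (R.val m) v w) : R.eqv P v w := Relation.EqvGen.rel _ _ ⟨m, hm, h⟩

/-- To show that equivalent values are related by an equivalence, look at the equations. -/
theorem eqv_induction {P : Set ℕ} {r : Value C N → Value C N → Prop} (hr : Equivalence r)
    (h : ∀ p ∈ P, ∀ v w, (R.con p).Equates (R.val p) v w → r v w) {v w : Value C N}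
    (hvw : R.eqv P v w) : r v w := by
  induction hvw with
  | rel _ _ h' => obtain ⟨p, hp, he⟩ := h'; exact h p hp _ _ he
  | refl => exact hr.refl _
  | symm _ _ _ ih => exact hr.symm ih
  | trans _ _ _ _ _ ih ih' => exact hr.trans ih ih'

theorem sim_trans {P : Set ℕ} {a b c : RAtom ar (Value C N)} (h : a.Sim (R.eqv P) b)
    (h' : b.Sim (R.eqv P) c) : a.Sim (R.eqv P) c :=
  RAtom.Sim.trans (fun _ _ _ => eqv_trans) h h'

theorem Enables.mono {P Q : Set ℕ} (h : P ⊆ Q) {m : ℕ} (hm : R.Enables P m) :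
    R.Enables Q m := by
  intro a ha
  obtain ⟨f, hf, hs⟩ := hm a ha
  exact ⟨f, facts_mono h hf, hs.mono fun _ _ => eqv_mono h⟩

theorem Violated.anti {P Q : Set ℕ} (h : P ⊆ Q) {m : ℕ} (hm : R.Violated Q m) :
    R.Violated P m := by
  unfold Violated at *
  split at hm
  · intro ν hν hh
    refine hm ν (fun x hx => eqv_mono h (hν x hx)) fun a ha => ?_
    obtain ⟨f, hf, hs⟩ := hh a ha
    exact ⟨f, facts_mono h hf, hs.mono fun _ _ => eqv_mono h⟩
  · exact fun hh => hm (eqv_mono h hh)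

/-- The values known after the steps in `P`, when the values in `X` are known beforehand. -/
def names (R : Trace ar C N V) (X : Set (Value C N)) (int P : Set ℕ) : Set (Value C N) :=
  X ∪ {v | ∃ p ∈ P, p ∈ int ∧ v ∈ R.born p}

theorem names_mono {X : Set (Value C N)} {int P Q : Set ℕ} (h : P ⊆ Q) :
    R.names X int P ⊆ R.names X int Q := by
  rintro v (hv | ⟨p, hp, h1, h2⟩)
  · exact Or.inl hv
  · exact Or.inr ⟨p, h hp, h1, h2⟩

end Trace

/-- The trace `R` is a run of the constraints in `S` with base values `X`: the *internal* steps (in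
`int`) are violated instances of constraints of `S`, with new nulls, and the *external* steps (in
`ext`) are arbitrary ones all of whose head values are in `X`. -/
structure IsRun (S : Set (Constraint ar C V)) (X : Set (Value C N)) (R : Trace ar C N V)
    (int ext : Set ℕ) : Prop where
  fin_int : int.Finite
  fin_ext : ext.Finite
  disj : Disjoint int ext
  init_fin : R.init.Finite
  init_sub : dom R.init ⊆ X
  ext_facts : ∀ m ∈ ext, dom ((R.con m).headFacts (R.val m)) ⊆ X
  ext_univ : ∀ m ∈ ext, ∀ x ∈ (R.con m).headUniv, R.val m x ∈ X
  con_mem : ∀ m ∈ int, R.con m ∈ S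
  const_mem : ∀ m ∈ int, ∀ c ∈ (R.con m).headConsts, Value.const c ∈ X
  null : ∀ m ∈ int, ∀ y ∈ (R.con m).exVars, ∃ n, R.val m y = Value.null n
  inj : ∀ m ∈ int, Set.InjOn (R.val m) (R.con m).exVars
  new : ∀ m ∈ int, ∀ v ∈ R.born m, v ∉ X
  unique : ∀ m ∈ int, ∀ m' ∈ int, ∀ v ∈ R.born m, v ∈ R.born m' → m = m'
  enabled : ∀ m ∈ int, R.Enables (before (int ∪ ext) m) m
  violated : ∀ m ∈ int, R.Violated (before (int ∪ ext) m) m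
  consistent : ∀ c c', R.eqv (int ∪ ext) (Value.const c) (Value.const c') → c = c'

/-- The values used by the internal steps in `P` are known after the steps in `P`. -/
structure Closed (X : Set (Value C N)) (R : Trace ar C N V) (int ext P : Set ℕ) : Prop where
  sub : P ⊆ int ∪ ext
  known : ∀ p ∈ P, p ∈ int → ∀ x ∈ (R.con p).headUniv, R.val p x ∈ R.names X int P

variable {S : Set (Constraint ar C V)} {X : Set (Value C N)} {R : Trace ar C N V}
  {int ext P Q : Set ℕ}

/-! ### Closed sets of steps and the values known to them -/

namespace IsRun

theorem facts_names (h : IsRun S X R int ext) (hP : Closed X R int ext P) :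
    dom (R.facts P) ⊆ R.names X int P := by
  intro v hv
  obtain ⟨f, hf | ⟨p, hp, hf⟩, q, hq⟩ := mem_dom_iff.1 hv
  · exact Or.inl (h.init_sub (mem_dom_iff.2 ⟨f, hf, q, hq⟩))
  · by_cases hi : p ∈ int
    · obtain ⟨c, hc, rfl⟩ | ⟨y, hy, rfl⟩ | ⟨x, hx, rfl⟩ := Constraint.headFacts_cases hf hq
      · exact Or.inl (h.const_mem p hi c hc)
      · exact Or.inr ⟨p, hp, hi, y, hy, rfl⟩
      · exact hP.known p hp hi x hx
    · have he : p ∈ ext := (hP.sub hp).resolve_left hi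
      exact Or.inl (h.ext_facts p he (mem_dom_iff.2 ⟨f, hf, q, hq⟩))

theorem univ_names (h : IsRun S X R int ext) (hP : Closed X R int ext P) {p : ℕ} (hp : p ∈ P)
    {x : V} (hx : x ∈ (R.con p).headUniv) : R.val p x ∈ R.names X int P := by
  rcases hP.sub hp with hi | he
  · exact hP.known p hp hi x hx
  · exact Or.inl (h.ext_univ p he x hx)

/-- Only known values are equated with others. -/
theorem eqv_names (h : IsRun S X R int ext) (hP : Closed X R int ext P) {v w : Value C N}
    (hvw : R.eqv P v w) : v = w ∨ (v ∈ R.names X int P ∧ w ∈ R.names X int P) := by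
  refine Trace.eqv_induction (r := fun v w => v = w ∨ (v ∈ R.names X int P ∧ w ∈ R.names X int P))
    ⟨fun _ => Or.inl rfl, ?_, ?_⟩ ?_ hvw
  · rintro _ _ (rfl | h) <;> tauto
  · rintro _ _ _ (rfl | h) (rfl | h') <;> tauto
  · intro p hp v w he
    obtain ⟨x, hx, rfl⟩ := he.exists_left
    obtain ⟨y, hy, rfl⟩ := he.exists_right
    exact Or.inr ⟨h.univ_names hP hp hx, h.univ_names hP hp hy⟩

theorem eqv_mem_names (h : IsRun S X R int ext) (hP : Closed X R int ext P) {v w : Value C N}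
    (hvw : R.eqv P v w) (hv : v ∈ R.names X int P) : w ∈ R.names X int P := by
  rcases h.eqv_names hP hvw with rfl | h'
  · exact hv
  · exact h'.2

theorem enables_names (h : IsRun S X R int ext) (hP : Closed X R int ext P) {m : ℕ}
    (hm : R.Enables P m) {x : V} (hx : x ∈ vars (R.con m).body) :
    R.val m x ∈ R.names X int P := by
  obtain ⟨p, a, ha, hxa⟩ := hx
  obtain ⟨f, hf, hs⟩ := hm a ha
  have hs' := RAtom.Sim.symm (fun _ _ => Trace.eqv_symm) hs
  obtain ⟨w, hw, hvw⟩ := hs'.atPos (RAtom.atPos_map.2 ⟨_, hxa, rfl⟩)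
  exact h.eqv_mem_names hP (Trace.eqv_symm hvw) (h.facts_names hP (mem_dom_iff.2 ⟨f, hf, p, hw⟩))

/-- A set of steps that are enabled by earlier ones is closed. -/
theorem closed_of_enabled (h : IsRun S X R int ext) {B : Set ℕ} (hB : Closed X R int ext B)
    (hP : P ⊆ int ∪ ext) (hen : ∀ m ∈ P, m ∈ int → m ∉ B → R.Enables (B ∪ before P m) m) :
    Closed X R int ext (B ∪ P) := by
  -- Induction along the order of the steps: a step enabled by a closed set uses only values known
  -- to that set.
  have key : ∀ n, Closed X R int ext (B ∪ before P n) := by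
    intro n
    induction n with
    | zero =>
      have : before P 0 = ∅ := by ext; simp
      rw [this, Set.union_empty]; exact hB
    | succ n ih =>
      refine ⟨Set.union_subset hB.sub (Set.inter_subset_left.trans hP), ?_⟩
      rintro p hp hi x hx
      have hsub : B ∪ before P n ⊆ B ∪ before P (n + 1) :=
        Set.union_subset_union_right _ (Set.inter_subset_inter_right _
          (Set.Iio_subset_Iio (Nat.le_succ n)))
      by_cases hp' : p ∈ B ∪ before P n
      · exact Trace.names_mono hsub (ih.known p hp' hi x hx)
      · obtain hp | ⟨hp, hlt⟩ := hp
        · exact absurd (Or.inl hp) hp'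
        · have hpn : p = n := by
            by_contra hne
            exact hp' (Or.inr ⟨hp, lt_of_le_of_ne (Nat.lt_succ_iff.1 hlt) hne⟩)
          subst hpn
          exact Trace.names_mono hsub (h.enables_names ih
            (hen p hp hi fun hb => hp' (Or.inl hb)) ((R.con p).headUniv_subset hx))
  refine ⟨Set.union_subset hB.sub hP, fun p hp hi x hx => ?_⟩
  have hsub : B ∪ before P (p + 1) ⊆ B ∪ P :=
    Set.union_subset_union_right _ Set.inter_subset_left
  refine Trace.names_mono hsub ((key (p + 1)).known p ?_ hi x hx)
  exact hp.imp id fun hp => ⟨hp, Nat.lt_succ_self p⟩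

theorem closed_ext (h : IsRun S X R int ext) (hP : P ⊆ ext) : Closed X R int ext P :=
  ⟨hP.trans Set.subset_union_right, fun _ hp hi =>
    absurd (hP hp) (Set.disjoint_left.1 h.disj hi)⟩

theorem closed_before (h : IsRun S X R int ext) (n : ℕ) :
    Closed X R int ext (before (int ∪ ext) n) := by
  have := h.closed_of_enabled (B := ∅) (P := before (int ∪ ext) n)
    (h.closed_ext (Set.empty_subset _)) Set.inter_subset_left (fun m hm hi _ => by
      rw [Set.empty_union]
      refine (h.enabled m hi).mono ?_
      rintro p ⟨hp, hpm⟩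
      exact ⟨⟨hp, lt_trans (Set.mem_Iio.1 hpm) (Set.mem_Iio.1 hm.2)⟩, hpm⟩)
  rwa [Set.empty_union] at this

theorem closed_act (h : IsRun S X R int ext) : Closed X R int ext (int ∪ ext) := by
  have := h.closed_of_enabled (B := ∅) (P := int ∪ ext)
    (h.closed_ext (Set.empty_subset _)) subset_rfl (fun m hm hi _ => by
      rw [Set.empty_union]
      exact h.enabled m hi)
  rwa [Set.empty_union] at this

/-- The values used by an internal step are in `X` or were created before. -/
theorem names_before (h : IsRun S X R int ext) {m : ℕ} (hm : m ∈ int) {x : V}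
    (hx : x ∈ vars (R.con m).body) : R.val m x ∈ R.names X int (before (int ∪ ext) m) :=
  h.enables_names (h.closed_before m) (h.enabled m hm) hx

theorem closed_union (_h : IsRun S X R int ext) (hP : Closed X R int ext P)
    (hQ : Closed X R int ext Q) : Closed X R int ext (P ∪ Q) := by
  refine ⟨Set.union_subset hP.sub hQ.sub, ?_⟩
  rintro p (hp | hp) hi x hx
  · exact Trace.names_mono Set.subset_union_left (hP.known p hp hi x hx)
  · exact Trace.names_mono Set.subset_union_right (hQ.known p hp hi x hx)

/-- A null created by a step is not known to a closed set of other steps. -/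
theorem born_notMem_names (h : IsRun S X R int ext) {m : ℕ} (hm : m ∈ int) (hP : m ∉ P)
    {v : Value C N} (hv : v ∈ R.born m) : v ∉ R.names X int P := by
  rintro (hX | ⟨p, hp, hi, hvp⟩)
  · exact h.new m hm v hv hX
  · exact hP (h.unique m hm p hi v hv hvp ▸ hp)

end IsRun
end Chase

namespace Chase

variable {Rel C N V : Type*} {ar : Rel → ℕ}

/-! ### Representatives and exact steps -/

section Rep

variable {K : Type*} [LinearOrder K] [WellFoundedLT K] (key : Value C N → K)

/-- The values of the steps are the least ones, with respect to `key`, among the values to which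
they are equal at that time. -/
structure Canonical (R : Trace ar C N V) (int ext : Set ℕ) : Prop where
  inj : Function.Injective key
  const_first : ∀ c v, key v ≤ key (Value.const c) → ∃ c', v = Value.const c'
  body_le : ∀ m ∈ int, ∀ x ∈ vars (R.con m).body, ∀ w,
    R.eqv (before (int ∪ ext) m) w (R.val m x) → key (R.val m x) ≤ key w
  univ_le : ∀ m ∈ int ∪ ext, ∀ x ∈ (R.con m).headUniv, ∀ w,
    R.eqv (before (int ∪ ext) m) w (R.val m x) → key (R.val m x) ≤ key w

namespace Trace

variable (R : Trace ar C N V)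

/-- The least value equal to `v` after the steps in `P`. -/
noncomputable def rep (P : Set ℕ) (v : Value C N) : Value C N :=
  Function.argminOn key {w | R.eqv P w v} ⟨v, eqv_refl P v⟩

/-- The instance after the steps in `P`: the facts, with values replaced by representatives. -/
noncomputable def inst (P : Set ℕ) : Inst ar C N := RAtom.map (R.rep key P) '' R.facts P

variable {R} {key} {P Q : Set ℕ}

theorem rep_eqv (P : Set ℕ) (v : Value C N) : R.eqv P (R.rep key P v) v :=
  Function.argminOn_mem key {w | R.eqv P w v} ⟨v, eqv_refl P v⟩

theorem rep_le {v w : Value C N} (h : R.eqv P w v) : key (R.rep key P v) ≤ key w :=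
  Function.argminOn_le key {w | R.eqv P w v} h

theorem rep_unique (hk : Function.Injective key) {u v : Value C N} (h : R.eqv P u v)
    (hle : ∀ w, R.eqv P w v → key u ≤ key w) : R.rep key P v = u :=
  hk (le_antisymm (rep_le h) (hle _ (rep_eqv P v)))

theorem rep_congr (hk : Function.Injective key) {v w : Value C N} (h : R.eqv P v w) :
    R.rep key P v = R.rep key P w :=
  rep_unique hk (eqv_trans (rep_eqv P w) (eqv_symm h)) fun _ hu => rep_le (eqv_trans hu h)

theorem eqv_of_rep_eq {v w : Value C N} (h : R.rep key P v = R.rep key P w) : R.eqv P v w :=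
  eqv_trans (eqv_symm (rep_eqv P v)) (h ▸ rep_eqv P w)

theorem sim_iff (hk : Function.Injective key) {f g : RAtom ar (Value C N)} :
    f.Sim (R.eqv P) g ↔ f.map (R.rep key P) = g.map (R.rep key P) := by
  refine ⟨RAtom.Sim.map_eq (g := R.rep key P) fun _ _ h => rep_congr hk h, fun h => ?_⟩
  have h1 : ∀ a : RAtom ar (Value C N), (a.map (R.rep key P)).Sim (R.eqv P) a := fun a =>
    ⟨a.rel, _, _, rfl, rfl, fun i => rep_eqv P _⟩
  exact sim_trans (RAtom.Sim.symm (fun _ _ => eqv_symm) (h1 f)) (h ▸ h1 g)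

/-- A redundant equation changes nothing. -/
theorem eqv_insert_iff {m : ℕ}
    (hm : ∀ v w, (R.con m).Equates (R.val m) v w → R.eqv P v w) {v w : Value C N} :
    R.eqv (insert m P) v w ↔ R.eqv P v w := by
  refine ⟨fun h => ?_, eqv_mono (Set.subset_insert _ _)⟩
  refine eqv_induction ⟨eqv_refl P, eqv_symm, eqv_trans⟩ ?_ h
  rintro p (rfl | hp) v w he
  · exact hm v w he
  · exact eqv_of_equates hp he

theorem rep_insert (hk : Function.Injective key) {m : ℕ}
    (hm : ∀ v w, (R.con m).Equates (R.val m) v w → R.eqv P v w) (v : Value C N) :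
    R.rep key (insert m P) v = R.rep key P v :=
  rep_unique hk ((eqv_insert_iff hm).2 (rep_eqv P v)) fun _ hw =>
    rep_le ((eqv_insert_iff hm).1 hw)

theorem facts_insert (m : ℕ) :
    R.facts (insert m P) = R.facts P ∪ (R.con m).headFacts (R.val m) := by
  ext f
  constructor
  · rintro (hf | ⟨p, rfl | hp, hf⟩)
    · exact Or.inl (Or.inl hf)
    · exact Or.inr hf
    · exact Or.inl (Or.inr ⟨p, hp, hf⟩)
  · rintro ((hf | ⟨p, hp, hf⟩) | hf)
    · exact Or.inl hf
    · exact Or.inr ⟨p, Or.inr hp, hf⟩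
    · exact Or.inr ⟨m, Or.inl rfl, hf⟩

/-- The representative after one more equation. -/
theorem rep_insert_equates (hk : Function.Injective key) {m : ℕ} {a b : Value C N}
    (hab : R.eqv (insert m P) a b) (hm : ∀ v w, (R.con m).Equates (R.val m) v w →
      (R.eqv P v a ∧ R.eqv P w b) ∨ (R.eqv P v b ∧ R.eqv P w a))
    (hlt : key (R.rep key P a) < key (R.rep key P b)) [DecidableEq (Value C N)] (v : Value C N) :
    R.rep key (insert m P) v =
      if R.rep key P v = R.rep key P b then R.rep key P a else R.rep key P v := by
  -- `φ` is constant on the classes of the enlarged equivalence, stays in the class of its argument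
  -- and never increases `key`. These three properties single out the least representative.
  set φ : Value C N → Value C N :=
    fun v => if R.rep key P v = R.rep key P b then R.rep key P a else R.rep key P v with hφ
  have hne : R.rep key P a ≠ R.rep key P b := fun h => (h ▸ hlt).ne rfl
  have hsub : P ⊆ insert m P := Set.subset_insert _ _
  have hφa : ∀ u, R.eqv P u a → φ u = R.rep key P a := fun u hu => by
    simp only [hφ, rep_congr hk hu]
    rw [if_neg hne]
  have hφb : ∀ u, R.eqv P u b → φ u = R.rep key P a := fun u hu => by
    simp only [hφ, rep_congr hk hu, if_true]
  have hconst : ∀ u w, R.eqv (insert m P) u w → φ u = φ w := by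
    intro u w h
    refine eqv_induction (r := fun u w => φ u = φ w)
      ⟨fun _ => rfl, fun h => h.symm, fun h h' => h.trans h'⟩ ?_ h
    rintro p (rfl | hp) u w he
    · rcases hm u w he with ⟨h1, h2⟩ | ⟨h1, h2⟩
      · rw [hφa u h1, hφb w h2]
      · rw [hφb u h1, hφa w h2]
    · have := rep_congr hk (eqv_of_equates hp he)
      simp only [hφ, this]
  have hle : ∀ u, key (φ u) ≤ key u := by
    intro u
    simp only [hφ]
    split_ifs with h
    · exact hlt.le.trans (h ▸ rep_le (eqv_refl P u))
    · exact rep_le (eqv_refl P u)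
  refine rep_unique hk (u := φ v) ?_ fun w hw => hconst w v hw ▸ hle w
  simp only [hφ]
  split_ifs with h
  · refine eqv_trans (eqv_mono hsub (rep_eqv P a)) (eqv_trans hab ?_)
    exact eqv_mono hsub (eqv_symm (eqv_of_rep_eq h))
  · exact eqv_mono hsub (rep_eqv P v)

end Trace

open Classical in
/-- The parameters of step `m` when it is performed after the steps in `P`. -/
noncomputable def Trace.exactVal (R : Trace ar C N V) (P : Set ℕ) (m : ℕ) : V → Value C N :=
  fun x => if x ∈ vars (R.con m).body then R.rep key P (R.val m x) else R.val m x

open Classical in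
/-- Step `m`, to be performed on the instance after the steps in `P`. For equations, the greater
value is replaced. -/
noncomputable def Trace.exact (R : Trace ar C N V) (P : Set ℕ) (m : ℕ) : Step ar C N V where
  constraint := R.con m
  val := R.exactVal key P m
  swap := match R.con m with
    | .tgd _ => false
    | .egd e => decide (key (R.exactVal key P m e.rhs) < key (R.exactVal key P m e.lhs))

variable {S : Set (Constraint ar C V)} {X : Set (Value C N)} {R : Trace ar C N V}
  {int ext P Q : Set ℕ} {key}

/-! ### Realising traces by instances of representatives -/

namespace IsRun

/-- No null precedes a constant with respect to `key`, and `consistent` keeps distinct constants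
inequivalent; so a class that contains a constant is represented by it. -/
theorem rep_const (h : IsRun S X R int ext) (hc : Canonical key R int ext)
    (hP : P ⊆ int ∪ ext) (c : C) : R.rep key P (Value.const c) = Value.const c := by
  obtain ⟨c', hc'⟩ := hc.const_first c _ (Trace.rep_le (Trace.eqv_refl P _))
  rw [hc']
  have := Trace.rep_eqv (R := R) (key := key) P (Value.const c)
  rw [hc'] at this
  rw [h.consistent _ _ (Trace.eqv_mono hP this)]

theorem rep_of_notMem (h : IsRun S X R int ext) (hP : Closed X R int ext P) {v : Value C N}
    (hv : v ∉ R.names X int P) : R.rep key P v = v :=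
  (h.eqv_names hP (Trace.rep_eqv P v)).resolve_right fun h' => hv h'.2

/-- The values of a step are their own representatives at that time. -/
theorem rep_target (hc : Canonical key R int ext) {i : ℕ} (hi : i ∈ int)
    (hP : P ⊆ before (int ∪ ext) i) {x : V} (hx : x ∈ vars (R.con i).body) :
    R.rep key P (R.val i x) = R.val i x :=
  Trace.rep_unique hc.inj (Trace.eqv_refl P _) fun w hw =>
    hc.body_le i hi x hx w (Trace.eqv_mono hP hw)

/-- The representatives of the values of a step only depend on the later equations. -/
theorem rep_body (hc : Canonical key R int ext) (hQ : Q ⊆ int ∪ ext) {m : ℕ}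
    (hm : m ∈ int) {x : V} (hx : x ∈ vars (R.con m).body) :
    R.rep key Q (R.val m x) = R.rep key (Q ∩ Set.Ici m) (R.val m x) := by
  set B := before (int ∪ ext) m
  have hself : R.rep key B (R.val m x) = R.val m x := rep_target hc hm subset_rfl hx
  -- Passing to representatives with respect to `B` makes the equations before `m` trivial. It
  -- leaves the later ones as they are, because their parameters are already least in their classes.
  have key1 : ∀ v w, R.eqv Q v w →
      R.eqv (Q ∩ Set.Ici m) (R.rep key B v) (R.rep key B w) := by
    intro v w h
    refine Trace.eqv_induction
      (r := fun v w => R.eqv (Q ∩ Set.Ici m) (R.rep key B v) (R.rep key B w))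
      ⟨fun _ => Trace.eqv_refl _ _, Trace.eqv_symm, Trace.eqv_trans⟩ ?_ h
    intro p hp v w he
    rcases lt_or_ge p m with hlt | hge
    · have : p ∈ B := ⟨hQ hp, hlt⟩
      rw [Trace.rep_congr hc.inj (Trace.eqv_of_equates this he)]
      exact Trace.eqv_refl _ _
    · have hfix : ∀ y ∈ (R.con p).headUniv, R.rep key B (R.val p y) = R.val p y := by
        intro y hy
        refine Trace.rep_unique hc.inj (Trace.eqv_refl B _) fun w hw => ?_
        refine hc.univ_le p (hQ hp) y hy w (Trace.eqv_mono ?_ hw)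
        exact Set.inter_subset_inter_right _ (Set.Iio_subset_Iio hge)
      obtain ⟨y, hy, rfl⟩ := he.exists_left
      obtain ⟨z, hz, rfl⟩ := he.exists_right
      rw [hfix y hy, hfix z hz]
      exact Trace.eqv_of_equates (P := Q ∩ Set.Ici m) ⟨hp, hge⟩ he
  refine Trace.rep_unique hc.inj (Trace.eqv_mono Set.inter_subset_left (Trace.rep_eqv _ _)) ?_
  intro w hw
  have h1 := key1 w _ hw
  rw [hself] at h1
  exact (Trace.rep_le h1).trans (Trace.rep_le (Trace.eqv_refl B w))

/-- The parameters of a step are insensitive to the equations of earlier steps. They can therefore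
be fixed once, for the starting instance, and kept when other steps of a list are performed or
omitted, as `≺` demands. -/
theorem exact_congr (hc : Canonical key R int ext) (hP : P ⊆ int ∪ ext) (hQ : Q ⊆ int ∪ ext)
    {m : ℕ} (hm : m ∈ int) (hPQ : P ∩ Set.Ici m = Q ∩ Set.Ici m) :
    R.exact key P m = R.exact key Q m := by
  have : R.exactVal key P m = R.exactVal key Q m := by
    funext x
    simp only [Trace.exactVal]
    split_ifs with hx
    · rw [rep_body hc hP hm hx, rep_body hc hQ hm hx, hPQ]
    · rfl
  simp only [Trace.exact, this]

theorem map_rep_body (h : IsRun S X R int ext) (hc : Canonical key R int ext)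
    (hP : P ⊆ int ∪ ext) {m : ℕ} {a : RAtom ar (Term C V)} (ha : a ∈ (R.con m).body) :
    (a.map (Term.eval (R.val m))).map (R.rep key P) = a.map (Term.eval (R.exactVal key P m)) := by
  rw [RAtom.map_map]
  refine RAtom.map_congr a fun p u hu => ?_
  cases u with
  | const c => exact h.rep_const hc hP c
  | var x =>
    have hx : x ∈ vars (R.con m).body := mem_vars_of_atPos ha hu
    simp only [Function.comp, Term.eval, Trace.exactVal, if_pos hx]

/-- Among representatives equivalence is equality, so matches up to equivalence become literal
homomorphisms. -/
theorem holds_inst_iff (h : IsRun S X R int ext) (hc : Canonical key R int ext)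
    (hP : P ⊆ int ∪ ext) {m : ℕ} :
    Holds (R.inst key P) (R.con m).body (R.exactVal key P m) ↔ R.Enables P m := by
  refine forall₂_congr fun a ha => ?_
  rw [← h.map_rep_body hc hP ha]
  constructor
  · rintro ⟨f, hf, hfa⟩
    exact ⟨f, hf, (Trace.sim_iff hc.inj).2 hfa⟩
  · rintro ⟨f, hf, hfa⟩
    exact ⟨f, hf, (Trace.sim_iff hc.inj).1 hfa⟩

theorem dom_inst (h : IsRun S X R int ext) (hP : Closed X R int ext P) :
    dom (R.inst key P) ⊆ R.names X int P := by
  intro v hv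
  obtain ⟨_, ⟨f, hf, rfl⟩, p, hp⟩ := mem_dom_iff.1 hv
  obtain ⟨u, hu, rfl⟩ := RAtom.atPos_map.1 hp
  exact h.eqv_mem_names hP (Trace.eqv_symm (Trace.rep_eqv P u))
    (h.facts_names hP (mem_dom_iff.2 ⟨f, hf, p, hu⟩))

theorem exact_fresh (h : IsRun S X R int ext) (hP : Closed X R int ext P) {m : ℕ}
    (hm : m ∈ int) (hmP : m ∉ P) : (R.exact key Q m).Fresh (R.inst key P) := by
  unfold Step.Fresh Trace.exact
  cases hcon : R.con m with
  | egd e => trivial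
  | tgd t =>
    intro y hy hdom
    have hex : y ∈ (R.con m).exVars := by rw [hcon]; exact hy
    have : R.exactVal key Q m y = R.val m y := by
      simp only [Trace.exactVal, if_neg (Constraint.notMem_body_of_exVars hex)]
    simp only at hdom
    rw [this] at hdom
    exact h.born_notMem_names hm hmP ⟨y, hex, rfl⟩ (h.dom_inst hP hdom)

/-- Performing step `m`. -/
theorem exact_apply (h : IsRun S X R int ext) (hc : Canonical key R int ext)
    (hP : Closed X R int ext P) {m : ℕ} (hm : m ∈ int) (hmP : m ∉ P)
    (hne : ∀ v w, (R.con m).Equates (R.val m) v w → ¬ R.eqv P v w) :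
    (R.exact key P m).apply (R.inst key P) = R.inst key (insert m P) := by
  classical
  cases hcon : R.con m with
  | tgd t =>
    have h0 : ∀ v w, (R.con m).Equates (R.val m) v w → R.eqv P v w := by
      intro v w he; rw [hcon] at he; exact he.elim
    -- Constants and the nulls created by the step itself are their own representatives, so taking
    -- representatives commutes with evaluating the head.
    have hhead : ∀ a ∈ t.head, (a.map (Term.eval (R.val m))).map (R.rep key P) =
        a.map (Term.eval (R.exactVal key P m)) := by
      intro a ha
      rw [RAtom.map_map]
      refine RAtom.map_congr a fun p u hu => ?_
      cases u with
      | const c => exact h.rep_const hc hP.sub c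
      | var x =>
        simp only [Function.comp, Term.eval, Trace.exactVal]
        split_ifs with hx
        · rfl
        · rw [hcon] at hx
          have hex : x ∈ (R.con m).exVars := by
            rw [hcon]; exact ⟨mem_vars_of_atPos ha hu, hx⟩
          exact h.rep_of_notMem hP (h.born_notMem_names hm hmP ⟨x, hex, rfl⟩)
    have hrep : R.rep key (insert m P) = R.rep key P := funext (Trace.rep_insert hc.inj h0)
    simp only [Trace.inst, Trace.facts_insert, hrep, Set.image_union, hcon]
    simp only [Step.apply, Trace.exact]
    rw [hcon]
    simp only
    congr 1
    ext f
    simp only [Constraint.headFacts, Set.mem_image, Set.mem_ofPred_eq]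
    constructor
    · rintro ⟨a, ha, rfl⟩
      exact ⟨_, ⟨a, ha, rfl⟩, hhead a ha⟩
    · rintro ⟨_, ⟨a, ha, rfl⟩, rfl⟩
      exact ⟨a, ha, hhead a ha⟩
  | egd e =>
    have hbl : e.lhs ∈ vars (R.con m).body := by rw [hcon]; exact e.lhs_mem
    have hbr : e.rhs ∈ vars (R.con m).body := by rw [hcon]; exact e.rhs_mem
    have hel : R.exactVal key P m e.lhs = R.rep key P (R.val m e.lhs) := by
      simp only [Trace.exactVal, if_pos hbl]
    have her : R.exactVal key P m e.rhs = R.rep key P (R.val m e.rhs) := by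
      simp only [Trace.exactVal, if_pos hbr]
    have heq : (R.con m).Equates (R.val m) (R.val m e.lhs) (R.val m e.rhs) := by
      rw [hcon]; exact ⟨rfl, rfl⟩
    have hins := Trace.eqv_of_equates (Set.mem_insert m P) heq
    have hne' : R.rep key P (R.val m e.lhs) ≠ R.rep key P (R.val m e.rhs) :=
      fun h' => hne _ _ heq (Trace.eqv_of_rep_eq h')
    have hfacts : R.facts (insert m P) = R.facts P := by
      rw [Trace.facts_insert, hcon]; exact Set.union_empty _
    simp only [Trace.inst, hfacts]
    simp only [Step.apply, Trace.exact]
    rw [hcon]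
    simp only [replaceValue, hel, her, ← Set.image_comp]
    -- The step replaces the greater of the two representatives, which is the one that is no longer
    -- least once the classes are merged.
    by_cases hlt : key (R.rep key P (R.val m e.rhs)) < key (R.rep key P (R.val m e.lhs))
    · simp only [hlt, decide_true, EGD.old, EGD.new, hel, her]
      refine Set.image_congr fun f _ => ?_
      simp only [Function.comp, RAtom.map_map]
      congr 1
      funext v
      rw [Trace.rep_insert_equates hc.inj (Trace.eqv_symm hins) ?_ hlt v]
      · rfl
      · intro v w he
        rw [hcon] at he
        obtain ⟨rfl, rfl⟩ := he
        exact Or.inr ⟨Trace.eqv_refl _ _, Trace.eqv_refl _ _⟩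
    · have hlt' := lt_of_le_of_ne (not_lt.1 hlt) fun h' => hne' (hc.inj h')
      simp only [hlt, decide_false, EGD.old, EGD.new, hel, her]
      refine Set.image_congr fun f _ => ?_
      simp only [Function.comp, RAtom.map_map]
      congr 1
      funext v
      rw [Trace.rep_insert_equates hc.inj hins ?_ hlt' v]
      · rfl
      · intro v w he
        rw [hcon] at he
        obtain ⟨rfl, rfl⟩ := he
        exact Or.inl ⟨Trace.eqv_refl _ _, Trace.eqv_refl _ _⟩

theorem exact_enabled_iff (h : IsRun S X R int ext) (hc : Canonical key R int ext)
    (hP : Closed X R int ext P) {m : ℕ} (hm : m ∈ int) (hmP : m ∉ P) :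
    (R.exact key P m).Enabled (R.inst key P) ↔
      R.Enables P m ∧ ∀ v w, (R.con m).Equates (R.val m) v w → ¬ R.eqv P v w := by
  have hf := h.exact_fresh (key := key) (Q := P) hP hm hmP
  have hb := h.holds_inst_iff hc hP.sub (m := m)
  unfold Step.Enabled
  rw [and_iff_right hf]
  simp only [Trace.exact]
  cases hcon : R.con m with
  | tgd t =>
    rw [hcon] at hb
    have hv : ∀ y ∈ t.exVars, R.exactVal key P m y = R.val m y := fun y hy => by
      have hex : y ∈ (R.con m).exVars := by rw [hcon]; exact hy
      simp only [Trace.exactVal, if_neg (Constraint.notMem_body_of_exVars hex)]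
    simp only
    constructor
    · rintro ⟨h1, -, -⟩
      exact ⟨hb.1 h1, fun v w he => he.elim⟩
    · rintro ⟨h1, -⟩
      refine ⟨hb.2 h1, fun y hy => ?_, fun y hy z hz hyz => ?_⟩
      · rw [hv y hy]
        exact h.null m hm y (by rw [hcon]; exact hy)
      · rw [hv y hy, hv z hz] at hyz
        exact h.inj m hm (by rw [hcon]; exact hy) (by rw [hcon]; exact hz) hyz
  | egd e =>
    have hbl : e.lhs ∈ vars (R.con m).body := by rw [hcon]; exact e.lhs_mem
    have hbr : e.rhs ∈ vars (R.con m).body := by rw [hcon]; exact e.rhs_mem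
    have hel : R.exactVal key P m e.lhs = R.rep key P (R.val m e.lhs) := by
      simp only [Trace.exactVal, if_pos hbl]
    have her : R.exactVal key P m e.rhs = R.rep key P (R.val m e.rhs) := by
      simp only [Trace.exactVal, if_pos hbr]
    rw [hcon] at hb
    simp only
    constructor
    · rintro ⟨h1, h2, -⟩
      refine ⟨hb.1 h1, ?_⟩
      rintro v w ⟨rfl, rfl⟩ he
      rw [hel, her] at h2
      exact h2 (Trace.rep_congr hc.inj he)
    · rintro ⟨h1, h2⟩
      have hne : R.rep key P (R.val m e.lhs) ≠ R.rep key P (R.val m e.rhs) :=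
        fun h' => h2 _ _ ⟨rfl, rfl⟩ (Trace.eqv_of_rep_eq h')
      refine ⟨hb.2 h1, by rwa [hel, her], ?_⟩
      -- The greater of two distinct equated representatives is a null: otherwise both would be
      -- constants, and these would coincide by consistency.
      have hnull : ∀ v w, R.rep key P v ≠ R.rep key P w → R.eqv (int ∪ ext) v w →
          key (R.rep key P v) ≤ key (R.rep key P w) → ∃ n, R.rep key P w = Value.null n := by
        intro v w hvw he hle
        cases hw : R.rep key P w with
        | null n => exact ⟨n, rfl⟩
        | const c =>
          exfalso
          rw [hw] at hle
          obtain ⟨c', hc'⟩ := hc.const_first c _ hle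
          have h3 := Trace.rep_eqv (R := R) (key := key) P v
          have h4 := Trace.rep_eqv (R := R) (key := key) P w
          have h5 := Trace.eqv_trans (Trace.eqv_mono hP.sub h3)
            (Trace.eqv_trans he (Trace.eqv_symm (Trace.eqv_mono hP.sub h4)))
          rw [hw, hc'] at h5
          rw [hw, hc', h.consistent _ _ h5] at hvw
          exact hvw rfl
      have heq : R.eqv (int ∪ ext) (R.val m e.lhs) (R.val m e.rhs) :=
        Trace.eqv_of_equates (Or.inl hm) (by rw [hcon]; exact ⟨rfl, rfl⟩)
      by_cases hlt : key (R.rep key P (R.val m e.rhs)) < key (R.rep key P (R.val m e.lhs))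
      · simp only [hel, her, hlt, decide_true, EGD.old]
        exact hnull _ _ hne.symm (Trace.eqv_symm heq) hlt.le
      · simp only [hel, her, hlt, decide_false, EGD.old]
        exact hnull _ _ hne heq (not_lt.1 hlt)

end IsRun
end Rep
end Chase

namespace Chase

variable {Rel C N V : Type*} {ar : Rel → ℕ} {K : Type*} [LinearOrder K] [WellFoundedLT K]
  {key : Value C N → K} {S : Set (Constraint ar C V)} {X : Set (Value C N)} {R : Trace ar C N V}
  {int ext P Q : Set ℕ}

/-! ### Performing several steps -/

namespace Trace

/-- The steps of the list are enabled one after the other, after those in `P`. -/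
def Valid (R : Trace ar C N V) : Set ℕ → List ℕ → Prop
  | _, [] => True
  | P, t :: l => R.Enables P t ∧ R.Valid (insert t P) l

/-- The steps of the list can be performed one after the other, after those in `P`: they are enabled
and their equations are not redundant. -/
def Performable (R : Trace ar C N V) : Set ℕ → List ℕ → Prop
  | _, [] => True
  | P, t :: l => R.Enables P t ∧ (∀ v w, (R.con t).Equates (R.val t) v w → ¬ R.eqv P v w) ∧
      R.Performable (insert t P) l

/-- The steps in `P` and those of the list. -/
abbrev _root_.Chase.adjoin (P : Set ℕ) (l : List ℕ) : Set ℕ := P ∪ {t | t ∈ l}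

theorem _root_.Chase.adjoin_nil (P : Set ℕ) : adjoin P [] = P := by
  ext; simp [adjoin]

theorem _root_.Chase.adjoin_cons (P : Set ℕ) (t : ℕ) (l : List ℕ) :
    adjoin P (t :: l) = adjoin (insert t P) l := by
  ext s
  simp only [adjoin, Set.mem_union, Set.mem_ofPred_eq, List.mem_cons, Set.mem_insert_iff]
  tauto

theorem Performable.valid {l : List ℕ} : ∀ {P : Set ℕ}, R.Performable P l → R.Valid P l := by
  induction l with
  | nil => exact fun _ => trivial
  | cons t l ih => exact fun hv => ⟨hv.1, ih hv.2.2⟩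

/-- Adding a step whose facts and equations are known changes nothing. -/
theorem enables_insert {t m : ℕ} (ht : ∀ f ∈ (R.con t).headFacts (R.val t), f ∈ R.facts P)
    (he : ∀ v w, (R.con t).Equates (R.val t) v w → R.eqv P v w) (hm : R.Enables (insert t P) m) :
    R.Enables P m := by
  intro a ha
  obtain ⟨f, hf, hs⟩ := hm a ha
  refine ⟨f, ?_, hs.mono fun _ _ => (eqv_insert_iff he).1⟩
  rw [facts_insert] at hf
  exact hf.elim id (ht f)

theorem headFacts_eq_empty {t : ℕ} {v w : Value C N} (h : (R.con t).Equates (R.val t) v w) :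
    (R.con t).headFacts (R.val t) = ∅ := by
  cases hc : R.con t with
  | tgd => rw [hc] at h; exact h.elim
  | egd => rfl

theorem equates_unique {t : ℕ} {v w v' w' : Value C N} (h : (R.con t).Equates (R.val t) v w)
    (h' : (R.con t).Equates (R.val t) v' w') : v = v' ∧ w = w' := by
  cases hc : R.con t with
  | tgd => rw [hc] at h; exact h.elim
  | egd e =>
    rw [hc] at h h'
    exact ⟨h.1.trans h'.1.symm, h.2.trans h'.2.symm⟩

/-- An equation that already holds contributes neither facts nor equalities, and this remains so
after any further steps. Oblivious steps with such equations are not allowed, so they have to be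
removable from lists. -/
theorem valid_of_redundant {t : ℕ} {v w : Value C N} (h : (R.con t).Equates (R.val t) v w)
    {l : List ℕ} : ∀ {P : Set ℕ}, R.eqv P v w → R.Valid (insert t P) l →
      R.Valid P l ∧ ∀ m, R.Enables (adjoin (insert t P) l) m → R.Enables (adjoin P l) m := by
  have key1 : ∀ {P : Set ℕ}, R.eqv P v w → ∀ m, R.Enables (insert t P) m → R.Enables P m := by
    intro P hP m
    refine enables_insert ?_ ?_
    · rw [headFacts_eq_empty h]; exact fun _ hf => hf.elim
    · intro v' w' h'
      obtain ⟨rfl, rfl⟩ := equates_unique h h'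
      exact hP
  induction l with
  | nil =>
    intro P hP _
    simp only [adjoin_nil]
    exact ⟨trivial, key1 hP⟩
  | cons s l ih =>
    intro P hP hv
    have hP' := eqv_mono (Set.subset_insert s P) hP
    obtain ⟨h1, h2⟩ := hv
    rw [Set.insert_comm] at h2
    obtain ⟨h3, h4⟩ := ih hP' h2
    rw [adjoin_cons, adjoin_cons, Set.insert_comm]
    exact ⟨⟨key1 hP s h1, h3⟩, h4⟩

/-- A valid list is performable or has a redundant member. -/
theorem Valid.performable_or {l : List ℕ} : ∀ {P : Set ℕ}, R.Valid P l → R.Performable P l ∨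
    ∃ q < l.length, R.Valid P (l.eraseIdx q) ∧
      ∀ m, R.Enables (adjoin P l) m → R.Enables (adjoin P (l.eraseIdx q)) m := by
  induction l with
  | nil => exact fun _ => Or.inl trivial
  | cons t l ih =>
    intro P hv
    by_cases hr : ∃ v w, (R.con t).Equates (R.val t) v w ∧ R.eqv P v w
    · obtain ⟨v, w, h1, h2⟩ := hr
      refine Or.inr ⟨0, Nat.succ_pos _, ?_⟩
      rw [List.eraseIdx_zero, List.tail_cons, adjoin_cons]
      exact valid_of_redundant h1 h2 hv.2
    · push Not at hr
      rcases ih hv.2 with h | ⟨q, hq, h1, h2⟩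
      · exact Or.inl ⟨hv.1, hr, h⟩
      · refine Or.inr ⟨q + 1, Nat.succ_lt_succ hq, ⟨hv.1, h1⟩, ?_⟩
        rw [List.eraseIdx_cons_succ, adjoin_cons, adjoin_cons]
        exact h2

end Trace

namespace IsRun

theorem closed_insert (h : IsRun S X R int ext) (hP : Closed X R int ext P) {t : ℕ}
    (ht : t ∈ int) (hen : R.Enables P t) : Closed X R int ext (insert t P) := by
  refine ⟨Set.insert_subset (Or.inl ht) hP.sub, ?_⟩
  rintro p (rfl | hp) hi x hx
  · exact Trace.names_mono (Set.subset_insert _ _)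
      (h.enables_names hP hen ((R.con p).headUniv_subset hx))
  · exact Trace.names_mono (Set.subset_insert _ _) (hP.known p hp hi x hx)

theorem inst_finite (h : IsRun S X R int ext) (hP : P ⊆ int ∪ ext) :
    (R.inst key P).Finite := by
  refine Set.Finite.image _ ?_
  have hfin : P.Finite := (h.fin_int.union h.fin_ext).subset hP
  have : R.facts P ⊆ R.init ∪ ⋃ p ∈ P, (R.con p).headFacts (R.val p) := by
    rintro f (hf | ⟨p, hp, hf⟩)
    · exact Or.inl hf
    · exact Or.inr (Set.mem_biUnion hp hf)
  refine (h.init_fin.union (hfin.biUnion fun p _ => ?_)).subset this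
  cases R.con p with
  | egd e => exact Set.finite_empty
  | tgd t =>
    refine (t.head.finite_toSet.image fun a => a.map (Term.eval (R.val p))).subset ?_
    rintro f ⟨a, ha, rfl⟩
    exact ⟨a, ha, rfl⟩

/-- Performing an increasing list of steps, with the parameters fixed in advance. -/
theorem executable_iff (h : IsRun S X R int ext) (hc : Canonical key R int ext) {l : List ℕ} :
    ∀ {P : Set ℕ}, Closed X R int ext P → l.Pairwise (· < ·) → (∀ t ∈ l, t ∈ int ∧ t ∉ P) →
    (Executable (R.inst key P) (l.map (R.exact key P)) ↔ R.Performable P l) ∧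
    (R.Performable P l →
      runSteps (R.inst key P) (l.map (R.exact key P)) = R.inst key (adjoin P l) ∧
      ∀ (i : ℕ) (hi : i < (l.map (R.exact key P)).length), ∀ j ≤ i,
        (l.map (R.exact key P))[i].Fresh
          (runSteps (R.inst key P) ((l.map (R.exact key P)).take j))) := by
  induction l with
  | nil =>
    intro P _ _ _
    refine ⟨Iff.rfl, fun _ => ⟨by rw [adjoin_nil]; rfl, fun i hi => absurd hi (Nat.not_lt_zero i)⟩⟩
  | cons t l ih =>
    intro P hP hs hl
    obtain ⟨hs1, hs2⟩ := List.pairwise_cons.1 hs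
    obtain ⟨hti, htP⟩ := hl t List.mem_cons_self
    have hen := h.exact_enabled_iff hc hP hti htP
    -- All later members of the list come after `t`, so their parameters do not change when `t`
    -- joins the starting set.
    have hmap : R.Enables P t → l.map (R.exact key P) = l.map (R.exact key (insert t P)) := by
      intro hE
      refine List.map_congr_left fun s hs => ?_
      refine exact_congr hc hP.sub (h.closed_insert hP hti hE).sub
        (hl s (List.mem_cons_of_mem _ hs)).1 ?_
      ext u
      simp only [Set.mem_inter_iff, Set.mem_insert_iff, Set.mem_Ici]
      have := hs1 s hs
      constructor
      · rintro ⟨h1, h2⟩; exact ⟨Or.inr h1, h2⟩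
      · rintro ⟨rfl | h1, h2⟩
        · omega
        · exact ⟨h1, h2⟩
    have hl' : ∀ s ∈ l, s ∈ int ∧ s ∉ insert t P := by
      intro s hs
      refine ⟨(hl s (List.mem_cons_of_mem _ hs)).1, ?_⟩
      rintro (h' | h')
      · exact (hs1 s hs).ne' h'
      · exact (hl s (List.mem_cons_of_mem _ hs)).2 h'
    constructor
    · rw [List.map_cons]
      simp only [Executable, Trace.Performable]
      rw [hen, and_assoc]
      refine and_congr_right fun hE => and_congr_right fun hne => ?_
      rw [h.exact_apply hc hP hti htP hne, hmap hE]
      exact (ih (h.closed_insert hP hti hE) hs2 hl').1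
    · rintro ⟨hE, hne, hp⟩
      obtain ⟨h1, h2⟩ := (ih (h.closed_insert hP hti hE) hs2 hl').2 hp
      have hrun : ∀ l', runSteps (R.inst key P) (R.exact key P t :: l') =
          runSteps (R.inst key (insert t P)) l' := by
        intro l'
        rw [← h.exact_apply hc hP hti htP hne]
        rfl
      rw [List.map_cons]
      constructor
      · rw [hrun, hmap hE, adjoin_cons]
        exact h1
      · intro i hi j hj
        -- For `j = 0` the instance is the starting one, which knows no null of a listed step;
        -- positive `j` are covered by the induction hypothesis after the first step.
        rcases j with _ | j
        · simp only [List.take_zero]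
          have hmem : ((R.exact key P t :: l.map (R.exact key P))[i]) ∈
              (t :: l).map (R.exact key P) := List.getElem_mem _
          obtain ⟨s, hs, hs'⟩ := List.mem_map.1 hmem
          rw [← hs']
          exact h.exact_fresh hP (hl s hs).1 (hl s hs).2
        · rcases i with _ | i
          · omega
          · have hi' : i < (l.map (R.exact key (insert t P))).length := by
              rw [← hmap hE]; simpa using hi
            have := h2 i hi' j (by omega)
            rw [List.take_succ_cons, hrun]
            simp only [List.getElem_cons_succ]
            simp only [hmap hE]
            exact this

/-- The values of step `i` are least among all values equal to them before `i`. Hence the target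
keeps the same parameters in every instance formed from earlier steps. -/
theorem holds_target_iff (h : IsRun S X R int ext) (hc : Canonical key R int ext) {i : ℕ}
    (hi : i ∈ int) (hP : P ⊆ before (int ∪ ext) i) :
    Holds (R.inst key P) (R.con i).body (R.val i) ↔ R.Enables P i := by
  rw [← h.holds_inst_iff hc (hP.trans Set.inter_subset_left)]
  have : R.exactVal key P i = R.val i := by
    funext x
    simp only [Trace.exactVal]
    split_ifs with hx
    · exact rep_target hc hi hP hx
    · rfl
  rw [this]

/-- Satisfaction is vacuous here, the body being unmatched. This yields both the satisfaction in the
starting instance and the necessity of each step. -/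
theorem sat_of_not_enables (h : IsRun S X R int ext) (hc : Canonical key R int ext) {i : ℕ}
    (hi : i ∈ int) (hP : P ⊆ before (int ∪ ext) i) (hen : ¬ R.Enables P i) :
    Sat (R.inst key P) (R.con i) (R.val i) := by
  have := mt (h.holds_target_iff hc hi hP).1 hen
  unfold Sat
  split
  · next heq => rw [heq] at this; exact fun hh => absurd hh this
  · next heq => rw [heq] at this; exact fun hh => absurd hh this

/-- Violation is inherited by smaller sets of steps. So, on sets of earlier steps, whether the
target is violated depends only on whether its body is matched. -/
theorem not_sat_of_enables (h : IsRun S X R int ext) (hc : Canonical key R int ext) {i : ℕ}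
    (hi : i ∈ int) (hP : P ⊆ before (int ∪ ext) i) (hen : R.Enables P i) :
    ¬ Sat (R.inst key P) (R.con i) (R.val i) := by
  have hb := (h.holds_target_iff hc hi hP).2 hen
  have hv := (h.violated i hi).anti hP
  have hrep := fun x hx => rep_target (x := x) hc hi hP hx
  unfold Sat
  unfold Trace.Violated at hv
  split
  · next t heq =>
    rw [heq] at hb hv hrep
    intro hs
    obtain ⟨ν, hν, hh⟩ := hs hb
    refine hv ν (fun x hx => hν x hx ▸ Trace.eqv_refl _ _) fun a ha => ?_
    obtain ⟨f, hf, hfa⟩ := hh a ha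
    refine ⟨f, hf, ?_⟩
    have h1 : f.Sim (R.eqv P) (f.map (R.rep key P)) :=
      ⟨f.rel, _, _, rfl, rfl, fun i => Trace.eqv_symm (Trace.rep_eqv P _)⟩
    exact hfa ▸ h1
  · next e heq =>
    rw [heq] at hb hv
    exact fun hs => hv (hs hb ▸ Trace.eqv_refl _ _)

/-- A minimal list of steps that enables the step `i` is a witness of `≺`. -/
theorem prec_of_minimal (h : IsRun S X R int ext) (hc : Canonical key R int ext)
    (hP : Closed X R int ext P) {i : ℕ} (hi : i ∈ int) (hPi : P ⊆ before (int ∪ ext) i)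
    {l : List ℕ} (hs : l.Pairwise (· < ·)) (hl : ∀ t ∈ l, t ∈ int ∧ t ∉ P ∧ t < i)
    (hv : R.Valid P l) (hen : R.Enables (adjoin P l) i) (hnP : ¬ R.Enables P i)
    (hmin : ∀ q < l.length, R.Valid P (l.eraseIdx q) → ¬ R.Enables (adjoin P (l.eraseIdx q)) i)
    {f : Set (Position ar)} (hw : ∃ x ∈ (R.con i).headUniv, ∃ n, R.val i x = Value.null n ∧
      nullPos S {n} (R.inst key P) ⊆ f) :
    Prec N S (l.length + 1) f (l.map R.con ++ [R.con i]) := by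
  have hsub : ∀ l' : List ℕ, (∀ t ∈ l', t ∈ l) → adjoin P l' ⊆ before (int ∪ ext) i := by
    intro l' hl'
    refine Set.union_subset hPi fun t ht => ?_
    exact ⟨Or.inl (hl t (hl' t ht)).1, (hl t (hl' t ht)).2.2⟩
  have hl1 : ∀ t ∈ l, t ∈ int ∧ t ∉ P := fun t ht => ⟨(hl t ht).1, (hl t ht).2.1⟩
  -- A redundant equation could be dropped, contrary to the minimality of `l`.
  have hper : R.Performable P l := by
    rcases hv.performable_or with h' | ⟨q, hq, h1, h2⟩
    · exact h'
    · exact absurd (h2 i hen) (hmin q hq h1)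
  obtain ⟨he1, he2⟩ := h.executable_iff hc hP hs hl1
  obtain ⟨hr1, hr2⟩ := he2 hper
  refine ⟨?_, R.inst key P, l.map (R.exact key P), R.con i, R.val i, h.inst_finite hP.sub,
    by rw [List.length_map], ?_, he1.2 hper, hr2, ?_, hw, ?_, ?_⟩
  · intro α hα
    rcases List.mem_append.1 hα with hα | hα
    · obtain ⟨t, ht, rfl⟩ := List.mem_map.1 hα
      exact h.con_mem t (hl t ht).1
    · rw [List.mem_singleton.1 hα]
      exact h.con_mem i hi
  · rw [List.map_map]; rfl
  · rw [hr1]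
    exact h.not_sat_of_enables hc hi (hsub l fun _ => id) hen
  · exact h.sat_of_not_enables hc hi hPi hnP
  -- If the shortened list can still be performed it is valid, and by minimality it fails to match
  -- the body of the target.
  · intro q hq hex
    rw [List.length_map] at hq
    rw [List.eraseIdx_map] at hex ⊢
    have hsl := List.eraseIdx_sublist l q
    obtain ⟨h1, h2⟩ := h.executable_iff hc hP (hs.sublist hsl) fun t ht => hl1 t (hsl.subset ht)
    have hper' := h1.1 hex
    rw [(h2 hper').1]
    exact h.sat_of_not_enables hc hi (hsub _ fun t ht => hsl.subset ht)
      (hmin q hq hper'.valid)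

end IsRun
end Chase

namespace Chase

variable {Rel C N V : Type*} {ar : Rel → ℕ} {K : Type*} [LinearOrder K] [WellFoundedLT K]
  {key : Value C N → K} {S : Set (Constraint ar C V)} {X : Set (Value C N)} {R : Trace ar C N V}
  {int ext P Q : Set ℕ}

/-! ### Edges from necessary steps -/

theorem transGen_of_isChain {A : Type*} {E : A → A → Prop} {l : List A} {b : A}
    (h : (l ++ [b]).IsChain E) {a : A} (ha : a ∈ l) : Relation.TransGen E a b := by
  have h1 : (l ++ [b]).IsChain (Relation.TransGen E) := h.imp fun _ _ => Relation.TransGen.single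
  have h2 := (List.isChain_iff_pairwise.1 h1)
  exact (List.pairwise_append.1 h2).2.2 a ha b (List.mem_singleton.2 rfl)

/-- A discrete intermediate value theorem. -/
theorem exists_exact_of_step {D : ℕ → ℕ → Prop} {a b m : ℕ} (hb : D b m) (ha : ¬ D a m)
    (hab : a ≤ b) (hstep : ∀ l, a ≤ l → l < b → D (l + 1) m → D l (m + 1)) :
    ∃ l, a ≤ l ∧ l < b ∧ D l (m + 1) ∧ ¬ D l m := by
  induction b, hab using Nat.le_induction with
  | base => exact absurd hb ha
  | succ b hab ih =>
    by_cases hD : D b m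
    · obtain ⟨l, h1, h2, h3⟩ := ih hD fun l h1 h2 => hstep l h1 (Nat.lt_succ_of_lt h2)
      exact ⟨l, h1, Nat.lt_succ_of_lt h2, h3⟩
    · exact ⟨b, hab, Nat.lt_succ_self b, hstep b hab (Nat.lt_succ_self b) hb, hD⟩

theorem before_succ_of_mem {m : ℕ} (h : m ∈ P) : before P (m + 1) = insert m (before P m) := by
  ext s
  simp only [before, Set.mem_inter_iff, Set.mem_Iio, Set.mem_insert_iff]
  constructor
  · rintro ⟨h1, h2⟩
    rcases Nat.lt_succ_iff_lt_or_eq.1 h2 with h3 | h3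
    · exact Or.inr ⟨h1, h3⟩
    · exact Or.inl h3
  · rintro (rfl | ⟨h1, h2⟩)
    · exact ⟨h, Nat.lt_succ_self _⟩
    · exact ⟨h1, Nat.lt_succ_of_lt h2⟩

theorem before_succ_of_notMem {m : ℕ} (h : m ∉ P) : before P (m + 1) = before P m := by
  ext s
  simp only [before, Set.mem_inter_iff, Set.mem_Iio]
  refine and_congr_right fun h1 => ⟨fun h2 => ?_, Nat.lt_succ_of_lt⟩
  rcases Nat.lt_succ_iff_lt_or_eq.1 h2 with h3 | rfl
  · exact h3
  · exact absurd h1 h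

theorem before_mono {m n : ℕ} (h : m ≤ n) : before P m ⊆ before P n :=
  Set.inter_subset_inter_right _ (Set.Iio_subset_Iio h)

/-- There is an increasing list of at most `n` members of `W`, none before `l`, that together with
`P` enables step `i`. -/
def Reaches (R : Trace ar C N V) (W P : Set ℕ) (i l n : ℕ) : Prop :=
  ∃ T : List ℕ, T.Pairwise (· < ·) ∧ (∀ t ∈ T, t ∈ W ∧ l ≤ t) ∧ T.length ≤ n ∧ R.Valid P T ∧
    R.Enables (adjoin P T) i

theorem Reaches.mono {W : Set ℕ} {i l n n' : ℕ} (hn : n ≤ n') :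
    Reaches R W P i l n → Reaches R W P i l n' := by
  rintro ⟨T, h1, h2, h3, h4⟩
  exact ⟨T, h1, h2, h3.trans hn, h4⟩

/-- Together with `Reaches.succ`, this shows that moving the starting point back by one costs at
most one further step, which is the hypothesis of the intermediate value argument. -/
theorem Reaches.cons {W : Set ℕ} {i l n : ℕ} (hl : l ∈ W) (hen : R.Enables P l)
    (h : Reaches R W (insert l P) i (l + 1) n) : Reaches R W P i l (n + 1) := by
  obtain ⟨T, h1, h2, h3, h4, h5⟩ := h
  refine ⟨l :: T, List.pairwise_cons.2 ⟨fun t ht => (h2 t ht).2, h1⟩, ?_, Nat.succ_le_succ h3,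
    ⟨hen, h4⟩, by rwa [adjoin_cons]⟩
  intro t ht
  rcases List.mem_cons.1 ht with rfl | ht
  · exact ⟨hl, le_rfl⟩
  · exact ⟨(h2 t ht).1, (Nat.le_succ l).trans (h2 t ht).2⟩

theorem Reaches.succ {W : Set ℕ} {i l n : ℕ} (h : Reaches R W P i (l + 1) n) :
    Reaches R W P i l (n + 1) := by
  obtain ⟨T, h1, h2, h3, h4⟩ := h
  exact ⟨T, h1, fun t ht => ⟨(h2 t ht).1, (Nat.le_succ l).trans (h2 t ht).2⟩,
    h3.trans (Nat.le_succ n), h4⟩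

namespace IsRun

/-- If step `j` is necessary for step `i`, which is not enabled by `B` with fewer than `k - 1` more
steps, then there is a path from `j` to `i` in every `k`-restriction system. -/
theorem transGen_of_needed (h : IsRun S X R int ext) (hc : Canonical key R int ext) {k : ℕ}
    (hk : 2 ≤ k) {E : Constraint ar C V → Constraint ar C V → Prop} {f : Set (Position ar)}
    (hE : IsRestrictionSystem N S k E f) {i j : ℕ} (hi : i ∈ int) (hj : j ∈ int) (hji : j < i)
    {B G : Set ℕ} (hB : Closed X R int ext B) (hBi : B ⊆ before (int ∪ ext) i)
    (hext : before ext i ⊆ B) (hjB : j ∉ B) (hG : ∀ g ∈ G, g ∈ int ∧ j < g ∧ g < i ∧ g ∉ B)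
    (hGen : ∀ g ∈ G, R.Enables (B ∪ before (int ∪ ext) (j + 1) ∪ before G g) g)
    (hnen : ¬ R.Enables (B ∪ before (int ∪ ext) j ∪ G) i)
    (hen : R.Enables (B ∪ before (int ∪ ext) (j + 1) ∪ G) i)
    (hknow : ∀ g ∈ G, ∀ x ∈ (R.con g).headUniv, R.val g x ∉ R.born j)
    (hdeep : ∀ T : List ℕ, T.Pairwise (· < ·) → (∀ t ∈ T, t ∈ int ∧ t ∉ B ∧ t < i) →
      T.length + 2 ≤ k → R.Valid B T → ¬ R.Enables (adjoin B T) i)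
    (hw : ∃ x ∈ (R.con i).headUniv, ∃ n, R.val i x = Value.null n ∧
      ∀ P ⊆ B ∪ before (int ∪ ext) j ∪ G, nullPos S {n} (R.inst key P) ⊆ f) :
    Relation.TransGen E (R.con j) (R.con i) := by
  set act := int ∪ ext with hact
  have hjact : j ∈ act := Or.inl hj
  have hGi : G ⊆ before act i := fun g hg => ⟨Or.inl (hG g hg).1, (hG g hg).2.2.1⟩
  have hbj : before act (j + 1) = insert j (before act j) := before_succ_of_mem hjact
  have hnone : ∀ {P : Set ℕ}, P ⊆ B ∪ before act j ∪ G → ¬ R.Enables P i :=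
    fun hP hP' => hnen (hP'.mono hP)
  -- any witness of `≺` of the right length that contains `j` is sufficient
  have finish : ∀ {P : Set ℕ} {l : List ℕ}, Closed X R int ext P → P ⊆ B ∪ before act j ∪ G →
      l.length + 1 = k → l.Pairwise (· < ·) → (∀ t ∈ l, t ∈ int ∧ t ∉ P ∧ t < i) → R.Valid P l →
      R.Enables (adjoin P l) i →
      (∀ q < l.length, R.Valid P (l.eraseIdx q) → ¬ R.Enables (adjoin P (l.eraseIdx q)) i) →
      j ∈ l → Relation.TransGen E (R.con j) (R.con i) := by
    intro P l hP hPs hlk hs hl hv he hmin hjl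
    obtain ⟨x, hx, n, hn, hpos⟩ := hw
    have hPi : P ⊆ before act i := hPs.trans (Set.union_subset (Set.union_subset hBi
      (before_mono hji.le)) hGi)
    have hprec := h.prec_of_minimal hc hP hi hPi hs hl hv he (hnone hPs) hmin
      ⟨x, hx, n, hn, hpos P hPs⟩
    rw [hlk] at hprec
    exact transGen_of_isChain (hE.prec _ hprec) (List.mem_map_of_mem hjl)
  -- The starting set consists of `B`, all steps up to `j` and the members of `G` before `l`; at
  -- most `n` further members of `G` have to suffice for `i`.
  set D : ℕ → ℕ → Prop := fun l n => Reaches R G (B ∪ before act (j + 1) ∪ before G l) i l n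
    with hD
  have hDi : D i 0 := by
    refine ⟨[], List.Pairwise.nil, by simp, le_rfl, trivial, ?_⟩
    rw [adjoin_nil]
    have hGG : G ⊆ before G i := fun g hg => ⟨hg, (hG g hg).2.2.1⟩
    exact hen.mono (Set.union_subset_union_right _ hGG)
  have hDstep : ∀ l n, D (l + 1) n → D l (n + 1) := by
    intro l n hD'
    by_cases hl : l ∈ G
    · refine Reaches.cons hl (hGen l hl) ?_
      simp only [hD, before_succ_of_mem hl, Set.union_insert] at hD'
      exact hD'
    · simp only [hD, before_succ_of_notMem hl] at hD'
      exact hD'.succ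
  -- witnesses that start with `j`
  have first : ∀ l, j < l → D l (k - 2) → (∀ n, n + 1 = k - 2 → ¬ D l n) →
      Relation.TransGen E (R.con j) (R.con i) := by
    intro l hjl hDl hmin
    obtain ⟨T, hT1, hT2, hT3, hT4, hT5⟩ := hDl
    have hlen : T.length = k - 2 := by
      by_contra hne
      exact hmin (k - 3) (by omega) ⟨T, hT1, hT2, by omega, hT4, hT5⟩
    set P := B ∪ before act j ∪ before G l with hP
    have hins : insert j P = B ∪ before act (j + 1) ∪ before G l := by
      rw [hP, hbj, Set.union_insert, Set.insert_union]
    have hPs : P ⊆ B ∪ before act j ∪ G := Set.union_subset_union_right _ Set.inter_subset_left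
    have hcl : ∀ n, Closed X R int ext (B ∪ before act (j + 1) ∪ before G n) := by
      intro n
      refine h.closed_of_enabled (h.closed_union hB (h.closed_before _))
        (fun g hg => Or.inl (hG g hg.1).1) fun m hm _ _ => (hGen m hm.1).mono ?_
      exact Set.union_subset_union_right _ fun s hs =>
        ⟨⟨hs.1, lt_trans (Set.mem_Iio.1 hs.2) (Set.mem_Iio.1 hm.2)⟩, hs.2⟩
    -- Closedness survives the removal of `j`, because by `hknow` no member of `G` uses a null
    -- created by `j`.
    have hPc : Closed X R int ext P := by
      refine ⟨Set.union_subset (h.closed_union hB (h.closed_before _)).sub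
        fun g hg => Or.inl (hG g hg.1).1, ?_⟩
      rintro p (hp | hp) hpi x hx
      · exact Trace.names_mono Set.subset_union_left
          ((h.closed_union hB (h.closed_before j)).known p hp hpi x hx)
      · have h1 := (hcl l).known p (Or.inr hp) hpi x hx
        rw [← hins] at h1
        rcases h1 with h1 | ⟨q, hq | hq, h2, h3⟩
        · exact Or.inl h1
        · rw [hq] at h3
          exact absurd h3 (hknow p hp.1 x hx)
        · exact Or.inr ⟨q, hq, h2, h3⟩
    refine finish (P := P) (l := j :: T) hPc hPs ?_ ?_ ?_ ?_ ?_ ?_ List.mem_cons_self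
    · rw [List.length_cons]; omega
    · exact List.pairwise_cons.2 ⟨fun t ht => lt_of_lt_of_le hjl (hT2 t ht).2, hT1⟩
    · intro t ht
      rcases List.mem_cons.1 ht with rfl | ht
      · refine ⟨hj, ?_, hji⟩
        rintro ((hb | hb) | hb)
        · exact hjB hb
        · exact lt_irrefl _ (Set.mem_Iio.1 hb.2)
        · exact lt_irrefl _ (hG _ hb.1).2.1
      · obtain ⟨ht1, ht2⟩ := hT2 t ht
        obtain ⟨hg1, hg2, hg3, hg4⟩ := hG t ht1
        refine ⟨hg1, ?_, hg3⟩
        rintro ((hb | hb) | hb)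
        · exact hg4 hb
        · exact lt_asymm hg2 hb.2
        · exact absurd (Set.mem_Iio.1 hb.2) (not_lt.2 ht2)
    · refine ⟨(h.enabled j hj).mono (Set.subset_union_right.trans Set.subset_union_left), ?_⟩
      rw [hins]; exact hT4
    · rw [adjoin_cons, hins]; exact hT5
    · intro q hq hv he
      -- Without `j`, the list stays within a set that does not enable `i`. Without another member,
      -- fewer than `k - 2` members of `G` would suffice after `j`.
      rcases q with _ | q
      · rw [List.eraseIdx_zero, List.tail_cons] at he
        refine hnone ?_ he
        exact Set.union_subset hPs fun t ht => Or.inr (hT2 t ht).1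
      · rw [List.eraseIdx_cons_succ] at hv he
        rw [List.length_cons, Nat.add_lt_add_iff_right] at hq
        rw [adjoin_cons] at he
        have hv' := hv.2
        rw [hins] at he hv'
        have hsl := List.eraseIdx_sublist T q
        refine hmin (k - 3) (by omega) ⟨T.eraseIdx q, hT1.sublist hsl,
          fun t ht => hT2 t (hsl.subset ht), ?_, hv', he⟩
        rw [List.length_eraseIdx_of_lt hq]
        omega
  -- For `k = 2` the list is `j` alone, and all of `G` is already part of the starting set.
  rcases Nat.eq_or_lt_of_le hk with hk2 | hk2
  · refine first i hji ?_ fun n hn => by omega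
    rw [← hk2]; exact hDi
  obtain ⟨m, hm⟩ : ∃ m, k = m + 3 := ⟨k - 3, by omega⟩
  by_cases hDj : D (j + 1) m
  · -- `i` is reached with few steps from `j`; start earlier
    set W := {t | t ∈ int ∧ t ∉ B ∧ (t < j + 1 ∨ t ∈ G)} with hW
    set D' : ℕ → ℕ → Prop := fun l n => Reaches R W (B ∪ before act l) i l n with hD'
    have hb : D' (j + 1) (m + 1) := by
      obtain ⟨T, hT1, hT2, hT3, hT4, hT5⟩ := hDj
      have hempty : before G (j + 1) = ∅ := by
        ext g
        simp only [Set.mem_inter_iff, Set.mem_Iio, Set.mem_empty_iff_false, iff_false, not_and]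
        intro hg
        have := (hG g hg).2.1
        omega
      rw [hempty, Set.union_empty] at hT4 hT5
      refine ⟨T, hT1, fun t ht => ⟨?_, (hT2 t ht).2⟩, hT3.trans (Nat.le_succ m), hT4, hT5⟩
      have := hG t (hT2 t ht).1
      exact ⟨this.1, this.2.2.2, Or.inr (hT2 t ht).1⟩
    -- From `B` alone, `m + 1 = k - 2` steps are not enough; this is exactly `hdeep`.
    have ha : ¬ D' 0 (m + 1) := by
      rintro ⟨T, hT1, hT2, hT3, hT4, hT5⟩
      have hempty : before act 0 = ∅ := by
        ext g; simp
      rw [hempty, Set.union_empty] at hT4 hT5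
      refine hdeep T hT1 (fun t ht => ?_) (by omega) hT4 hT5
      obtain ⟨⟨h1, h2, h3⟩, -⟩ := hT2 t ht
      refine ⟨h1, h2, ?_⟩
      rcases h3 with h3 | h3
      · omega
      · exact (hG t h3).2.2.1
    -- So for some start `l ≤ j` the least number of steps is `m + 2 = k - 1`. Moving the start
    -- across an index that is in `B` or is no step does not change the starting set.
    obtain ⟨l, -, hlj, hDl, hnDl⟩ := exists_exact_of_step hb ha (Nat.zero_le _)
      fun l _ hl hD'' => by
      by_cases hlB : l ∈ int ∧ l ∉ B
      · refine Reaches.cons (W := W) ⟨hlB.1, hlB.2, Or.inl hl⟩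
          ((h.enabled l hlB.1).mono Set.subset_union_right) ?_
        simp only [hD', before_succ_of_mem (show l ∈ act from Or.inl hlB.1),
          Set.union_insert] at hD''
        exact hD''
      · have : B ∪ before act (l + 1) = B ∪ before act l := by
          by_cases hla : l ∈ act
          · rw [before_succ_of_mem hla, Set.union_insert]
            refine Set.insert_eq_of_mem (Or.inl ?_)
            by_contra hlB'
            have hle : l ∈ ext := hla.resolve_left fun hli => hlB ⟨hli, hlB'⟩
            exact hlB' (hext ⟨hle, Set.mem_Iio.2 (by omega)⟩)
          · rw [before_succ_of_notMem hla]
        simp only [hD', this] at hD''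
        exact hD''.succ
    obtain ⟨T, hT1, hT2, hT3, hT4, hT5⟩ := hDl
    have hlen : T.length = m + 2 := by
      by_contra hne
      exact hnDl ⟨T, hT1, hT2, by omega, hT4, hT5⟩
    have hPs : B ∪ before act l ⊆ B ∪ before act j ∪ G :=
      (Set.union_subset_union_right _ (before_mono (by omega))).trans Set.subset_union_left
    refine finish (P := B ∪ before act l) (l := T) (h.closed_union hB (h.closed_before l)) hPs
      (by omega) hT1 ?_ hT4 hT5 ?_ ?_
    · intro t ht
      obtain ⟨⟨h1, h2, h3⟩, h4⟩ := hT2 t ht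
      refine ⟨h1, ?_, ?_⟩
      · rintro (hb | hb)
        · exact h2 hb
        · exact absurd (Set.mem_Iio.1 hb.2) (not_lt.2 h4)
      · rcases h3 with h3 | h3
        · omega
        · exact (hG t h3).2.2.1
    · intro q hq hv he
      have hsl := List.eraseIdx_sublist T q
      refine hnDl ⟨T.eraseIdx q, hT1.sublist hsl, fun t ht => hT2 t (hsl.subset ht), ?_, hv, he⟩
      rw [List.length_eraseIdx_of_lt hq]
      omega
    -- A list that avoids `j` would enable `i` from `B`, the steps before `j` and `G`, which `hnen`
    -- excludes.
    · by_contra hjT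
      refine hnone (Set.union_subset hPs fun t ht => ?_) hT5
      obtain ⟨⟨h1, h2, h3⟩, h4⟩ := hT2 t ht
      rcases h3 with h3 | h3
      · refine Or.inl (Or.inr ⟨Or.inl h1, ?_⟩)
        rcases Nat.lt_succ_iff_lt_or_eq.1 h3 with h5 | rfl
        · exact h5
        · exact absurd ht hjT
      · exact Or.inr h3
  -- From `j + 1` more than `m = k - 3` members of `G` are needed, from `i` none are; at some `l` in
  -- between, the least number is `k - 2`, which leaves room for `j`.
  · obtain ⟨l, h1, -, h2, h3⟩ := exists_exact_of_step (D := D) (m := m)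
      (show D i m from Reaches.mono (Nat.zero_le m) hDi) hDj hji fun l _ _ => hDstep l m
    refine first l h1 ?_ ?_
    · have : k - 2 = m + 1 := by omega
      rw [this]; exact h2
    · intro n hn
      have : n = m := by omega
      rw [this]; exact h3

end IsRun
end Chase

namespace Chase

variable {Rel C N V : Type*} {ar : Rel → ℕ} {K : Type*} [LinearOrder K] [WellFoundedLT K]
  {key : Value C N → K} {S : Set (Constraint ar C V)} {X : Set (Value C N)} {R : Trace ar C N V}
  {int ext P Q : Set ℕ}

/-! ### Levels -/

namespace Trace

/-- The internal steps whose head values are equal to values in `Y` when they are performed. -/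
def stage (R : Trace ar C N V) (int ext : Set ℕ) (Y : Set (Value C N)) : Set ℕ :=
  {m | m ∈ int ∧ ∀ x ∈ (R.con m).headUniv, ∃ w ∈ Y,
    R.eqv (before (int ∪ ext) m) w (R.val m x)}

/-- The values obtained from those in `X` by `r` rounds of creating nulls. -/
def level (R : Trace ar C N V) (X : Set (Value C N)) (int ext : Set ℕ) : ℕ → Set (Value C N)
  | 0 => X
  | r + 1 => R.level X int ext r ∪ {v | ∃ m ∈ R.stage int ext (R.level X int ext r), v ∈ R.born m}

theorem stage_mono {Y Z : Set (Value C N)} (h : Y ⊆ Z) : R.stage int ext Y ⊆ R.stage int ext Z := by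
  rintro m ⟨hm, hx⟩
  refine ⟨hm, fun x hxm => ?_⟩
  obtain ⟨w, hw, hwx⟩ := hx x hxm
  exact ⟨w, h hw, hwx⟩

theorem level_mono {r s : ℕ} (h : r ≤ s) : R.level X int ext r ⊆ R.level X int ext s := by
  induction h with
  | refl => exact subset_rfl
  | step _ ih => exact ih.trans Set.subset_union_left

theorem subset_level (r : ℕ) : X ⊆ R.level X int ext r := level_mono (Nat.zero_le r)

theorem born_subset_level {r : ℕ} {m : ℕ} (hm : m ∈ R.stage int ext (R.level X int ext r)) :
    R.born m ⊆ R.level X int ext (r + 1) := fun _ hv => Or.inr ⟨m, hm, hv⟩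

theorem exists_born_of_mem_level {r : ℕ} {v : Value C N} (h : v ∈ R.level X int ext r) :
    v ∈ X ∨ ∃ s < r, ∃ m ∈ R.stage int ext (R.level X int ext s), v ∈ R.born m := by
  induction r with
  | zero => exact Or.inl h
  | succ r ih =>
    rcases h with h | ⟨m, hm, hv⟩
    · rcases ih h with h | ⟨s, hs, h⟩
      · exact Or.inl h
      · exact Or.inr ⟨s, Nat.lt_succ_of_lt hs, h⟩
    · exact Or.inr ⟨r, Nat.lt_succ_self r, m, hm, hv⟩

end Trace

open Trace

theorem RAtom.Sim.atPos' {T : Type*} {r : T → T → Prop} {a b : RAtom ar T} (h : a.Sim r b)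
    {p : Position ar} {v : T} (hv : b.AtPos p v) : ∃ w, a.AtPos p w ∧ r w v := by
  obtain ⟨R, u, w, rfl, rfl, hr⟩ := h
  obtain ⟨i, rfl, rfl⟩ := hv
  exact ⟨u i, ⟨i, rfl, rfl⟩, hr i⟩

/-- The values in the head of a constraint come from constants or variables. -/
theorem Constraint.exists_occursAt_of_headFacts {α : Constraint ar C V} {μ : V → Value C N}
    {f : RAtom ar (Value C N)} (hf : f ∈ α.headFacts μ) {p : Position ar} {v : Value C N}
    (hv : f.AtPos p v) : ∃ t, α = Constraint.tgd t ∧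
    ((∃ c ∈ α.headConsts, v = Value.const c) ∨ ∃ x, OccursAt t.head x p ∧ v = μ x) := by
  cases α with
  | egd e => exact hf.elim
  | tgd t =>
    refine ⟨t, rfl, ?_⟩
    obtain ⟨a, ha, rfl⟩ := hf
    obtain ⟨u, hu, rfl⟩ := RAtom.atPos_map.1 hv
    cases u with
    | const c => exact Or.inl ⟨c, ⟨a, ha, p, hu⟩, rfl⟩
    | var x => exact Or.inr ⟨x, occursAt_iff.2 ⟨a, ha, hu⟩, rfl⟩

theorem Trace.Enables.exists_fact {m : ℕ} (h : R.Enables P m) {x : V} {q : Position ar}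
    (hx : OccursAt (R.con m).body x q) :
    ∃ f ∈ R.facts P, ∃ w, f.AtPos q w ∧ R.eqv P w (R.val m x) := by
  obtain ⟨a, ha, hax⟩ := occursAt_iff.1 hx
  obtain ⟨f, hf, hs⟩ := h a ha
  obtain ⟨w, hw, hwx⟩ := hs.atPos' (RAtom.atPos_map.2 ⟨_, hax, rfl⟩)
  exact ⟨f, hf, w, hw, hwx⟩

theorem mem_nullPos_inst {n : N} {p : Position ar} (hp : p ∈ nullPos S {n} (R.inst key P)) :
    p ∈ pos S ∧ ∃ f ∈ R.facts P, ∃ w, f.AtPos p w ∧ R.eqv P w (Value.null n) := by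
  obtain ⟨h1, n', rfl, _, ⟨f, hf, rfl⟩, i, rfl, hi⟩ := hp
  refine ⟨h1, f, hf, f.args i, ⟨i, rfl, rfl⟩, ?_⟩
  rw [← hi]
  exact eqv_symm (rep_eqv P _)

theorem Trace.eqv_cases {v w : Value C N} (h : R.eqv P v w) :
    v = w ∨ (∃ p ∈ P, ∃ x ∈ (R.con p).headUniv, v = R.val p x) ∧
      ∃ p ∈ P, ∃ x ∈ (R.con p).headUniv, w = R.val p x := by
  refine eqv_induction (r := fun v w => v = w ∨
    (∃ p ∈ P, ∃ x ∈ (R.con p).headUniv, v = R.val p x) ∧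
      ∃ p ∈ P, ∃ x ∈ (R.con p).headUniv, w = R.val p x) ⟨fun _ => Or.inl rfl, ?_, ?_⟩ ?_ h
  · rintro _ _ (rfl | h)
    exacts [Or.inl rfl, Or.inr h.symm]
  · rintro _ _ _ (rfl | h) (rfl | h')
    exacts [Or.inl rfl, Or.inr h', Or.inr h, Or.inr ⟨h.1, h'.2⟩]
  · intro p hp v w he
    obtain ⟨x, hx⟩ := he.exists_left
    obtain ⟨y, hy⟩ := he.exists_right
    exact Or.inr ⟨⟨p, hp, x, hx⟩, ⟨p, hp, y, hy⟩⟩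

namespace IsRun

theorem stage_of_enables (h : IsRun S X R int ext) (hP : Closed X R int ext P)
    {Y : Set (Value C N)} (hY : R.names X int P ⊆ Y) {m : ℕ} (hm : m ∈ int)
    (hen : R.Enables P m) : m ∈ R.stage int ext Y :=
  ⟨hm, fun _ hx => ⟨_, hY (h.enables_names hP hen ((R.con m).headUniv_subset hx)), eqv_refl _ _⟩⟩

theorem closed_adjoin (h : IsRun S X R int ext) {l : List ℕ} :
    ∀ {P : Set ℕ}, Closed X R int ext P → (∀ t ∈ l, t ∈ int) → R.Valid P l →
      Closed X R int ext (adjoin P l) := by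
  induction l with
  | nil => intro P hP _ _; rwa [adjoin_nil]
  | cons t l ih =>
    intro P hP hl hv
    rw [adjoin_cons]
    exact ih (h.closed_insert hP (hl t List.mem_cons_self) hv.1)
      (fun s hs => hl s (List.mem_cons_of_mem t hs)) hv.2

theorem names_insert_subset {t r : ℕ} (hP : R.names X int P ⊆ R.level X int ext r)
    (ht : t ∈ R.stage int ext (R.level X int ext r)) :
    R.names X int (insert t P) ⊆ R.level X int ext (r + 1) := by
  rintro v (hv | ⟨p, rfl | hp, hpi, hv⟩)
  · exact subset_level _ hv
  · exact born_subset_level ht hv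
  · exact level_mono (Nat.le_succ r) (hP (Or.inr ⟨p, hp, hpi, hv⟩))

/-- Few steps only use values of low level. -/
theorem stage_of_valid (h : IsRun S X R int ext) {l : List ℕ} :
    ∀ {P : Set ℕ} {r : ℕ}, Closed X R int ext P → R.names X int P ⊆ R.level X int ext r →
      (∀ t ∈ l, t ∈ int) → R.Valid P l →
      (∀ t ∈ l, t ∈ R.stage int ext (R.level X int ext (r + l.length))) ∧
        R.names X int (adjoin P l) ⊆ R.level X int ext (r + l.length) := by
  induction l with
  | nil => intro P r _ hr _ _; rw [adjoin_nil]; exact ⟨by simp, hr⟩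
  | cons t l ih =>
    intro P r hP hr hl hv
    have ht := hl t List.mem_cons_self
    have hst := h.stage_of_enables hP hr ht hv.1
    obtain ⟨h1, h2⟩ := ih (r := r + 1) (h.closed_insert hP ht hv.1) (names_insert_subset hr hst)
      (fun s hs => hl s (List.mem_cons_of_mem t hs)) hv.2
    have hlen : r + (t :: l).length = r + 1 + l.length := by rw [List.length_cons]; omega
    rw [adjoin_cons, hlen]
    refine ⟨fun s hs => ?_, h2⟩
    rcases List.mem_cons.1 hs with rfl | hs
    · exact stage_mono (level_mono (by omega)) hst
    · exact h1 s hs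

theorem stage_of_enables_adjoin (h : IsRun S X R int ext) {l : List ℕ} {r i : ℕ}
    (hP : Closed X R int ext P) (hr : R.names X int P ⊆ R.level X int ext r)
    (hl : ∀ t ∈ l, t ∈ int) (hv : R.Valid P l) (hi : i ∈ int) (hen : R.Enables (adjoin P l) i) :
    i ∈ R.stage int ext (R.level X int ext (r + l.length)) :=
  h.stage_of_enables (h.closed_adjoin hP hl hv) (h.stage_of_valid hP hr hl hv).2 hi hen

theorem names_of_subset_ext (h : IsRun S X R int ext) (hP : P ⊆ ext) : R.names X int P ⊆ X := by
  rintro v (hv | ⟨p, hp, hpi, -⟩)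
  · exact hv
  · exact absurd (hP hp) (Set.disjoint_left.1 h.disj hpi)

/-- A step of high level is not enabled with the help of few steps. -/
theorem not_enables_of_deep (h : IsRun S X R int ext) {k i : ℕ} (hi : i ∈ int)
    (hdeep : i ∉ R.stage int ext (R.level X int ext (k - 2))) {l : List ℕ}
    (hl : ∀ t ∈ l, t ∈ int) (hlk : l.length + 2 ≤ k) (hP : P ⊆ ext) (hv : R.Valid P l) :
    ¬ R.Enables (adjoin P l) i := fun hen =>
  hdeep (stage_mono (level_mono (by omega)) (h.stage_of_enables_adjoin (r := 0)
    (h.closed_ext hP) (h.names_of_subset_ext hP) hl hv hi hen))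

/-- A name that was not mentioned is only equal to itself. -/
theorem eq_of_unmentioned (h : IsRun S X R int ext) (hP : P ⊆ int ∪ ext) {u w : Value C N}
    (hu : u ∉ X) (hm : ∀ m ∈ P, m ∈ int → ∀ x ∈ (R.con m).headUniv, R.val m x ≠ u)
    (hw : R.eqv P w u) : w = u := by
  rcases eqv_cases hw with h' | ⟨-, p, hp, x, hx, rfl⟩
  · exact h'
  · rcases hP hp with hpi | hpe
    · exact absurd rfl (hm p hp hpi x hx)
    · exact absurd (h.ext_univ p hpe x hx) hu

/-- A step that creates a null of high level has an edge to the first step that uses one of its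
nulls. -/
theorem transGen_of_first_use (h : IsRun S X R int ext) (hc : Canonical key R int ext) {k : ℕ}
    (hk : 2 ≤ k) {E : Constraint ar C V → Constraint ar C V → Prop} {f : Set (Position ar)}
    (hE : IsRestrictionSystem N S k E f) {b c : ℕ} (hb : b ∈ int) (hci : c ∈ int)
    {v : Value C N} (hv : v ∈ R.born b) (hvX : v ∉ R.level X int ext (k - 1))
    (huse : ∃ x ∈ (R.con c).headUniv, R.val c x ∈ R.born b)
    (hfirst : ∀ c' ∈ int, c' < c → ∀ x ∈ (R.con c').headUniv, R.val c' x ∉ R.born b) :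
    Relation.TransGen E (R.con b) (R.con c) := by
  obtain ⟨x, hx, hxb⟩ := huse
  set act := int ∪ ext with hact
  have huX : R.val c x ∉ X := h.new b hb _ hxb
  have born_eq : ∀ {q : ℕ}, q ∈ int → R.val c x ∈ R.born q → q = b := fun hq hv =>
    h.unique _ hq _ hb _ hv hxb
  have hbc : b < c := by
    rcases h.names_before hci ((R.con c).headUniv_subset hx) with h1 | ⟨q, hq, hqi, h1⟩
    · exact absurd h1 huX
    · rw [← born_eq hqi h1]; exact hq.2
  set G : Set ℕ := {g | g ∈ int ∧ b < g ∧ g < c} with hG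
  -- No step before `c` uses a null of `b`. Dropping `b` therefore leaves a closed set, and the null
  -- that `c` uses is unknown to it.
  have hHcl : Closed X R int ext (before ext c ∪ before act b ∪ G) := by
    refine ⟨?_, ?_⟩
    · rintro p ((hp | hp) | hp)
      · exact Or.inr hp.1
      · exact hp.1
      · exact Or.inl hp.1
    · rintro p hp hpi y hy
      have hpc : p < c := by
        rcases hp with (hp | hp) | hp
        · exact hp.2
        · exact lt_trans (Set.mem_Iio.1 hp.2) hbc
        · exact hp.2.2
      rcases h.names_before hpi ((R.con p).headUniv_subset hy) with h1 | ⟨q, hq, hqi, h1⟩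
      · exact Or.inl h1
      · refine Or.inr ⟨q, ?_, hqi, h1⟩
        have hqp : q < p := hq.2
        rcases lt_trichotomy q b with h2 | rfl | h2
        · exact Or.inl (Or.inr ⟨hq.1, h2⟩)
        · exact absurd h1 (hfirst p hpi hpc y hy)
        · exact Or.inr ⟨hqi, h2, hqp.trans hpc⟩
  have hbH : b ∉ before ext c ∪ before act b ∪ G := by
    rintro ((hp | hp) | hp)
    · exact Set.disjoint_left.1 h.disj hb hp.1
    · exact lt_irrefl _ (Set.mem_Iio.1 hp.2)
    · exact lt_irrefl _ hp.2.1
  have huH := h.born_notMem_names hb hbH hxb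
  have hbefore : ∀ {g}, b < g → g ≤ c →
      before act g ⊆ before ext c ∪ before act (b + 1) ∪ before G g := by
    rintro g hbg hgc q ⟨hq, hqg⟩
    have hqg' : q < g := hqg
    by_cases hqb : q < b + 1
    · exact Or.inl (Or.inr ⟨hq, hqb⟩)
    · rcases hq with hq | hq
      · exact Or.inr ⟨⟨hq, by omega, by omega⟩, hqg⟩
      · exact Or.inl (Or.inl ⟨hq, Set.mem_Iio.2 (by omega)⟩)
  refine h.transGen_of_needed hc hk hE hci hb hbc (B := before ext c) (G := G)
    (h.closed_ext Set.inter_subset_left) (fun p hp => ⟨Or.inr hp.1, hp.2⟩) subset_rfl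
    (fun hp => Set.disjoint_left.1 h.disj hb hp.1)
    (fun g hg => ⟨hg.1, hg.2.1, hg.2.2, fun hp => Set.disjoint_left.1 h.disj hg.1 hp.1⟩)
    (fun g hg => (h.enabled g hg.1).mono (hbefore hg.2.1 hg.2.2.le)) ?_ ?_ ?_ ?_ ?_
  · exact fun hen => huH (h.enables_names hHcl hen ((R.con c).headUniv_subset hx))
  · exact (h.enabled c hci).mono ((hbefore hbc le_rfl).trans
      (Set.union_subset_union_right _ Set.inter_subset_left))
  · exact fun g hg => hfirst g hg.1 hg.2.2
  · intro T _ hT hTk hTv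
    refine h.not_enables_of_deep hci ?_ (fun t ht => (hT t ht).1) hTk Set.inter_subset_left hTv
    -- The null of `b` used by `c` is no head parameter of an earlier internal step, so it equals
    -- only itself. If it had level `k - 2`, then `b` would have bounded stage and its null `v`
    -- would contradict `hvX`.
    rintro ⟨-, hst⟩
    obtain ⟨w, hw, hwu⟩ := hst x hx
    obtain rfl := h.eq_of_unmentioned Set.inter_subset_left huX
      (fun m hm hmi y hy he => hfirst m hmi hm.2 y hy (he ▸ hxb)) hwu
    rcases exists_born_of_mem_level hw with h1 | ⟨s, hs, m, hm, h1⟩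
    · exact huX h1
    · rw [born_eq hm.1 h1] at hm
      exact hvX (level_mono (by omega) (born_subset_level hm hv))
  -- The condition on positions holds vacuously: in the absence of `b`, its null occurs nowhere.
  · obtain ⟨y, hy, hyx⟩ := hxb
    obtain ⟨n, hn⟩ := h.null b hb y hy
    refine ⟨x, hx, n, hyx ▸ hn, fun P hP p hp => absurd ?_ huH⟩
    obtain ⟨-, f', hf', w, hw, hwn⟩ := mem_nullPos_inst hp
    rw [← hyx, hn]
    exact h.eqv_mem_names hHcl (eqv_mono hP hwn)
      (h.facts_names hHcl (mem_dom_iff.2 ⟨f', facts_mono hP hf', p, hw⟩))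

end IsRun
end Chase

namespace Chase

variable {Rel C N V : Type*} {ar : Rel → ℕ} {K : Type*} [LinearOrder K] [WellFoundedLT K]
  {key : Value C N → K} {S : Set (Constraint ar C V)} {X : Set (Value C N)} {R : Trace ar C N V}
  {int ext P Q : Set ℕ}

open Trace

/-! ### Positions of nulls of high level -/

/-- Before step `j`, the used values that are not equal to a value in `Y` occur, among the positions
in `pos S`, only in those in `f`. -/
def Confined (S : Set (Constraint ar C V)) (R : Trace ar C N V) (int ext : Set ℕ)
    (f : Set (Position ar)) (Y : Set (Value C N)) (j : ℕ) : Prop :=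
  ∀ v, (∀ w ∈ Y, ¬ R.eqv (before (int ∪ ext) j) w v) →
    (∃ c ∈ int, ∃ x ∈ (R.con c).headUniv, R.val c x = v) →
    ∀ a ∈ R.facts (before (int ∪ ext) j), ∀ p ∈ pos S, a.AtPos p v → p ∈ f

namespace IsRun

theorem exists_born_of_used (h : IsRun S X R int ext) {c : ℕ} (hc : c ∈ int) {x : V}
    (hx : x ∈ (R.con c).headUniv) (hX : R.val c x ∉ X) :
    ∃ b ∈ int, b < c ∧ R.val c x ∈ R.born b := by
  rcases h.names_before hc ((R.con c).headUniv_subset hx) with h1 | ⟨b, hb, hbi, h1⟩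
  · exact absurd h1 hX
  · exact ⟨b, hbi, hb.2, h1⟩

theorem used_of_eqv (h : IsRun S X R int ext) (hP : P ⊆ int ∪ ext) {v w : Value C N}
    (hvw : R.eqv P w v) (hw : w ∉ X) (hv : ∃ c ∈ int, ∃ x ∈ (R.con c).headUniv, R.val c x = v) :
    ∃ c ∈ int, ∃ x ∈ (R.con c).headUniv, R.val c x = w := by
  rcases eqv_cases hvw with rfl | ⟨⟨p, hp, x, hx, rfl⟩, -⟩
  · exact hv
  · rcases hP hp with hp | hp
    · exact ⟨p, hp, x, hx, rfl⟩
    · exact absurd (h.ext_univ p hp x hx) hw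

/-- This supplies the null required by `≺`. A step outside the stage of `Y` has a head value not
equal to any value in `Y`. This value is equal to its representative in the starting instance, and
confinement applies to every value equal to it. -/
theorem wild_of_confined (h : IsRun S X R int ext) {f : Set (Position ar)}
    {Y : Set (Value C N)} (hY : X ⊆ Y) {m : ℕ} (hm : m ∈ int) (hcon : Confined S R int ext f Y m)
    (hmY : m ∉ R.stage int ext Y) :
    ∃ x ∈ (R.con m).headUniv, ∃ n, R.val m x = Value.null n ∧
      ∀ P ⊆ before (int ∪ ext) m, nullPos S {n} (R.inst key P) ⊆ f := by
  obtain ⟨x, hx, hxY⟩ : ∃ x ∈ (R.con m).headUniv, ∀ w ∈ Y,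
      ¬ R.eqv (before (int ∪ ext) m) w (R.val m x) := by
    by_contra hcontra
    push Not at hcontra
    exact hmY ⟨hm, hcontra⟩
  have hX : R.val m x ∉ X := fun hX => hxY _ (hY hX) (eqv_refl _ _)
  obtain ⟨b, hb, -, y, hy, hyx⟩ := h.exists_born_of_used hm hx hX
  obtain ⟨n, hn⟩ := h.null b hb y hy
  have hxn : R.val m x = Value.null n := by rw [← hyx, hn]
  refine ⟨x, hx, n, hxn, fun P hP p hp => ?_⟩
  obtain ⟨hpS, a, ha, w, hw, hwn⟩ := mem_nullPos_inst hp
  rw [← hxn] at hwn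
  have hwm := eqv_mono hP hwn
  have hwY : ∀ u ∈ Y, ¬ R.eqv (before (int ∪ ext) m) u w := fun u hu hu' =>
    hxY u hu (eqv_trans hu' hwm)
  have hwX : w ∉ X := fun hwX => hwY w (hY hwX) (eqv_refl _ _)
  exact hcon w hwY (h.used_of_eqv Set.inter_subset_left hwm hwX ⟨m, hm, x, hx, rfl⟩) a
    (facts_mono hP ha) p hpS hw

/-- A step of high level has a predecessor. -/
theorem exists_transGen (h : IsRun S X R int ext) (hc : Canonical key R int ext) {k : ℕ}
    (hk : 2 ≤ k) {E : Constraint ar C V → Constraint ar C V → Prop} {f : Set (Position ar)}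
    (hE : IsRestrictionSystem N S k E f) {m : ℕ} (hm : m ∈ int)
    (hcon : Confined S R int ext f (R.level X int ext (k - 1)) m)
    (hmA : m ∉ R.stage int ext (R.level X int ext (k - 1))) :
    ∃ α, Relation.TransGen E α (R.con m) := by
  have hdeep : m ∉ R.stage int ext (R.level X int ext (k - 2)) := fun hm' =>
    hmA (stage_mono (level_mono (by omega)) hm')
  set D : ℕ → Prop := fun j => R.Enables (before ext m ∪ before (int ∪ ext) j) m with hD
  have h0 : ¬ D 0 := fun hen => hdeep (stage_mono (subset_level _)
    (h.stage_of_enables (h.closed_ext (Set.inter_subset_left (t := Set.Iio m)))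
      (h.names_of_subset_ext Set.inter_subset_left) hm
      (hen.mono (Set.union_subset subset_rfl fun q hq => absurd hq.2 (Nat.not_lt_zero q)))))
  have hm1 : D m := (h.enabled m hm).mono Set.subset_union_right
  -- Since external steps alone do not suffice, `m` becomes enabled when some step `j` is added; no
  -- helpers after `j` are needed.
  obtain ⟨j, hjm, hj1, hj2⟩ : ∃ j < m, ¬ D j ∧ D (j + 1) := by
    by_contra hcontra
    push Not at hcontra
    have : ∀ n ≤ m, ¬ D n := by
      intro n
      induction n with
      | zero => exact fun _ => h0
      | succ n ih => exact fun hn => hcontra n hn (ih (Nat.le_of_succ_le hn))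
    exact this m le_rfl hm1
  have hja : j ∈ int := by
    by_contra hji
    refine hj1 (hj2.mono (Set.union_subset Set.subset_union_left fun q hq => ?_))
    have hq2 : q < j + 1 := hq.2
    rcases Nat.lt_succ_iff_lt_or_eq.1 hq2 with h1 | rfl
    · exact Or.inr ⟨hq.1, h1⟩
    · exact Or.inl ⟨hq.1.resolve_left hji, hjm⟩
  refine ⟨_, h.transGen_of_needed hc hk hE hm hja hjm (B := before ext m) (G := ∅)
    (h.closed_ext Set.inter_subset_left) (fun p hp => ⟨Or.inr hp.1, hp.2⟩) subset_rfl
    (fun hp => Set.disjoint_left.1 h.disj hja hp.1) (by simp) (by simp) ?_ ?_ (by simp) ?_ ?_⟩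
  · rw [Set.union_empty]; exact hj1
  · rw [Set.union_empty]; exact hj2
  · intro T _ hT hTk hTv
    exact h.not_enables_of_deep hm hdeep (fun t ht => (hT t ht).1) hTk Set.inter_subset_left hTv
  · obtain ⟨x, hx, n, hn, hP⟩ := h.wild_of_confined (key := key) (subset_level _) hm hcon hmA
    refine ⟨x, hx, n, hn, fun P hP' => hP P (hP'.trans ?_)⟩
    rw [Set.union_empty]
    exact Set.union_subset (fun p hp => ⟨Or.inr hp.1, hp.2⟩) (before_mono hjm.le)

theorem affCl_subset_of_transGen_left {k : ℕ}
    {E : Constraint ar C V → Constraint ar C V → Prop} {f : Set (Position ar)}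
    (hE : IsRestrictionSystem N S k E f) {α β : Constraint ar C V}
    (h : Relation.TransGen E α β) : affCl α f ∩ pos S ⊆ f := by
  obtain ⟨γ, h, -⟩ := Relation.TransGen.head'_iff.1 h
  exact (hE.closed _ _ h).1

theorem affCl_subset_of_transGen_right {k : ℕ}
    {E : Constraint ar C V → Constraint ar C V → Prop} {f : Set (Position ar)}
    (hE : IsRestrictionSystem N S k E f) {α β : Constraint ar C V}
    (h : Relation.TransGen E α β) : affCl β f ∩ pos S ⊆ f := by
  obtain ⟨γ, -, h⟩ := Relation.TransGen.tail'_iff.1 h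
  exact (hE.closed _ _ h).2

theorem exists_first_use (b c : ℕ) (hc : c ∈ int)
    (huse : ∃ x ∈ (R.con c).headUniv, R.val c x ∈ R.born b) :
    ∃ c ∈ int, (∃ x ∈ (R.con c).headUniv, R.val c x ∈ R.born b) ∧
      ∀ c' ∈ int, c' < c → ∀ x ∈ (R.con c').headUniv, R.val c' x ∉ R.born b := by
  classical
  have hex : ∃ c, c ∈ int ∧ ∃ x ∈ (R.con c).headUniv, R.val c x ∈ R.born b := ⟨c, hc, huse⟩
  obtain ⟨h1, h2⟩ := Nat.find_spec hex
  exact ⟨_, h1, h2, fun c' hc' hlt x hx hb => Nat.find_min hex hlt ⟨hc', x, hx, hb⟩⟩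

/-- The nulls of high level are confined to the positions of a restriction system. -/
theorem confined (h : IsRun S X R int ext) (hc : Canonical key R int ext) {k : ℕ}
    (hk : 2 ≤ k) {E : Constraint ar C V → Constraint ar C V → Prop} {f : Set (Position ar)}
    (hE : IsRestrictionSystem N S k E f) (j : ℕ) :
    Confined S R int ext f (R.level X int ext (k - 1)) j := by
  induction j using Nat.strong_induction_on with
  | _ j ih =>
    intro v hv hused a ha p hp hap
    have hvX : v ∉ X := fun hX => hv v (subset_level _ hX) (eqv_refl _ _)
    rcases ha with ha | ⟨m, hm, ha⟩
    · exact absurd (h.init_sub (mem_dom_iff.2 ⟨a, ha, p, hap⟩)) hvX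
    have hmj : m < j := hm.2
    rcases hm.1 with hmi | hme
    swap
    · exact absurd (h.ext_facts m hme (mem_dom_iff.2 ⟨a, ha, p, hap⟩)) hvX
    obtain ⟨t, ht, ⟨c, hcc, rfl⟩ | ⟨x, hx, hvx⟩⟩ := Constraint.exists_occursAt_of_headFacts ha hap
    · exact absurd (h.const_mem m hmi c hcc) hvX
    by_cases hxb : x ∈ vars t.body
    · have hxu : x ∈ (R.con m).headUniv := by rw [ht]; exact ⟨⟨p, hx⟩, hxb⟩
      have huntame : ∀ w ∈ R.level X int ext (k - 1), ¬ R.eqv (before (int ∪ ext) m) w v :=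
        fun w hw hwv => hv w hw (eqv_mono (before_mono hmj.le) hwv)
      have hmA : m ∉ R.stage int ext (R.level X int ext (k - 1)) := by
        rintro ⟨-, hst⟩
        obtain ⟨w, hw, hwv⟩ := hst x hxu
        exact huntame w hw (hvx ▸ hwv)
      -- A step that copies a value of high level has an edge into it. Its `affCl` is therefore
      -- absorbed by `f`, once the body positions of the copied variable are known to lie in `f`;
      -- they do by induction.
      obtain ⟨α, hα⟩ := h.exists_transGen hc hk hE hmi (ih m hmj) hmA
      refine affCl_subset_of_transGen_right hE hα ⟨?_, hp⟩
      rw [ht]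
      refine ⟨x, hx, Or.inr ⟨hxb, fun q hq => ?_⟩⟩
      have hq' : OccursAt (R.con m).body x q := by rw [ht]; exact hq
      obtain ⟨f', hf', w, hw, hwv⟩ := (h.enabled m hmi).exists_fact hq'
      rw [← hvx] at hwv
      have hwY : ∀ u ∈ R.level X int ext (k - 1), ¬ R.eqv (before (int ∪ ext) m) u w :=
        fun u hu hu' => huntame u hu (eqv_trans hu' hwv)
      have hwX : w ∉ X := fun hwX => hwY w (subset_level _ hwX) (eqv_refl _ _)
      refine ih m hmj w hwY (h.used_of_eqv Set.inter_subset_left hwv hwX hused) f' hf' q ?_ hw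
      obtain ⟨a', ha', i, hi, -⟩ := hq'
      exact ⟨R.con m, h.con_mem m hmi, a', ha', i, hi⟩
    · have hxe : x ∈ (R.con m).exVars := by rw [ht]; exact ⟨⟨p, hx⟩, hxb⟩
      have hvb : v ∈ R.born m := ⟨x, hxe, hvx.symm⟩
      obtain ⟨c, hci, y, hy, hyv⟩ := hused
      -- The creating step has an edge out of it on a path to the first use of one of its nulls, so
      -- its existential positions that lie in `pos S` belong to `f`.
      obtain ⟨c, hci, huse, hfirst⟩ := exists_first_use m c hci ⟨y, hy, hyv ▸ hvb⟩
      have hmc := h.transGen_of_first_use hc hk hE hmi hci hvb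
        (fun hX => hv v hX (eqv_refl _ _)) huse hfirst
      refine affCl_subset_of_transGen_left hE hmc ⟨?_, hp⟩
      rw [ht]
      exact ⟨x, hx, Or.inl ⟨⟨p, hx⟩, hxb⟩⟩

end IsRun
end Chase

namespace Chase

variable {Rel C N V : Type*} {ar : Rel → ℕ} {K : Type*} [LinearOrder K] [WellFoundedLT K]
  {key : Value C N → K} {S : Set (Constraint ar C V)} {X : Set (Value C N)} {R : Trace ar C N V}
  {int ext A P Q : Set ℕ}

open Trace

/-! ### Which steps are needed for a step of high level -/

theorem Trace.Valid.enables {l : List ℕ} : ∀ {P : Set ℕ}, R.Valid P l → l.Pairwise (· < ·) →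
    ∀ t ∈ l, R.Enables (P ∪ before {s | s ∈ l} t) t := by
  induction l with
  | nil => intro P _ _ t ht; simp at ht
  | cons s l ih =>
    intro P hv hs t ht
    obtain ⟨h1, h2⟩ := List.pairwise_cons.1 hs
    rcases List.mem_cons.1 ht with rfl | htl
    · exact hv.1.mono Set.subset_union_left
    · refine (ih hv.2 h2 t htl).mono ?_
      rintro q ((rfl | hq) | hq)
      · exact Or.inr ⟨List.mem_cons_self, h1 t htl⟩
      · exact Or.inl hq
      · exact Or.inr ⟨List.mem_cons_of_mem s hq.1, hq.2⟩

/-- The list `T` of at most `k - 2` steps enables step `e`, given the external steps and those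
in `A` before `e`. -/
structure Shortcut (R : Trace ar C N V) (int ext A : Set ℕ) (k e : ℕ) (T : List ℕ) : Prop where
  mem : e ∈ int
  notMem : e ∉ A
  sorted : T.Pairwise (· < ·)
  prop : ∀ t ∈ T, t ∈ int ∧ t ∉ before (ext ∪ A) e ∧ t < e
  length : T.length + 2 ≤ k
  valid : R.Valid (before (ext ∪ A) e) T
  enables : R.Enables (adjoin (before (ext ∪ A) e) T) e

/-- The steps before `n` that have a shortcut, and the steps of their shortcuts. -/
def near (R : Trace ar C N V) (int ext A : Set ℕ) (k n : ℕ) : Set ℕ :=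
  {s | ∃ e T, Shortcut R int ext A k e T ∧ e < n ∧ (s = e ∨ s ∈ T)}

/-- The steps that have a path to `i`. -/
def upstream (R : Trace ar C N V) (E : Constraint ar C V → Constraint ar C V → Prop)
    (int : Set ℕ) (i : ℕ) : Set ℕ :=
  {m | m ∈ int ∧ m < i ∧ Relation.TransGen E (R.con m) (R.con i)}

/-- External steps, steps in `A`, steps that are near, and steps with a path to `i`. -/
def support (R : Trace ar C N V) (E : Constraint ar C V → Constraint ar C V → Prop)
    (int ext A : Set ℕ) (k i : ℕ) : Set ℕ :=
  before (ext ∪ A) i ∪ near R int ext A k i ∪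
    upstream R E (int \ (A ∪ {e | ∃ T, Shortcut R int ext A k e T})) i

theorem near_mono {k m n : ℕ} (h : m ≤ n) : near R int ext A k m ⊆ near R int ext A k n := by
  rintro s ⟨e, T, h1, h2, h3⟩
  exact ⟨e, T, h1, h2.trans_le h, h3⟩

theorem near_subset {k n : ℕ} : near R int ext A k n ⊆ int ∩ Set.Iio n := by
  rintro s ⟨e, T, h1, h2, rfl | h3⟩
  · exact ⟨h1.mem, h2⟩
  · exact ⟨(h1.prop s h3).1, (h1.prop s h3).2.2.trans h2⟩

theorem support_subset {E : Constraint ar C V → Constraint ar C V → Prop} (hA : A ⊆ int) {k i : ℕ} :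
    support R E int ext A k i ⊆ before (int ∪ ext) i := by
  rintro s ((hs | hs) | hs)
  · exact ⟨hs.1.symm.imp (fun h => hA h) id, hs.2⟩
  · exact ⟨Or.inl (near_subset hs).1, (near_subset hs).2⟩
  · exact ⟨Or.inl hs.1.1, hs.2.1⟩

theorem Shortcut.subset_near {k e n : ℕ} {T : List ℕ} (h : Shortcut R int ext A k e T)
    (hen : e < n) : {s | s ∈ T} ⊆ near R int ext A k n := fun _ hs => ⟨e, T, h, hen, Or.inr hs⟩

/-- Steps that are near are enabled by few steps. -/
theorem enables_of_near {k n g : ℕ} (hg : g ∈ near R int ext A k n) :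
    ∃ e T, Shortcut R int ext A k e T ∧ e < n ∧
      R.Enables (before (ext ∪ A) e ∪ before {s | s ∈ T} g) g := by
  obtain ⟨e, T, h1, h2, rfl | h3⟩ := hg
  · refine ⟨g, T, h1, h2, h1.enables.mono (Set.union_subset_union_right _ fun t ht => ?_)⟩
    exact ⟨ht, (h1.prop t ht).2.2⟩
  · exact ⟨e, T, h1, h2, h1.valid.enables h1.sorted g h3⟩

namespace IsRun

/-- By `hlit`, the head values of steps in `A` are base values or nulls created in `A`. Each null is
created only once, and before it is used, so cutting at `n` keeps the set closed. -/
theorem closed_base (h : IsRun S X R int ext) (hA : A ⊆ int)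
    (hlit : ∀ m ∈ A, ∀ x ∈ (R.con m).headUniv, R.val m x ∈ R.names X int A) (n : ℕ) :
    Closed X R int ext (before (ext ∪ A) n) := by
  refine ⟨fun p hp => hp.1.symm.imp (fun h => hA h) id, ?_⟩
  rintro p ⟨hp, hpn⟩ hpi x hx
  have hpA : p ∈ A := hp.resolve_left (Set.disjoint_left.1 h.disj hpi)
  rcases hlit p hpA x hx with h1 | ⟨q, hq, hqi, h1⟩
  · exact Or.inl h1
  · rcases h.names_before hpi ((R.con p).headUniv_subset hx) with h2 | ⟨r, hr, hri, h2⟩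
    · exact Or.inl h2
    · have hqr : q = r := h.unique q hqi r hri _ h1 h2
      exact Or.inr ⟨q, ⟨Or.inr hq, lt_trans (Set.mem_Iio.1 (hqr ▸ hr.2)) (Set.mem_Iio.1 hpn)⟩,
        hqi, h1⟩

/-- A near step is enabled by base steps and its own shortcut, and an upstream step by its own
support, which is contained in that of `i` by transitivity of paths. -/
theorem closed_support (h : IsRun S X R int ext) (hA : A ⊆ int)
    (hlit : ∀ m ∈ A, ∀ x ∈ (R.con m).headUniv, R.val m x ∈ R.names X int A)
    {E : Constraint ar C V → Constraint ar C V → Prop} {k i : ℕ}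
    (ih : ∀ m < i, m ∈ int → m ∉ A → (¬ ∃ T, Shortcut R int ext A k m T) →
      R.Enables (support R E int ext A k m) m) :
    Closed X R int ext (support R E int ext A k i) := by
  have := h.closed_of_enabled (h.closed_base hA hlit i)
    (P := near R int ext A k i ∪
      upstream R E (int \ (A ∪ {e | ∃ T, Shortcut R int ext A k e T})) i) ?_ ?_
  · rwa [← Set.union_assoc] at this
  · exact fun p hp => Or.inl (hp.elim (fun hp => (near_subset hp).1) fun hp => hp.1.1)
  · rintro m (hm | hm) hmi -
    · obtain ⟨e, T, h1, h2, h3⟩ := enables_of_near hm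
      refine h3.mono (Set.union_subset_union (before_mono h2.le) ?_)
      exact fun s hs => ⟨Or.inl (h1.subset_near h2 hs.1), hs.2⟩
    · obtain ⟨⟨-, hmA⟩, hmi', hmE⟩ := hm
      refine (ih m hmi' hmi (fun hh => hmA (Or.inl hh)) fun hh => hmA (Or.inr hh)).mono ?_
      rintro s ((hs | hs) | hs)
      · exact Or.inl (before_mono hmi'.le hs)
      · exact Or.inr ⟨Or.inl (near_mono hmi'.le hs), (near_subset hs).2⟩
      · exact Or.inr ⟨Or.inr ⟨hs.1, lt_trans hs.2.1 hmi', hs.2.2.trans hmE⟩, hs.2.1⟩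

/-- Steps of high level are enabled by the steps that have a path to them and steps of bounded
level. -/
theorem enables_support (h : IsRun S X R int ext) (hc : Canonical key R int ext) {k : ℕ}
    (hk : 2 ≤ k) {E : Constraint ar C V → Constraint ar C V → Prop} {f : Set (Position ar)}
    (hE : IsRestrictionSystem N S k E f) (hA : A = R.stage int ext (R.level X int ext (k - 1)))
    (hlit : ∀ m ∈ A, ∀ x ∈ (R.con m).headUniv, R.val m x ∈ R.names X int A) (i : ℕ)
    (hi : i ∈ int) (hiA : i ∉ A) (hiT : ¬ ∃ T, Shortcut R int ext A k i T) :
    R.Enables (support R E int ext A k i) i := by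
  have hAint : A ⊆ int := by rw [hA]; exact fun m hm => hm.1
  induction i using Nat.strong_induction_on with
  | _ i ih =>
    by_contra hnot
    set U := int \ (A ∪ {e | ∃ T, Shortcut R int ext A k e T}) with hU
    set B := before (ext ∪ A) i with hB
    set Z := support R E int ext A k i with hZ
    have hBZ : B ⊆ Z := fun s hs => Or.inl (Or.inl hs)
    set D : ℕ → Prop := fun j => R.Enables (before (int ∪ ext) j ∪ Z) i with hD
    have h0 : ¬ D 0 := fun hen =>
      hnot (hen.mono (Set.union_subset (fun q hq => absurd hq.2 (Nat.not_lt_zero q)) subset_rfl))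
    have hDi : D i := (h.enabled i hi).mono Set.subset_union_left
    -- When the steps of the run are added to `Z` in order, `i` becomes enabled at some `j`. This
    -- `j` is outside `Z` but indispensable; a path from `j` to `i` would put it into `Z`.
    obtain ⟨j, hji, hj1, hj2⟩ : ∃ j < i, ¬ D j ∧ D (j + 1) := by
      by_contra hcontra
      push Not at hcontra
      have : ∀ n ≤ i, ¬ D n := by
        intro n
        induction n with
        | zero => exact fun _ => h0
        | succ n ih => exact fun hn => hcontra n hn (ih (Nat.le_of_succ_le hn))
      exact this i le_rfl hDi
    have hjZ : j ∉ Z := by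
      intro hjZ
      refine hj1 (hj2.mono (Set.union_subset (fun q hq => ?_) Set.subset_union_right))
      have hq2 : q < j + 1 := hq.2
      rcases Nat.lt_succ_iff_lt_or_eq.1 hq2 with h1 | rfl
      · exact Or.inl ⟨hq.1, h1⟩
      · exact Or.inr hjZ
    have hjact : j ∈ int ∪ ext := by
      by_contra hja
      refine hj1 ?_
      simp only [hD, before_succ_of_notMem hja] at hj2
      exact hj2
    have hjB : j ∉ B := fun hh => hjZ (hBZ hh)
    have hjint : j ∈ int := hjact.resolve_right fun hh => hjB ⟨Or.inl hh, hji⟩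
    have hjA : j ∉ A := fun hh => hjB ⟨Or.inr hh, hji⟩
    have hjT : ¬ ∃ T, Shortcut R int ext A k j T := fun ⟨T, hT⟩ =>
      hjZ (Or.inl (Or.inr ⟨j, T, hT, hji, Or.inl rfl⟩))
    have hjU : j ∈ U := ⟨hjint, fun hh => hh.elim hjA hjT⟩
    suffices hpath : Relation.TransGen E (R.con j) (R.con i) from
      hjZ (Or.inr ⟨hjU, hji, hpath⟩)
    have hnear : j ∉ near R int ext A k i := fun hh => hjZ (Or.inl (Or.inr hh))
    -- The helpers after `j` are the members of `Z` outside `B`. Each is near or upstream, hence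
    -- enabled by steps in `Z`.
    set G : Set ℕ := {g | g ∈ Z ∧ j < g ∧ g ∉ B} with hG
    have hZi : Z ⊆ before (int ∪ ext) i := support_subset hAint
    have hsub : ∀ {g}, Z ∩ Set.Iio g ⊆ B ∪ before (int ∪ ext) (j + 1) ∪ before G g := by
      rintro g s ⟨hs, hsg⟩
      by_cases hsB : s ∈ B
      · exact Or.inl (Or.inl hsB)
      by_cases hsj : s < j + 1
      · exact Or.inl (Or.inr ⟨(hZi hs).1, hsj⟩)
      · exact Or.inr ⟨⟨hs, by omega, hsB⟩, hsg⟩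
    have hcases : ∀ g ∈ G, g ∈ near R int ext A k i ∨ g ∈ upstream R E U i := by
      rintro g ⟨(hg | hg) | hg, -, hgB⟩
      · exact absurd hg hgB
      · exact Or.inl hg
      · exact Or.inr hg
    have hupZ : ∀ g ∈ upstream R E U i, support R E int ext A k g ⊆ Z ∩ Set.Iio g := by
      rintro g ⟨hgU, hgi, hgE⟩ s hs
      refine ⟨?_, (support_subset hAint hs).2⟩
      rcases hs with (hs | hs) | hs
      · exact hBZ (before_mono hgi.le hs)
      · exact Or.inl (Or.inr (near_mono hgi.le hs))
      · exact Or.inr ⟨hs.1, lt_trans hs.2.1 hgi, hs.2.2.trans hgE⟩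
    have hupen : ∀ g ∈ upstream R E U i, R.Enables (support R E int ext A k g) g := by
      rintro g ⟨hgU, hgi, hgE⟩
      exact ih g hgi hgU.1 (fun hh => hgU.2 (Or.inl hh)) fun hh => hgU.2 (Or.inr hh)
    refine h.transGen_of_needed hc hk hE hi hjint hji (B := B) (G := G)
      (h.closed_base hAint hlit i) (fun s hs => hZi (hBZ hs))
      (fun s hs => ⟨Or.inl hs.1, hs.2⟩) hjB ?_ ?_ ?_ ?_ ?_ ?_ ?_
    · rintro g hg
      refine ⟨?_, hg.2.1, (hZi hg.1).2, hg.2.2⟩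
      rcases hcases g hg with h1 | h1
      · exact (near_subset h1).1
      · exact h1.1.1
    · intro g hg
      rcases hcases g hg with h1 | h1
      · obtain ⟨e, T, h2, h3, h4⟩ := enables_of_near h1
        refine h4.mono (Set.union_subset ?_ (subset_trans ?_ (hsub (g := g))))
        · exact (before_mono h3.le).trans (Set.subset_union_left.trans Set.subset_union_left)
        · exact fun s hs => ⟨Or.inl (Or.inr (h2.subset_near h3 hs.1)), hs.2⟩
      · exact (hupen g h1).mono ((hupZ g h1).trans hsub)
    · refine fun hen => hj1 (hen.mono ?_)
      rintro s ((hs | hs) | hs)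
      exacts [Or.inr (hBZ hs), Or.inl hs, Or.inr hs.1]
    · refine hj2.mono ?_
      rintro s (hs | hs)
      · exact Or.inl (Or.inr hs)
      · rcases hsub (g := i) ⟨hs, (hZi hs).2⟩ with h1 | h1
        · exact Or.inl h1
        · exact Or.inr h1.1
    -- A helper is enabled by a closed set inside `Z`. As `j` is not in `Z`, its nulls are unknown
    -- to that set.
    · intro g hg x hx hb
      rcases hcases g hg with h1 | h1
      · obtain ⟨e, T, h2, h3, h4⟩ := enables_of_near h1
        have hcl := h.closed_adjoin (h.closed_base hAint hlit e) (fun t ht => (h2.prop t ht).1)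
          h2.valid
        refine h.born_notMem_names hjint ?_ hb (h.enables_names hcl (h4.mono
          (Set.union_subset_union_right _ Set.inter_subset_left)) ((R.con g).headUniv_subset hx))
        rintro (hh | hh)
        · exact hjB (before_mono h3.le hh)
        · exact hnear (h2.subset_near h3 hh)
      · refine h.born_notMem_names hjint ?_ hb (h.enables_names
          (h.closed_support hAint hlit fun m hm => ih m (hm.trans h1.2.1)) (hupen g h1)
          ((R.con g).headUniv_subset hx))
        exact fun hh => hjZ (hupZ g h1 hh).1
    · intro T h1 h2 h3 h4 h5
      exact hiT ⟨T, hi, hiA, h1, h2, h3, h4, h5⟩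
    · obtain ⟨x, hx, n, hn, hP⟩ := h.wild_of_confined (key := key) (subset_level _) hi
        (h.confined hc hk hE i) (hA ▸ hiA)
      refine ⟨x, hx, n, hn, fun P hP' => hP P (hP'.trans ?_)⟩
      refine Set.union_subset (Set.union_subset (fun s hs => hZi (hBZ hs)) (before_mono hji.le)) ?_
      exact fun g hg => hZi hg.1

/-- Steps that are near have bounded level. -/
theorem stage_of_near (h : IsRun S X R int ext) {k n : ℕ} (hk : 2 ≤ k)
    (hA : A = R.stage int ext (R.level X int ext (k - 1)))
    (hlit : ∀ m ∈ A, ∀ x ∈ (R.con m).headUniv, R.val m x ∈ R.names X int A) :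
    near R int ext A k n ⊆ R.stage int ext (R.level X int ext (2 * k)) := by
  have hAint : A ⊆ int := by rw [hA]; exact fun m hm => hm.1
  rintro s ⟨e, T, h1, -, hs⟩
  have hnames : R.names X int (before (ext ∪ A) e) ⊆ R.level X int ext k := by
    rintro v (hv | ⟨p, hp, hpi, hv⟩)
    · exact subset_level _ hv
    · have hpA : p ∈ A := hp.1.resolve_left (Set.disjoint_left.1 h.disj hpi)
      rw [hA] at hpA
      have := born_subset_level hpA hv
      rwa [Nat.sub_add_cancel (by omega)] at this
  have hlen := h1.length
  have hint : ∀ t ∈ T, t ∈ int := fun t ht => (h1.prop t ht).1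
  have hcl := h.closed_base hAint hlit e
  -- Nulls of steps in `A` have level `k`, and the at most `k - 2` steps of a shortcut raise this by
  -- at most their number.
  refine stage_mono (level_mono (r := k + T.length) (by omega)) ?_
  rcases hs with rfl | hs
  · exact h.stage_of_enables_adjoin hcl hnames hint h1.valid h1.mem h1.enables
  · exact (h.stage_of_valid hcl hnames hint h1.valid).1 s hs

end IsRun
end Chase

namespace Chase

variable {Rel C N V : Type*} {ar : Rel → ℕ}
  {S : Set (Constraint ar C V)} {X : Set (Value C N)} {R : Trace ar C N V}
  {int ext P Q : Set ℕ}

open Trace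

/-! ### Counting -/

theorem eval_le_eval (Q : Polynomial ℕ) {a b : ℕ} (h : a ≤ b) : Q.eval a ≤ Q.eval b := by
  rw [Polynomial.eval_eq_sum, Polynomial.eval_eq_sum]
  exact Finset.sum_le_sum fun i _ => Nat.mul_le_mul_left _ (Nat.pow_le_pow_left h i)

theorem vars_finite (l : Conj ar C V) : (vars l).Finite := by
  have : vars l ⊆ ⋃ a ∈ {a | a ∈ l}, ⋃ i : Fin (ar a.rel), {x | a.args i = Term.var x} := by
    rintro x ⟨p, a, ha, i, -, hi⟩
    exact Set.mem_biUnion ha (Set.mem_iUnion.2 ⟨i, hi⟩)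
  refine (Set.Finite.biUnion l.finite_toSet fun a _ => Set.finite_iUnion fun i => ?_).subset this
  refine Set.Subsingleton.finite fun x hx y hy => ?_
  exact Term.var.inj (hx.symm.trans hy)

theorem Constraint.finite_headUniv (α : Constraint ar C V) : α.headUniv.Finite :=
  (vars_finite α.body).subset α.headUniv_subset

theorem Constraint.finite_exVars (α : Constraint ar C V) : α.exVars.Finite := by
  cases α with
  | tgd t => exact (vars_finite t.head).subset Set.sdiff_subset
  | egd e => exact Set.finite_empty

/-- Every run of constraints in `S` has polynomially many internal steps. -/
def Good (N : Type*) (S : Set (Constraint ar C V)) : Prop :=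
  ∃ Q : Polynomial ℕ, ∀ (X : Set (Value C N)) (R : Trace ar C N V) (int ext : Set ℕ), X.Finite →
    IsRun S X R int ext → int.ncard ≤ Q.eval X.ncard

/-- A violated constraint was not applied before with equal head values. -/
theorem IsRun.eq_of_eqv (h : IsRun S X R int ext) {m m' : ℕ} (hm : m ∈ int) (hm' : m' ∈ int)
    (hlt : m < m') (hcon : R.con m = R.con m') :
    ¬ ∀ x ∈ (R.con m').headUniv, R.eqv (before (int ∪ ext) m') (R.val m x) (R.val m' x) := by
  classical
  intro hx
  have hmb : m ∈ before (int ∪ ext) m' := ⟨Or.inl hm, hlt⟩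
  have hv := h.violated m' hm'
  unfold Violated at hv
  split at hv
  · next t ht =>
    rw [ht] at hx hcon
    -- The nulls created by step `m` serve as witnesses for the existential variables of step `m'`.
    refine hv (fun x => if x ∈ vars t.body then R.val m' x else R.val m x)
      (fun x hxb => by simp only [if_pos hxb]; exact eqv_refl _ _) fun a ha => ?_
    refine ⟨a.map (Term.eval (R.val m)), Or.inr ⟨m, hmb, ?_⟩, RAtom.sim_map a fun p v hv => ?_⟩
    · rw [hcon]; exact ⟨a, ha, rfl⟩
    · cases v with
      | const c => exact eqv_refl _ _
      | var x =>
        simp only [Term.eval]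
        split_ifs with hxb
        · exact hx x ⟨mem_vars_of_atPos ha hv, hxb⟩
        · exact eqv_refl _ _
  · next e he =>
    rw [he] at hx hcon
    refine hv (eqv_trans (eqv_symm (hx e.lhs (Or.inl rfl))) (eqv_trans (eqv_of_equates hmb ?_)
      (hx e.rhs (Or.inr rfl))))
    rw [hcon]
    exact ⟨rfl, rfl⟩

/-- Choosing values in `Y` equal to the head values maps steps to functions from the head variables
to `Y`. By `eq_of_eqv` this map is injective, as equalities persist until the later step. -/
theorem IsRun.ncard_stage_con (h : IsRun S X R int ext) {Y : Set (Value C N)} (hY : Y.Finite)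
    (β : Constraint ar C V) :
    {m | m ∈ R.stage int ext Y ∧ R.con m = β}.ncard ≤ Y.ncard ^ β.headUniv.ncard := by
  classical
  have hfin := hY.to_subtype
  have hfin' := β.finite_headUniv.to_subtype
  have hw : ∀ m : {m | m ∈ R.stage int ext Y ∧ R.con m = β}, ∀ x : β.headUniv,
      ∃ w : Y, R.eqv (before (int ∪ ext) m) w (R.val m x) := by
    rintro ⟨m, hm, rfl⟩ ⟨x, hx⟩
    obtain ⟨w, hw, hwx⟩ := hm.2 x hx
    exact ⟨⟨w, hw⟩, hwx⟩
  choose w hw using hw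
  have hinj : Function.Injective w := by
    intro m m' hmm
    by_contra hne
    have key : ∀ m m' : {m | m ∈ R.stage int ext Y ∧ R.con m = β}, w m = w m' →
        ¬ (m : ℕ) < m' := by
      intro m m' hmm hlt
      refine h.eq_of_eqv m.2.1.1 m'.2.1.1 hlt (m.2.2.trans m'.2.2.symm) fun x hx => ?_
      rw [m'.2.2] at hx
      have h1 := hw m ⟨x, hx⟩
      rw [hmm] at h1
      exact eqv_trans (eqv_symm (eqv_mono (before_mono hlt.le) h1)) (hw m' ⟨x, hx⟩)
    rcases lt_or_gt_of_ne fun hh => hne (Subtype.ext hh) with h1 | h1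
    · exact key m m' hmm h1
    · exact key m' m hmm.symm h1
  calc _ = Nat.card {m | m ∈ R.stage int ext Y ∧ R.con m = β} := (Nat.card_coe_set_eq _).symm
    _ ≤ Nat.card (β.headUniv → Y) := Nat.card_le_card_of_injective w hinj
    _ = _ := by rw [Nat.card_fun, Nat.card_coe_set_eq, Nat.card_coe_set_eq]

/-- The number of steps with a given constraint and with few head values is polynomial. -/
theorem exists_bound_stage (hS : S.Finite) : ∃ Q : Polynomial ℕ, ∀ (S' : Set (Constraint ar C V))
    (X : Set (Value C N)) (R : Trace ar C N V) (int ext : Set ℕ), IsRun S' X R int ext →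
    (∀ m ∈ int, R.con m ∈ S) → ∀ Y : Set (Value C N), Y.Finite →
    (R.stage int ext Y).ncard ≤ Q.eval Y.ncard := by
  classical
  refine ⟨∑ β ∈ hS.toFinset, Polynomial.X ^ β.headUniv.ncard, fun S' X R int ext h hcon Y hY => ?_⟩
  have hcover : R.stage int ext Y ⊆
      ⋃ β ∈ hS.toFinset, {m | m ∈ R.stage int ext Y ∧ R.con m = β} := fun m hm =>
    Set.mem_biUnion (x := R.con m) (by simpa using hcon m hm.1) ⟨hm, rfl⟩
  have hfin : ∀ β, {m | m ∈ R.stage int ext Y ∧ R.con m = β}.Finite := fun β =>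
    h.fin_int.subset fun m hm => hm.1.1
  calc _ ≤ _ := Set.ncard_le_ncard hcover
        (Set.Finite.biUnion hS.toFinset.finite_toSet fun β _ => hfin β)
    _ ≤ ∑ β ∈ hS.toFinset, {m | m ∈ R.stage int ext Y ∧ R.con m = β}.ncard :=
        Finset.set_ncard_biUnion_le _ _
    _ ≤ ∑ β ∈ hS.toFinset, Y.ncard ^ β.headUniv.ncard :=
        Finset.sum_le_sum fun β _ => h.ncard_stage_con hY β
    _ = _ := by simp [Polynomial.eval_finsetSum]

theorem exists_bound_born (hS : S.Finite) : ∃ e : ℕ, ∀ (R : Trace ar C N V) (M : Set ℕ), M.Finite →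
    (∀ m ∈ M, R.con m ∈ S) → {v | ∃ m ∈ M, v ∈ R.born m}.Finite ∧
      {v | ∃ m ∈ M, v ∈ R.born m}.ncard ≤ e * M.ncard := by
  classical
  refine ⟨∑ β ∈ hS.toFinset, β.exVars.ncard, fun R M hM hcon => ?_⟩
  have heq : {v | ∃ m ∈ M, v ∈ R.born m} = ⋃ m ∈ hM.toFinset, R.born m := by
    ext v; simp
  have hfin : ∀ m, (R.born m).Finite := fun m => (R.con m).finite_exVars.image _
  rw [heq]
  refine ⟨Set.Finite.biUnion hM.toFinset.finite_toSet fun m _ => hfin m, ?_⟩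
  refine (Finset.set_ncard_biUnion_le _ _).trans ?_
  rw [Set.ncard_eq_toFinset_card M hM, mul_comm, ← smul_eq_mul]
  refine Finset.sum_le_card_nsmul _ _ _ fun m hm => ?_
  refine (Set.ncard_image_le (R.con m).finite_exVars).trans ?_
  exact Finset.single_le_sum (f := fun β : Constraint ar C V => β.exVars.ncard)
    (fun _ _ => Nat.zero_le _) (by simpa using hcon m (by simpa using hm))

/-- A round adds a bounded number of nulls for each step in the current stage, and such steps are
polynomially many in the size of the level. A fixed number of rounds composes finitely many
polynomials. -/
theorem exists_bound_level (hS : S.Finite) (r : ℕ) : ∃ Q : Polynomial ℕ, ∀ (X : Set (Value C N))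
    (R : Trace ar C N V) (int ext : Set ℕ), X.Finite → IsRun S X R int ext →
    (R.level X int ext r).Finite ∧ (R.level X int ext r).ncard ≤ Q.eval X.ncard := by
  obtain ⟨Qs, hQs⟩ := exists_bound_stage (N := N) hS
  obtain ⟨e, he⟩ := exists_bound_born (N := N) hS
  induction r with
  | zero => exact ⟨Polynomial.X, fun X R int ext hX _ => ⟨hX, by simp [level]⟩⟩
  | succ r ih =>
    obtain ⟨Q, hQ⟩ := ih
    refine ⟨Q + Polynomial.C e * Qs.comp Q, fun X R int ext hX h => ?_⟩
    obtain ⟨h1, h2⟩ := hQ X R int ext hX h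
    obtain ⟨h3, h4⟩ := he R (R.stage int ext (R.level X int ext r))
      (h.fin_int.subset fun m hm => hm.1) fun m hm => h.con_mem m hm.1
    refine ⟨h1.union h3, (Set.ncard_union_le _ _).trans ?_⟩
    rw [Polynomial.eval_add, Polynomial.eval_mul, Polynomial.eval_C, Polynomial.eval_comp]
    refine Nat.add_le_add h2 (h4.trans (Nat.mul_le_mul_left _ ?_))
    exact (hQs S X R int ext h h.con_mem _ h1).trans (eval_le_eval _ h2)

/-- The number of steps of bounded level is polynomial. -/
theorem exists_bound_stage_level (hS : S.Finite) (r : ℕ) : ∃ Q : Polynomial ℕ,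
    ∀ (X : Set (Value C N)) (R : Trace ar C N V) (int ext : Set ℕ), X.Finite →
    IsRun S X R int ext → (R.stage int ext (R.level X int ext r)).ncard ≤ Q.eval X.ncard := by
  obtain ⟨Qs, hQs⟩ := exists_bound_stage (N := N) hS
  obtain ⟨Q, hQ⟩ := exists_bound_level (N := N) hS r
  refine ⟨Qs.comp Q, fun X R int ext hX h => ?_⟩
  obtain ⟨h1, h2⟩ := hQ X R int ext hX h
  rw [Polynomial.eval_comp]
  exact (hQs S X R int ext h h.con_mem _ h1).trans (eval_le_eval _ h2)

/-! ### Safe sets of constraints -/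

/-- Some path with at least `r` special edges ends in `p`. -/
def Depth (S : Set (Constraint ar C V)) : ℕ → Position ar → Prop
  | 0, _ => True
  | r + 1, p => ∃ q q', Depth S r q ∧ PropSpecial S q q' ∧
      Relation.ReflTransGen (fun u v => PropEdge S u v ∨ PropSpecial S u v) q' p

theorem Depth.tail {r : ℕ} {p q : Position ar} (h : Depth S r p) (hpq : PropEdge S p q) :
    Depth S r q := by
  cases r with
  | zero => trivial
  | succ r =>
    obtain ⟨u, u', h1, h2, h3⟩ := h
    exact ⟨u, u', h1, h2, h3.tail (Or.inl hpq)⟩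

/-- The sources of the special edges on a path are distinct in a safe set, since a repetition would
close a cycle through a special edge. -/
theorem Depth.exists_finset (hS : Safe S) {r : ℕ} : ∀ {p : Position ar}, Depth S r p →
    ∃ F : Finset (Position ar), F.card = r ∧ ∀ q ∈ F, ∃ q', PropSpecial S q q' ∧
      Relation.ReflTransGen (fun u v => PropEdge S u v ∨ PropSpecial S u v) q' p := by
  classical
  induction r with
  | zero => exact fun _ => ⟨∅, rfl, by simp⟩
  | succ r ih =>
    rintro p ⟨q, q', h1, h2, h3⟩
    obtain ⟨F, hF, hFq⟩ := ih h1
    have hq : q ∉ F := fun hq => by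
      obtain ⟨u, hu, hu'⟩ := hFq q hq
      exact hS q u hu hu'
    refine ⟨insert q F, by rw [Finset.card_insert_of_notMem hq, hF], fun u hu => ?_⟩
    rcases Finset.mem_insert.1 hu with rfl | hu
    · exact ⟨q', h2, h3⟩
    · obtain ⟨u', hu1, hu2⟩ := hFq u hu
      exact ⟨u', hu1, (hu2.tail (Or.inr h2)).trans h3⟩

/-- A null of level more than `r` only occurs at the end of paths with `r` special edges. -/
theorem IsRun.affected_depth (h : IsRun S X R int ext) (j : ℕ) : ∀ (r : ℕ) (v : Value C N),
    (∀ w ∈ R.level X int ext r, ¬ R.eqv (before (int ∪ ext) j) w v) →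
    ∀ a ∈ R.facts (before (int ∪ ext) j), ∀ p, a.AtPos p v → Affected S p ∧ Depth S r p := by
  induction j using Nat.strong_induction_on with
  | _ j ih =>
    intro r v hv a ha p hap
    have hvX : v ∉ X := fun hX => hv v (subset_level _ hX) (eqv_refl _ _)
    rcases ha with ha | ⟨m, hm, ha⟩
    · exact absurd (h.init_sub (mem_dom_iff.2 ⟨a, ha, p, hap⟩)) hvX
    have hmj : m < j := hm.2
    rcases hm.1 with hmi | hme
    swap
    · exact absurd (h.ext_facts m hme (mem_dom_iff.2 ⟨a, ha, p, hap⟩)) hvX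
    obtain ⟨t, ht, ⟨c, hcc, rfl⟩ | ⟨x, hx, hvx⟩⟩ := Constraint.exists_occursAt_of_headFacts ha hap
    · exact absurd (h.const_mem m hmi c hcc) hvX
    have htS : Constraint.tgd t ∈ S := ht ▸ h.con_mem m hmi
    have hbody : ∀ s x, (∀ w ∈ R.level X int ext s,
        ¬ R.eqv (before (int ∪ ext) m) w (R.val m x)) →
        ∀ q, OccursAt t.body x q → Affected S q ∧ Depth S s q := by
      intro s x hs q hq
      have hq' : OccursAt (R.con m).body x q := by rw [ht]; exact hq
      obtain ⟨f', hf', w, hw, hwv⟩ := (h.enabled m hmi).exists_fact hq'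
      exact ih m hmj s w (fun u hu huw => hs u hu (eqv_trans huw hwv)) f' hf' q hw
    by_cases hxb : x ∈ vars t.body
    · have h1 := hbody r x fun w hw hwv => hv w hw (eqv_mono (before_mono hmj.le) (hvx ▸ hwv))
      refine ⟨Affected.univ t x p htS hxb hx fun q hq => (h1 q hq).1, ?_⟩
      obtain ⟨q, hq⟩ := hxb
      exact (h1 q hq).2.tail ⟨t, htS, x, hq, fun u hu => (h1 u hu).1, hx⟩
    · have hxe : x ∈ t.exVars := ⟨⟨p, hx⟩, hxb⟩
      refine ⟨Affected.exist t x p htS hxe hx, ?_⟩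
      cases r with
      | zero => trivial
      | succ r =>
        -- As the new null is not of level `r + 1`, some head value of `m` is not equal to one of
        -- level `r`. Its body positions have depth `r` and send special edges to the position of
        -- the null.
        have hst : m ∉ R.stage int ext (R.level X int ext r) := fun hst =>
          hv v (born_subset_level hst ⟨x, by rw [ht]; exact hxe, hvx.symm⟩) (eqv_refl _ _)
        obtain ⟨y, hy, hyv⟩ : ∃ y ∈ (R.con m).headUniv, ∀ w ∈ R.level X int ext r,
            ¬ R.eqv (before (int ∪ ext) m) w (R.val m y) := by
          by_contra hcontra
          push Not at hcontra
          exact hst ⟨hmi, hcontra⟩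
        rw [ht] at hy
        obtain ⟨hyh, q, hq⟩ := hy
        have h1 := hbody r y hyv
        exact ⟨q, p, (h1 q hq).2, ⟨t, htS, y, hyh, hq, fun u hu => (h1 u hu).1, x, hxe, hx⟩,
          Relation.ReflTransGen.refl⟩

/-- A depth above the number of positions is impossible by `Depth.exists_finset`. Hence the head
values of all internal steps equal values of bounded level. -/
theorem good_of_safe [Finite Rel] (hS : S.Finite) (hsafe : Safe S) : Good N S := by
  classical
  have : Finite (Position ar) := inferInstance
  have := Fintype.ofFinite (Position ar)
  obtain ⟨Q, hQ⟩ := exists_bound_stage_level (N := N) hS (Fintype.card (Position ar) + 1)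
  refine ⟨Q, fun X R int ext hX h => ?_⟩
  refine le_trans (Set.ncard_le_ncard (fun m hm => ?_) (h.fin_int.subset fun m hm => hm.1))
    (hQ X R int ext hX h)
  refine ⟨hm, fun x hx => ?_⟩
  by_contra hcontra
  push Not at hcontra
  obtain ⟨q, hq⟩ := (R.con m).headUniv_subset hx
  obtain ⟨f', hf', w, hw, hwv⟩ := (h.enabled m hm).exists_fact hq
  obtain ⟨-, hd⟩ := h.affected_depth m _ w
    (fun u hu huw => hcontra u hu (eqv_trans huw hwv)) f' hf' q hw
  obtain ⟨F, hF, -⟩ := hd.exists_finset hsafe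
  have := F.card_le_univ
  omega

end Chase

namespace Chase

variable {Rel C N V : Type*} {ar : Rel → ℕ} {K : Type*} [LinearOrder K] [WellFoundedLT K]
  {key : Value C N → K} {S : Set (Constraint ar C V)} {X : Set (Value C N)} {R : Trace ar C N V}
  {int ext P Q : Set ℕ}

open Trace

/-! ### Making a run canonical -/

open Classical in
/-- A well-founded order of the values in which constants come first, then the values in `X`, then
those in `Y`. -/
theorem exists_key (X Y : Set (Value C N)) (hXY : X ⊆ Y) :
    ∃ (_ : LinearOrder (ℕ ×ₗ Value C N)) (_ : WellFoundedLT (ℕ ×ₗ Value C N))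
    (key : Value C N → ℕ ×ₗ Value C N), Function.Injective key ∧
    (∀ c v, key v ≤ key (Value.const c) → ∃ c', v = Value.const c') ∧
    (∀ v w, w ∈ X → key v ≤ key w → v ∈ X ∨ ∃ c, v = Value.const c) ∧
    (∀ v w, w ∈ Y → key v ≤ key w → v ∈ Y ∨ ∃ c, v = Value.const c) := by
  obtain ⟨_, _⟩ := exists_wellFoundedLT (Value C N)
  -- The order is lexicographic, with this class first and an arbitrary well-order for ties. It
  -- makes a class that meets `X` or `Y` have its least member there, or a constant.
  let cls : Value C N → ℕ := fun v =>
    if ∃ c, v = Value.const c then 0 else if v ∈ X then 1 else if v ∈ Y then 2 else 3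
  have hle : ∀ v w, toLex (cls v, v) ≤ toLex (cls w, w) → cls v ≤ cls w := by
    intro v w hvw
    rcases Prod.Lex.le_iff.1 hvw with h | h
    · exact h.le
    · exact h.1.le
  refine ⟨inferInstance, inferInstance, fun v => toLex (cls v, v),
    fun v w hvw => (Prod.mk.inj (toLex.injective hvw)).2, ?_, ?_, ?_⟩
  · intro c v hv
    have h1 := hle _ _ hv
    have h0 : cls (Value.const c) = 0 := if_pos ⟨c, rfl⟩
    rw [h0] at h1
    by_contra hcon
    simp only [cls, if_neg hcon] at h1
    split_ifs at h1 <;> omega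
  · intro v w hw hv
    have h1 := hle _ _ hv
    by_contra! hcon
    have hcon' : ¬ ∃ c, v = Value.const c := fun ⟨c, hc⟩ => hcon.2 c hc
    simp only [cls, if_neg hcon', if_neg hcon.1, if_pos hw] at h1
    split_ifs at h1 <;> omega
  · intro v w hw hv
    have h1 := hle _ _ hv
    by_contra! hcon
    have hcon' : ¬ ∃ c, v = Value.const c := fun ⟨c, hc⟩ => hcon.2 c hc
    have hvX : v ∉ X := fun hh => hcon.1 (hXY hh)
    simp only [cls, if_neg hcon', if_neg hvX, if_neg hcon.1, if_pos hw] at h1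
    split_ifs at h1 <;> omega

open Classical in
/-- The values of the steps are replaced by representatives. -/
noncomputable def Trace.normalize (key : Value C N → K) (R : Trace ar C N V) (act : Set ℕ) :
    Trace ar C N V where
  init := R.init
  con := R.con
  val m x := if x ∈ vars (R.con m).body then R.rep key (before act m) (R.val m x) else R.val m x

namespace Trace

variable {act : Set ℕ}

theorem normalize_val_of_mem {m : ℕ} {x : V} (hx : x ∈ vars (R.con m).body) :
    (R.normalize key act).val m x = R.rep key (before act m) (R.val m x) := if_pos hx

theorem normalize_val_of_notMem {m : ℕ} {x : V} (hx : x ∉ vars (R.con m).body) :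
    (R.normalize key act).val m x = R.val m x := if_neg hx

theorem normalize_val_eqv (m : ℕ) (x : V) :
    R.eqv (before act m) ((R.normalize key act).val m x) (R.val m x) := by
  by_cases hx : x ∈ vars (R.con m).body
  · rw [normalize_val_of_mem hx]; exact rep_eqv _ _
  · rw [normalize_val_of_notMem hx]; exact eqv_refl _ _

theorem normalize_born (m : ℕ) : (R.normalize key act).born m = R.born m :=
  Set.image_congr fun _ hy => normalize_val_of_notMem (Constraint.notMem_body_of_exVars hy)

theorem Equates.normalize {α : Constraint ar C V} {μ ν : V → Value C N}
    {r : Value C N → Value C N → Prop} (hr : Equivalence r) (hμ : ∀ x, r (μ x) (ν x))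
    (h : ∀ v w, α.Equates μ v w → r v w)
    {v w : Value C N} (hvw : α.Equates ν v w) : r v w := by
  cases α with
  | tgd t => exact hvw.elim
  | egd e =>
    obtain ⟨rfl, rfl⟩ := hvw
    exact hr.trans (hr.symm (hμ _)) (hr.trans (h _ _ ⟨rfl, rfl⟩) (hμ _))

theorem eqv_equivalence : Equivalence (R.eqv P) :=
  ⟨eqv_refl P, eqv_symm, eqv_trans⟩

theorem eqv_of_normalize (hP : ∀ p ∈ P, before act p ⊆ P) {v w : Value C N}
    (h : (R.normalize key act).eqv P v w) : R.eqv P v w :=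
  eqv_induction eqv_equivalence (fun p hp _ _ he => Equates.normalize (α := R.con p)
    (μ := R.val p) eqv_equivalence
    (fun x => eqv_symm (eqv_mono (hP p hp) (normalize_val_eqv p x)))
    (fun _ _ he' => eqv_of_equates hp he') he) h

theorem before_subset_before {m n : ℕ} (hm : m ∈ before P n) : before P m ⊆ before P n :=
  before_mono (Set.mem_Iio.1 hm.2).le

/-- The new parameters of a step equal the old ones by equations of strictly earlier steps only. For
these the claim is already known, so the old equation follows from the new one. -/
theorem normalize_eqv_of_eqv (n : ℕ) : ∀ {v w : Value C N}, R.eqv (before act n) v w →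
    (R.normalize key act).eqv (before act n) v w := by
  induction n using Nat.strong_induction_on with
  | _ n ih =>
    intro v w h
    refine eqv_induction eqv_equivalence (fun p hp _ _ he => Equates.normalize (α := R.con p)
      (μ := (R.normalize key act).val p) eqv_equivalence
      (fun x => eqv_mono (before_subset_before hp) (ih p hp.2 (normalize_val_eqv p x)))
      (fun _ _ he' => eqv_of_equates (R := R.normalize key act) hp he') he) h

theorem normalize_eqv_iff {n : ℕ} {v w : Value C N} :
    (R.normalize key act).eqv (before act n) v w ↔ R.eqv (before act n) v w :=
  ⟨eqv_of_normalize fun _ hp => before_subset_before hp, normalize_eqv_of_eqv n⟩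

theorem normalize_eqv_val_iff {n : ℕ} {v : Value C N} {x : V} :
    (R.normalize key act).eqv (before act n) v ((R.normalize key act).val n x) ↔
      R.eqv (before act n) v (R.val n x) := by
  rw [normalize_eqv_iff]
  exact ⟨fun h => eqv_trans h (normalize_val_eqv n x),
    fun h => eqv_trans h (eqv_symm (normalize_val_eqv n x))⟩

theorem headFacts_sim {α : Constraint ar C V} {μ ν : V → Value C N}
    {r : Value C N → Value C N → Prop} (hr : ∀ v, r v v) (h : ∀ x, r (μ x) (ν x))
    {f : RAtom ar (Value C N)} (hf : f ∈ α.headFacts μ) : ∃ g ∈ α.headFacts ν, f.Sim r g := by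
  cases α with
  | egd e => exact hf.elim
  | tgd t =>
    obtain ⟨a, ha, rfl⟩ := hf
    refine ⟨_, ⟨a, ha, rfl⟩, RAtom.sim_map a fun p v _ => ?_⟩
    cases v with
    | const c => exact hr _
    | var x => exact h x

theorem facts_normalize {n : ℕ} {f : RAtom ar (Value C N)}
    (hf : f ∈ (R.normalize key act).facts (before act n)) :
    ∃ g ∈ R.facts (before act n), f.Sim (R.eqv (before act n)) g := by
  rcases hf with hf | ⟨p, hp, hf⟩
  · exact ⟨f, Or.inl hf, RAtom.Sim.refl (eqv_refl _) f⟩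
  · obtain ⟨g, hg, hs⟩ := headFacts_sim (eqv_refl _)
      (fun x => eqv_mono (before_subset_before hp) (normalize_val_eqv (key := key) p x)) hf
    exact ⟨g, Or.inr ⟨p, hp, hg⟩, hs⟩

theorem exists_facts_normalize {n : ℕ} {f : RAtom ar (Value C N)}
    (hf : f ∈ R.facts (before act n)) :
    ∃ g ∈ (R.normalize key act).facts (before act n), f.Sim (R.eqv (before act n)) g := by
  rcases hf with hf | ⟨p, hp, hf⟩
  · exact ⟨f, Or.inl hf, RAtom.Sim.refl (eqv_refl _) f⟩
  · obtain ⟨g, hg, hs⟩ := headFacts_sim (eqv_refl _)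
      (fun x => eqv_mono (before_subset_before hp) (eqv_symm (normalize_val_eqv (key := key) p x)))
      hf
    exact ⟨g, Or.inr ⟨p, hp, hg⟩, hs⟩

theorem Enables.normalize {m : ℕ} (h : R.Enables (before act m) m) :
    (R.normalize key act).Enables (before act m) m := by
  intro a ha
  obtain ⟨f, hf, hs⟩ := h a ha
  obtain ⟨g, hg, hs'⟩ := exists_facts_normalize (key := key) hf
  refine ⟨g, hg, RAtom.Sim.mono (fun _ _ h => normalize_eqv_iff.2 h) (sim_trans
    (RAtom.Sim.symm (fun _ _ => eqv_symm) hs') (sim_trans hs (RAtom.sim_map a fun p v _ => ?_)))⟩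
  cases v with
  | const c => exact eqv_refl _ _
  | var x => exact eqv_symm (normalize_val_eqv m x)

theorem Violated.normalize {m : ℕ} (h : R.Violated (before act m) m) :
    (R.normalize key act).Violated (before act m) m := by
  have hcon : (R.normalize key act).con m = R.con m := rfl
  unfold Violated at h ⊢
  rw [hcon]
  split at h
  · intro ν hν hh
    refine h ν (fun x hx => normalize_eqv_val_iff.1 (hν x hx)) fun a ha => ?_
    obtain ⟨f, hf, hs⟩ := hh a ha
    obtain ⟨g, hg, hs'⟩ := facts_normalize hf
    exact ⟨g, hg, sim_trans (RAtom.Sim.symm (fun _ _ => eqv_symm) hs')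
      (hs.mono fun _ _ h => normalize_eqv_iff.1 h)⟩
  · exact fun hh => h (eqv_trans (eqv_symm (normalize_val_eqv m _)) (normalize_eqv_val_iff.1 hh))

theorem normalize_stage (Y : Set (Value C N)) :
    (R.normalize key (int ∪ ext)).stage int ext Y = R.stage int ext Y := by
  ext m
  refine and_congr_right fun _ => forall₂_congr fun x _ => exists_congr fun w =>
    and_congr_right fun _ => normalize_eqv_val_iff

theorem normalize_level (r : ℕ) :
    (R.normalize key (int ∪ ext)).level X int ext r = R.level X int ext r := by
  induction r with
  | zero => rfl
  | succ r ih => simp only [level, ih, normalize_stage, normalize_born]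

end Trace

namespace IsRun

theorem const_mem_of_names (h : IsRun S X R int ext) {c : C}
    (hc : Value.const c ∈ R.names X int P) : Value.const c ∈ X := by
  rcases hc with hc | ⟨p, -, hpi, y, hy, hyc⟩
  · exact hc
  · obtain ⟨n, hn⟩ := h.null p hpi y hy
    rw [hyc] at hn
    cases hn

/-- The least value equal to a value in `Y` is in `Y`. -/
theorem rep_mem (h : IsRun S X R int ext) {Y : Set (Value C N)} (hXY : X ⊆ Y)
    (hkey : ∀ v w, w ∈ Y → key v ≤ key w → v ∈ Y ∨ ∃ c, v = Value.const c)
    (hP : Closed X R int ext P) {v w : Value C N} (hw : w ∈ Y) (hwv : R.eqv P w v) :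
    R.rep key P v ∈ Y := by
  rcases hkey _ _ hw (rep_le hwv) with h1 | ⟨c, hc⟩
  · exact h1
  · rcases h.eqv_names hP (eqv_trans (rep_eqv (key := key) P v) (eqv_symm hwv)) with h1 | h1
    · rw [h1]; exact hw
    · rw [hc] at h1 ⊢
      exact hXY (h.const_mem_of_names h1.1)

/-- Matching and violation are invariant under equivalence, and created nulls are untouched.
External head values stay in `X` because of `hkey`; the constants that could also be least members
are then known values, hence in `X`. -/
theorem normalize (h : IsRun S X R int ext)
    (hkey : ∀ v w, w ∈ X → key v ≤ key w → v ∈ X ∨ ∃ c, v = Value.const c) :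
    IsRun S X (R.normalize key (int ∪ ext)) int ext := by
  have huniv : ∀ m ∈ ext, ∀ x ∈ (R.con m).headUniv,
      (R.normalize key (int ∪ ext)).val m x ∈ X := fun m hm x hx => by
    rw [normalize_val_of_mem ((R.con m).headUniv_subset hx)]
    exact h.rep_mem subset_rfl hkey (h.closed_before m) (h.ext_univ m hm x hx) (eqv_refl _ _)
  refine { h with
    ext_facts := fun m hm v hv => ?_
    ext_univ := huniv
    null := fun m hm y hy => ?_
    inj := fun m hm => ?_
    new := fun m hm v hv => h.new m hm v (by rwa [normalize_born] at hv)
    unique := fun m hm m' hm' v hv hv' => h.unique m hm m' hm' v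
      (by rwa [normalize_born] at hv) (by rwa [normalize_born] at hv')
    enabled := fun m hm => (h.enabled m hm).normalize
    violated := fun m hm => (h.violated m hm).normalize
    consistent := fun c c' hcc => h.consistent c c' (eqv_of_normalize
      (fun _ _ => Set.inter_subset_left) hcc) }
  · obtain ⟨f, hf, p, hp⟩ := mem_dom_iff.1 hv
    change f ∈ (R.con m).headFacts _ at hf
    obtain ⟨t, ht, ⟨c, hc, rfl⟩ | ⟨x, hx, hvx⟩⟩ := Constraint.exists_occursAt_of_headFacts hf hp
    · have hm' := h.ext_facts m hm
      rw [ht] at hc hm'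
      obtain ⟨a, ha, q, hq⟩ := hc
      exact hm' (mem_dom_iff.2 ⟨_, ⟨a, ha, rfl⟩, q, RAtom.atPos_map.2 ⟨_, hq, rfl⟩⟩)
    · by_cases hb : x ∈ vars t.body
      · rw [hvx]
        exact huniv m hm x (by rw [ht]; exact ⟨⟨p, hx⟩, hb⟩)
      · have hm' := h.ext_facts m hm
        rw [hvx, normalize_val_of_notMem (by rw [ht]; exact hb)]
        rw [ht] at hm'
        obtain ⟨a, ha, hxa⟩ := occursAt_iff.1 hx
        exact hm' (mem_dom_iff.2 ⟨_, ⟨a, ha, rfl⟩, p, RAtom.atPos_map.2 ⟨_, hxa, rfl⟩⟩)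
  · change y ∈ (R.con m).exVars at hy
    rw [normalize_val_of_notMem (Constraint.notMem_body_of_exVars hy)]
    exact h.null m hm y hy
  · intro y hy y' hy' heq
    change y ∈ (R.con m).exVars at hy
    change y' ∈ (R.con m).exVars at hy'
    rw [normalize_val_of_notMem (Constraint.notMem_body_of_exVars hy),
      normalize_val_of_notMem (Constraint.notMem_body_of_exVars hy')] at heq
    exact h.inj m hm hy hy' heq

theorem level_subset_names (_h : IsRun S X R int ext) {r : ℕ} :
    R.level X int ext r ⊆ R.names X int (R.stage int ext (R.level X int ext r)) := by
  intro v hv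
  rcases exists_born_of_mem_level hv with h1 | ⟨s, hs, m, hm, h1⟩
  · exact Or.inl h1
  · exact Or.inr ⟨m, stage_mono (level_mono hs.le) hm, hm.1, h1⟩

/-- Every run can be made canonical, such that steps of low level use values of low level. -/
theorem exists_canonical (h : IsRun S X R int ext) (r : ℕ) :
    ∃ (_ : LinearOrder (ℕ ×ₗ Value C N)) (_ : WellFoundedLT (ℕ ×ₗ Value C N))
    (key : Value C N → ℕ ×ₗ Value C N) (R' : Trace ar C N V), IsRun S X R' int ext ∧
    Canonical key R' int ext ∧
    ∀ m ∈ R'.stage int ext (R'.level X int ext r), ∀ x ∈ (R'.con m).headUniv,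
      R'.val m x ∈ R'.names X int (R'.stage int ext (R'.level X int ext r)) := by
  obtain ⟨i1, i2, key, h1, h2, h3, h4⟩ := exists_key X (R.level X int ext r) (subset_level r)
  have hrun := h.normalize h3
  refine ⟨i1, i2, key, R.normalize key (int ∪ ext), hrun, ⟨h1, h2, ?_, ?_⟩, ?_⟩
  · intro m hm x hx w hw
    change x ∈ vars (R.con m).body at hx
    rw [normalize_val_of_mem hx]
    exact rep_le (normalize_eqv_val_iff.1 hw)
  · intro m hm x hx w hw
    change x ∈ (R.con m).headUniv at hx
    rw [normalize_val_of_mem ((R.con m).headUniv_subset hx)]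
    exact rep_le (normalize_eqv_val_iff.1 hw)
  · intro m hm x hx
    change x ∈ (R.con m).headUniv at hx
    refine hrun.level_subset_names ?_
    rw [normalize_val_of_mem ((R.con m).headUniv_subset hx)]
    obtain ⟨w, hw, hwx⟩ := hm.2 x hx
    rw [normalize_level] at hw ⊢
    exact h.rep_mem (subset_level r) h4 (h.closed_before m) hw (normalize_eqv_val_iff.1 hwx)

end IsRun
end Chase

namespace Chase

variable {Rel C N V : Type*} {ar : Rel → ℕ}
  {S D : Set (Constraint ar C V)} {X : Set (Value C N)} {R : Trace ar C N V}
  {int ext I W A P Q : Set ℕ} {E : Constraint ar C V → Constraint ar C V → Prop} {k : ℕ}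

open Trace Relation

/-! ### Strongly connected components -/

/-- Some of the internal steps of a run form a run if others are considered external. -/
theorem IsRun.restrict (h : IsRun S X R int ext) (hI : I ⊆ int) (hW : W ⊆ int) (hIW : Disjoint I W)
    (hcl : Closed X R int ext (ext ∪ W)) (hD : ∀ m ∈ I, R.con m ∈ D)
    (hen : ∀ m ∈ I, R.Enables (before (I ∪ (ext ∪ W)) m) m) :
    IsRun D (X ∪ {v | ∃ m ∈ W, v ∈ R.born m}) R I (ext ∪ W) := by
  have hsub : I ∪ (ext ∪ W) ⊆ int ∪ ext := Set.union_subset (hI.trans Set.subset_union_left)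
    (Set.union_subset Set.subset_union_right (hW.trans Set.subset_union_left))
  have hnames : R.names X int (ext ∪ W) ⊆ X ∪ {v | ∃ m ∈ W, v ∈ R.born m} := by
    rintro v (hv | ⟨p, hp | hp, hpi, hv⟩)
    · exact Or.inl hv
    · exact absurd hp (Set.disjoint_left.1 h.disj hpi)
    · exact Or.inr ⟨p, hp, hv⟩
  refine { fin_int := h.fin_int.subset hI
           fin_ext := h.fin_ext.union (h.fin_int.subset hW)
           disj := ?_
           init_fin := h.init_fin
           init_sub := h.init_sub.trans Set.subset_union_left
           ext_facts := fun m hm v hv => hnames (h.facts_names hcl ?_)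
           ext_univ := fun m hm x hx => hnames (h.univ_names hcl hm hx)
           con_mem := hD
           const_mem := fun m hm c hc => Or.inl (h.const_mem m (hI hm) c hc)
           null := fun m hm => h.null m (hI hm)
           inj := fun m hm => h.inj m (hI hm)
           new := ?_
           unique := fun m hm m' hm' => h.unique m (hI hm) m' (hI hm')
           enabled := hen
           violated := fun m hm => (h.violated m (hI hm)).anti (Set.inter_subset_inter_left _ hsub)
           consistent := fun c c' hcc => h.consistent c c' (eqv_mono hsub hcc) }
  · exact Set.disjoint_union_right.2 ⟨h.disj.mono_left hI, hIW⟩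
  · obtain ⟨f, hf, p, hp⟩ := mem_dom_iff.1 hv
    exact mem_dom_iff.2 ⟨f, Or.inr ⟨m, hm, hf⟩, p, hp⟩
  · rintro m hm v hv (hX | ⟨p, hp, hvp⟩)
    · exact h.new m (hI hm) v hv hX
    · have hmp := h.unique m (hI hm) p (hW hp) v hv hvp
      exact Set.disjoint_left.1 hIW hm (hmp ▸ hp)

/-- The steps of low level and those that are near. -/
def lowSteps (R : Trace ar C N V) (int ext A : Set ℕ) (k : ℕ) : Set ℕ :=
  A ∪ {s | ∃ n, s ∈ near R int ext A k n}

/-- A run in which the steps of low level use values of low level, and all steps that are not low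
are enabled by those upstream. -/
structure Stratified (S : Set (Constraint ar C V)) (X : Set (Value C N)) (R : Trace ar C N V)
    (int ext : Set ℕ) (E : Constraint ar C V → Constraint ar C V → Prop) (k : ℕ) (A : Set ℕ) :
    Prop where
  run : IsRun S X R int ext
  stage_eq : A = R.stage int ext (R.level X int ext (k - 1))
  literal : ∀ m ∈ A, ∀ x ∈ (R.con m).headUniv, R.val m x ∈ R.names X int A
  enables : ∀ i ∈ int, i ∉ A → (¬ ∃ T, Shortcut R int ext A k i T) →
    R.Enables (support R E int ext A k i) i

namespace Stratified

theorem subset_int (h : Stratified S X R int ext E k A) : A ⊆ int := by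
  rw [h.stage_eq]; exact fun m hm => hm.1

theorem low_subset_int (h : Stratified S X R int ext E k A) : lowSteps R int ext A k ⊆ int :=
  Set.union_subset h.subset_int fun _ ⟨_, hs⟩ => (near_subset hs).1

theorem low_subset_stage (h : Stratified S X R int ext E k A) (hk : 2 ≤ k) :
    lowSteps R int ext A k ⊆ R.stage int ext (R.level X int ext (2 * k)) := by
  refine Set.union_subset ?_ fun _ ⟨_, hs⟩ => h.run.stage_of_near hk h.stage_eq h.literal hs
  rw [h.stage_eq]
  exact stage_mono (level_mono (by omega))

/-- Steps that are not low are enabled by low steps and by those upstream. -/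
theorem enables_of_notMem (h : Stratified S X R int ext E k A) {i : ℕ} (hi : i ∈ int)
    (hlow : i ∉ lowSteps R int ext A k) : R.Enables (before (ext ∪ lowSteps R int ext A k) i ∪
      upstream R E (int \ lowSteps R int ext A k) i) i := by
  refine (h.enables i hi (fun hh => hlow (Or.inl hh)) ?_).mono ?_
  · rintro ⟨T, hT⟩
    exact hlow (Or.inr ⟨i + 1, i, T, hT, Nat.lt_succ_self i, Or.inl rfl⟩)
  · rintro s ((hs | hs) | hs)
    · exact Or.inl ⟨hs.1.imp id Or.inl, hs.2⟩
    · exact Or.inl ⟨Or.inr (Or.inr ⟨i, hs⟩), (near_subset hs).2⟩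
    · by_cases hsl : s ∈ lowSteps R int ext A k
      · exact Or.inl ⟨Or.inr hsl, hs.2.1⟩
      · exact Or.inr ⟨⟨hs.1.1, hsl⟩, hs.2⟩

/-- The external and low steps, and other steps that form an initial part of the graph, are
closed. -/
theorem closed_union_low (h : Stratified S X R int ext E k A) {M : Set (Constraint ar C V)}
    (hM : ∀ α ∈ S, ∀ β ∈ M, TransGen E α β → α ∈ M) :
    Closed X R int ext (ext ∪ (lowSteps R int ext A k ∪
      {m | m ∈ int \ lowSteps R int ext A k ∧ R.con m ∈ M})) := by
  have hbase : Closed X R int ext (ext ∪ A) := by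
    refine ⟨Set.union_subset Set.subset_union_right (h.subset_int.trans Set.subset_union_left), ?_⟩
    intro p hp hpi x hx
    have hpA := hp.resolve_left (Set.disjoint_left.1 h.run.disj hpi)
    exact names_mono Set.subset_union_right (h.literal p hpA x hx)
  set W := lowSteps R int ext A k ∪ {m | m ∈ int \ lowSteps R int ext A k ∧ R.con m ∈ M} with hW
  have hAW : A ⊆ W := fun _ hs => Or.inl (Or.inl hs)
  have heq : ext ∪ W = (ext ∪ A) ∪ W := by
    rw [Set.union_assoc, Set.union_eq_self_of_subset_left hAW]
  rw [heq]
  refine h.run.closed_of_enabled hbase ?_ ?_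
  · exact (Set.union_subset h.low_subset_int fun _ hs => hs.1.1).trans Set.subset_union_left
  · rintro m ((hm | ⟨n, hm⟩) | ⟨hm, hmM⟩) hmi hmB
    · exact absurd (Or.inr hm) hmB
    · obtain ⟨e, T, h1, h2, h3⟩ := enables_of_near hm
      refine h3.mono (Set.union_subset_union Set.inter_subset_left fun s hs => ?_)
      exact ⟨Or.inl (Or.inr ⟨n, h1.subset_near h2 hs.1⟩), hs.2⟩
    · refine (h.enables_of_notMem hmi hm.2).mono ?_
      rintro s (⟨hs | hs, hsm⟩ | hs)
      · exact Or.inl (Or.inl hs)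
      · exact Or.inr ⟨Or.inl hs, hsm⟩
      · exact Or.inr ⟨Or.inr ⟨hs.1, hM _ (h.run.con_mem s hs.1.1) _ hmM hs.2.2⟩, hs.2.1⟩

end Stratified

/-- The constraints of `S` with a path to `β` but no path from `β`. -/
def strictAnc (S : Set (Constraint ar C V)) (E : Constraint ar C V → Constraint ar C V → Prop)
    (β : Constraint ar C V) : Set (Constraint ar C V) :=
  {γ | γ ∈ S ∧ TransGen E γ β ∧ ¬ TransGen E β γ}

/-- The component of `β`, or just `β` if it is in no component. -/
def comp (S : Set (Constraint ar C V)) (E : Constraint ar C V → Constraint ar C V → Prop)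
    (β : Constraint ar C V) : Set (Constraint ar C V) :=
  {γ | γ ∈ S ∧ (γ = β ∨ TransGen E β γ ∧ TransGen E γ β)}

/-- A step that is upstream of a member of the component has a path to `β`. It therefore belongs to
the component itself or to a strict ancestor, so nothing outside the chosen internal, low and
external steps is needed. -/
theorem Stratified.run_comp (h : Stratified S X R int ext E k A) (β : Constraint ar C V) :
    IsRun (comp S E β)
      (X ∪ {v | ∃ m ∈ lowSteps R int ext A k ∪
        {m | m ∈ int \ lowSteps R int ext A k ∧ R.con m ∈ strictAnc S E β}, v ∈ R.born m}) R
      {m | m ∈ int \ lowSteps R int ext A k ∧ R.con m ∈ comp S E β}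
      (ext ∪ (lowSteps R int ext A k ∪
        {m | m ∈ int \ lowSteps R int ext A k ∧ R.con m ∈ strictAnc S E β})) := by
  refine h.run.restrict (fun m hm => hm.1.1)
    (Set.union_subset h.low_subset_int fun m hm => hm.1.1) ?_ (h.closed_union_low ?_)
    (fun m hm => hm.2) ?_
  · refine Set.disjoint_left.2 ?_
    rintro m ⟨hm, -, hmD⟩ (hml | ⟨-, -, h1, h2⟩)
    · exact hm.2 hml
    · rcases hmD with h3 | h3
      · rw [h3] at h1 h2; exact h2 h1
      · exact h2 h3.1
  · rintro α hα γ ⟨-, h1, h2⟩ hαγ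
    exact ⟨hα, hαγ.trans h1, fun hβ => h2 (hβ.trans hαγ)⟩
  · rintro m ⟨hm, -, hmD⟩
    refine (h.enables_of_notMem hm.1 hm.2).mono ?_
    rintro s (⟨hs | hs, hsm⟩ | ⟨hs, hsm, hsE⟩)
    · exact ⟨Or.inr (Or.inl hs), hsm⟩
    · exact ⟨Or.inr (Or.inr (Or.inl hs)), hsm⟩
    · have hsS := h.run.con_mem s hs.1
      have hsβ : TransGen E (R.con s) β := by
        rcases hmD with h3 | h3
        · rwa [h3] at hsE
        · exact hsE.trans h3.2
      by_cases hβs : TransGen E β (R.con s)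
      · exact ⟨Or.inl ⟨hs, hsS, Or.inr ⟨hβs, hsβ⟩⟩, hsm⟩
      · exact ⟨Or.inr (Or.inr (Or.inr ⟨hs, hsS, hsβ, hβs⟩)), hsm⟩

/-- The steps of a constraint that is in no component are enabled by the other ones. -/
theorem Stratified.enables_of_not_cyclic (h : Stratified S X R int ext E k A)
    {β : Constraint ar C V} (hβ : ¬ TransGen E β β) {m : ℕ}
    (hm : m ∈ int \ lowSteps R int ext A k) (hmD : R.con m ∈ comp S E β) :
    R.Enables (ext ∪ (lowSteps R int ext A k ∪
        {m | m ∈ int \ lowSteps R int ext A k ∧ R.con m ∈ strictAnc S E β})) m := by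
  have hmβ : R.con m = β := hmD.2.resolve_right fun h3 => hβ (h3.1.trans h3.2)
  refine (h.enables_of_notMem hm.1 hm.2).mono ?_
  rintro s (⟨hs | hs, -⟩ | ⟨hs, -, hsE⟩)
  · exact Or.inl hs
  · exact Or.inr (Or.inl hs)
  · rw [hmβ] at hsE
    exact Or.inr (Or.inr ⟨hs, h.run.con_mem s hs.1, hsE, fun h3 => hβ (h3.trans hsE)⟩)

/-- The number of steps in `M` outside the low ones is polynomial. -/
def Few (N : Type*) (S : Set (Constraint ar C V))
    (E : Constraint ar C V → Constraint ar C V → Prop) (k : ℕ) (M : Set (Constraint ar C V)) :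
    Prop :=
  ∃ Q : Polynomial ℕ, ∀ (X : Set (Value C N)) (R : Trace ar C N V) (int ext A : Set ℕ), X.Finite →
    Stratified S X R int ext E k A →
    {m | m ∈ int \ lowSteps R int ext A k ∧ R.con m ∈ M}.ncard ≤ Q.eval X.ncard

theorem Few.union_all {M : Set (Constraint ar C V)} (hM : M.Finite) (h : ∀ β ∈ M, Few N S E k {β}) :
    Few N S E k M := by
  classical
  choose! Q hQ using h
  refine ⟨∑ β ∈ hM.toFinset, Q β, fun X R int ext A hX hs => ?_⟩
  have hcover : {m | m ∈ int \ lowSteps R int ext A k ∧ R.con m ∈ M} ⊆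
      ⋃ β ∈ hM.toFinset, {m | m ∈ int \ lowSteps R int ext A k ∧ R.con m ∈ ({β} : Set _)} :=
    fun m hm => Set.mem_biUnion (x := R.con m) (by simpa using hm.2) ⟨hm.1, rfl⟩
  have hfin : ∀ β : Constraint ar C V,
      {m | m ∈ int \ lowSteps R int ext A k ∧ R.con m ∈ ({β} : Set _)}.Finite := fun β =>
    hs.run.fin_int.subset fun m hm => hm.1.1
  refine ((Set.ncard_le_ncard hcover (Set.Finite.biUnion hM.toFinset.finite_toSet
    fun β _ => hfin β)).trans (Finset.set_ncard_biUnion_le _ _)).trans ?_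
  rw [Polynomial.eval_finsetSum]
  exact Finset.sum_le_sum fun β hβ => hQ β (by simpa using hβ) X R int ext A hX hs

/-- With low steps and strict ancestors as input, the steps of the component of `β` form a run over
polynomially many base values. If `β` lies on a cycle, its component is good. Otherwise its steps
are enabled by external ones, so their head values are base values. -/
theorem Few.of_strictAnc (hS : S.Finite) (hk : 2 ≤ k) (hgood : ∀ D, IsSCC S E D → Good N D)
    {β : Constraint ar C V} (hβ : β ∈ S) (h : Few N S E k (strictAnc S E β)) :
    Few N S E k {β} := by
  obtain ⟨Qa, hQa⟩ := h
  obtain ⟨Ql, hQl⟩ := exists_bound_stage_level (N := N) hS (2 * k)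
  obtain ⟨e, he⟩ := exists_bound_born (N := N) hS
  have hfin : (comp S E β).Finite := hS.subset fun γ hγ => hγ.1
  have hgood' : ∃ Qd : Polynomial ℕ, ∀ (X : Set (Value C N)) (R : Trace ar C N V)
      (int ext : Set ℕ), X.Finite → IsRun (comp S E β) X R int ext →
      (TransGen E β β ∨ ∀ m ∈ int, R.Enables ext m) → int.ncard ≤ Qd.eval X.ncard := by
    by_cases hc : TransGen E β β
    · obtain ⟨Qd, hQd⟩ := hgood (comp S E β) ⟨β, hβ, hc, by
        ext γ
        refine and_congr_right fun _ => ⟨?_, Or.inr⟩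
        rintro (rfl | h1)
        exacts [⟨hc, hc⟩, h1]⟩
      exact ⟨Qd, fun X R int ext hX h _ => hQd X R int ext hX h⟩
    · obtain ⟨Qd, hQd⟩ := exists_bound_stage (N := N) hfin
      refine ⟨Qd, fun X R int ext hX h hen => ?_⟩
      refine (Set.ncard_le_ncard (fun m hm => ?_) (h.fin_int.subset fun m hm => hm.1)).trans
        (hQd _ X R int ext h h.con_mem X hX)
      exact h.stage_of_enables (h.closed_ext subset_rfl) (h.names_of_subset_ext subset_rfl) hm
        (hen.resolve_left hc m hm)
  obtain ⟨Qd, hQd⟩ := hgood'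
  -- The base is `X` together with at most `e` nulls for each low step (counted by `Ql`) and each
  -- step of a strict ancestor (counted by `Qa`).
  refine ⟨Qd.comp (Polynomial.X + Polynomial.C e * (Ql + Qa)), fun X R int ext A hX hs => ?_⟩
  set W := lowSteps R int ext A k ∪
    {m | m ∈ int \ lowSteps R int ext A k ∧ R.con m ∈ strictAnc S E β} with hW
  have hWint : W ⊆ int := Set.union_subset hs.low_subset_int fun m hm => hm.1.1
  have hWcard : W.ncard ≤ Ql.eval X.ncard + Qa.eval X.ncard :=
    (Set.ncard_union_le _ _).trans (Nat.add_le_add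
      ((Set.ncard_le_ncard (hs.low_subset_stage hk) (hs.run.fin_int.subset fun m hm => hm.1)).trans
        (hQl X R int ext hX hs.run)) (hQa X R int ext A hX hs))
  obtain ⟨hb1, hb2⟩ := he R W (hs.run.fin_int.subset hWint) fun m hm =>
    hs.run.con_mem m (hWint hm)
  have hcount := hQd _ R _ _ (hX.union hb1) (hs.run_comp β) (by
    by_cases hc : TransGen E β β
    · exact Or.inl hc
    · exact Or.inr fun m hm => hs.enables_of_not_cyclic hc hm.1 hm.2)
  refine le_trans (Set.ncard_le_ncard ?_ (hs.run.fin_int.subset fun m hm => hm.1.1))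
    (hcount.trans ?_)
  · rintro m ⟨hm, hmβ⟩
    rw [Set.mem_singleton_iff] at hmβ
    exact ⟨hm, hmβ ▸ hβ, Or.inl hmβ⟩
  · rw [Polynomial.eval_comp]
    refine eval_le_eval _ ((Set.ncard_union_le _ _).trans ?_)
    rw [Polynomial.eval_add, Polynomial.eval_X, Polynomial.eval_mul, Polynomial.eval_C,
      Polynomial.eval_add]
    exact Nat.add_le_add_left (hb2.trans (Nat.mul_le_mul_left _ hWcard)) _

/-- Strict ancestry is transitive and irreflexive on a finite set, hence well-founded; this is the
topological order of the components. -/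
theorem Few.all (hS : S.Finite) (hk : 2 ≤ k) (hgood : ∀ D, IsSCC S E D → Good N D) :
    Few N S E k S := by
  have := hS.to_subtype
  let r : S → S → Prop := fun γ β => TransGen E γ.1 β.1 ∧ ¬ TransGen E β.1 γ.1
  have hirr : Std.Irrefl r := ⟨fun a h => h.2 h.1⟩
  have htrans : IsTrans S r := ⟨fun a b c h1 h2 =>
    ⟨h1.1.trans h2.1, fun h3 => h2.2 (h3.trans h1.1)⟩⟩
  have hwf : WellFounded r := Finite.wellFounded_of_trans_of_irrefl r
  refine Few.union_all hS fun β hβ => ?_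
  suffices ∀ β : S, Few N S E k {β.1} from this ⟨β, hβ⟩
  intro β
  induction β using hwf.induction with
  | _ β ih =>
    refine Few.of_strictAnc hS hk hgood β.2 (Few.union_all (hS.subset fun γ hγ => hγ.1) ?_)
    exact fun γ hγ => ih ⟨γ, hγ.1⟩ hγ.2

/-- If all components of the minimal restriction system are good, then so is the set. -/
theorem good_of_components (hS : S.Finite) (hk : 2 ≤ k)
    (hgood : ∀ D, IsSCC S (minEdge N S k) D → Good N D) : Good N S := by
  obtain ⟨Q, hQ⟩ := Few.all hS hk hgood
  obtain ⟨Ql, hQl⟩ := exists_bound_stage_level (N := N) hS (2 * k)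
  refine ⟨Ql + Q, fun X R int ext hX h => ?_⟩
  -- Only the index set `int` is counted, so the trace may be exchanged for a canonical one with the
  -- same indices.
  obtain ⟨_, _, key, R', hrun, hc, hlit⟩ := h.exists_canonical (k - 1)
  have hs : Stratified S X R' int ext (minEdge N S k) k
      (R'.stage int ext (R'.level X int ext (k - 1))) :=
    ⟨hrun, rfl, hlit, hrun.enables_support hc hk (isRestrictionSystem_min N S k) rfl hlit⟩
  set A := R'.stage int ext (R'.level X int ext (k - 1))
  have hcover : int ⊆ R'.stage int ext (R'.level X int ext (2 * k)) ∪
      {m | m ∈ int \ lowSteps R' int ext A k ∧ R'.con m ∈ S} := by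
    intro m hm
    by_cases hml : m ∈ lowSteps R' int ext A k
    · exact Or.inl (hs.low_subset_stage hk hml)
    · exact Or.inr ⟨⟨hm, hml⟩, hrun.con_mem m hm⟩
  refine (Set.ncard_le_ncard hcover (hrun.fin_int.subset (Set.union_subset (fun m hm => hm.1)
    fun m hm => hm.1.1))).trans ((Set.ncard_union_le _ _).trans ?_)
  rw [Polynomial.eval_add]
  exact Nat.add_le_add (hQl X R' int ext hX hrun) (hQ X R' int ext A hX hs)

/-- Strong induction on the size of `S`, following the recursion of `InPart`: either `S` is its own
component and safe, or all components are proper subsets to which the hypothesis passes down. -/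
theorem good_of_inPart [Finite Rel] (hk : 2 ≤ k) (hS : S.Finite)
    (h : ∀ S', InPart N k S S' → Safe S') : Good N S := by
  induction hn : S.ncard using Nat.strong_induction_on generalizing S with
  | _ n ih =>
    by_cases hscc : IsSCC S (minEdge N S k) S
    · exact good_of_safe hS (h S (InPart.self S hscc))
    · refine good_of_components hS hk fun D hD => ?_
      have hDS : D ⊆ S := by
        obtain ⟨α, -, -, rfl⟩ := hD
        exact fun β hβ => hβ.1
      have hne : D ≠ S := by
        rintro rfl
        exact hscc hD
      exact ih D.ncard (hn ▸ Set.ncard_lt_ncard (hDS.ssubset_of_ne hne) hS) (hS.subset hDS)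
        (fun S' hS' => h S' (InPart.comp S D S' hD hne hS')) rfl

end Chase

namespace Chase

variable {Rel C N V : Type*} {ar : Rel → ℕ}
  {S : Set (Constraint ar C V)} {X : Set (Value C N)} {R R' : Trace ar C N V}
  {int ext P : Set ℕ} {g : Value C N → Value C N} {J : Inst ar C N} {n : ℕ}

open Trace

/-! ### From chase sequences to runs -/

namespace Trace

theorem facts_congr (hinit : R.init = R'.init)
    (h : ∀ p ∈ P, R.con p = R'.con p ∧ R.val p = R'.val p) : R.facts P = R'.facts P := by
  ext f
  simp only [facts, Set.mem_ofPred_eq, hinit]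
  refine or_congr_right (exists_congr fun p => and_congr_right fun hp => ?_)
  rw [(h p hp).1, (h p hp).2]

theorem eqv_congr (h : ∀ p ∈ P, R.con p = R'.con p ∧ R.val p = R'.val p) :
    R.eqv P = R'.eqv P := by
  unfold eqv
  congr 1
  funext v w
  refine propext (exists_congr fun p => and_congr_right fun hp => ?_)
  rw [(h p hp).1, (h p hp).2]

theorem Enables.congr (hinit : R.init = R'.init)
    (h : ∀ p ∈ P, R.con p = R'.con p ∧ R.val p = R'.val p) {m : ℕ}
    (hm : R.con m = R'.con m ∧ R.val m = R'.val m) (hen : R.Enables P m) : R'.Enables P m := by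
  unfold Enables at *
  rwa [← facts_congr hinit h, ← eqv_congr h, ← hm.1, ← hm.2]

theorem Violated.congr (hinit : R.init = R'.init)
    (h : ∀ p ∈ P, R.con p = R'.con p ∧ R.val p = R'.val p) {m : ℕ}
    (hm : R.con m = R'.con m ∧ R.val m = R'.val m) (hv : R.Violated P m) : R'.Violated P m := by
  unfold Violated at *
  rwa [← facts_congr hinit h, ← eqv_congr h, ← hm.1, ← hm.2]

/-- The trace extended by a step. -/
noncomputable def extend (R : Trace ar C N V) (n : ℕ) (α : Constraint ar C V)
    (μ : V → Value C N) : Trace ar C N V where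
  init := R.init
  con := Function.update R.con n α
  val := Function.update R.val n μ

variable {α : Constraint ar C V} {μ : V → Value C N}

theorem extend_con_self : (R.extend n α μ).con n = α := Function.update_self ..

theorem extend_val_self : (R.extend n α μ).val n = μ := Function.update_self ..

theorem extend_of_ne {m : ℕ} (hm : m ≠ n) :
    R.con m = (R.extend n α μ).con m ∧ R.val m = (R.extend n α μ).val m :=
  ⟨(Function.update_of_ne hm ..).symm, (Function.update_of_ne hm ..).symm⟩

theorem extend_of_mem {m : ℕ} (hm : m ∈ Set.Iio n) :
    R.con m = (R.extend n α μ).con m ∧ R.val m = (R.extend n α μ).val m :=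
  extend_of_ne (ne_of_lt hm)

theorem extend_born_of_lt {m : ℕ} (hm : m < n) : (R.extend n α μ).born m = R.born m := by
  have := extend_of_mem (R := R) (α := α) (μ := μ) (Set.mem_Iio.2 hm)
  unfold born
  rw [← this.1, ← this.2]

theorem extend_facts : (R.extend n α μ).facts (Set.Iio (n + 1)) =
    R.facts (Set.Iio n) ∪ α.headFacts μ := by
  ext f
  rw [facts_congr (R := R) (R' := R.extend n α μ) rfl fun p hp => extend_of_mem hp]
  simp only [facts, Set.mem_union, Set.mem_ofPred_eq, Set.mem_Iio]
  constructor
  · rintro (hf | ⟨p, hp, hf⟩)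
    · exact Or.inl (Or.inl hf)
    · rcases Nat.lt_succ_iff_lt_or_eq.1 hp with h1 | rfl
      · exact Or.inl (Or.inr ⟨p, h1, hf⟩)
      · rw [extend_con_self, extend_val_self] at hf
        exact Or.inr hf
  · rintro ((hf | ⟨p, hp, hf⟩) | hf)
    · exact Or.inl hf
    · exact Or.inr ⟨p, by omega, hf⟩
    · exact Or.inr ⟨n, Nat.lt_succ_self n, by rwa [extend_con_self, extend_val_self]⟩

end Trace

/-- The map `g` sends names to the values that they have in the instance `J` after `n` steps. -/
structure Models (X : Set (Value C N)) (R : Trace ar C N V) (n : ℕ) (g : Value C N → Value C N)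
    (J : Inst ar C N) : Prop where
  const : ∀ c, g (Value.const c) = Value.const c
  image : J = RAtom.map g '' R.facts (Set.Iio n)
  eqv_of_eq : ∀ v w, (v ∈ R.names X (Set.Iio n) (Set.Iio n) ∨ ∃ c, v = Value.const c) →
    (w ∈ R.names X (Set.Iio n) (Set.Iio n) ∨ ∃ c, w = Value.const c) → g v = g w →
    R.eqv (Set.Iio n) v w
  eq_of_eqv : ∀ v w, R.eqv (Set.Iio n) v w → g v = g w

/-- The parameters of a trace step that corresponds to the chase step with parameters `μ'`. -/
structure Lifts (X : Set (Value C N)) (R : Trace ar C N V) (n : ℕ) (g : Value C N → Value C N)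
    (α : Constraint ar C V) (μ' μ : V → Value C N) : Prop where
  body : ∀ x ∈ vars α.body, μ x ∈ dom (R.facts (Set.Iio n)) ∧ g (μ x) = μ' x
  null : ∀ y ∈ α.exVars, ∃ n, μ y = Value.null n
  new : ∀ y ∈ α.exVars, μ y ∉ R.names X (Set.Iio n) (Set.Iio n)
  inj : Set.InjOn μ α.exVars

theorem before_Iio {m n : ℕ} (h : m ≤ n) : before (Set.Iio n ∪ ∅) m = Set.Iio m := by
  ext s
  simp only [Set.union_empty, Set.mem_inter_iff, Set.mem_Iio]
  omega

namespace Models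

theorem map_eval (h : Models X R n g J) (a : RAtom ar (Term C V)) {μ ν : V → Value C N}
    (hμ : ∀ p x, a.AtPos p (Term.var x) → g (μ x) = ν x) :
    (a.map (Term.eval μ)).map g = a.map (Term.eval ν) := by
  rw [RAtom.map_map]
  refine RAtom.map_congr a fun p u hu => ?_
  cases u with
  | const c => exact h.const c
  | var x => exact hμ p x hu

theorem map_mem (h : Models X R n g J) {f : RAtom ar (Value C N)}
    (hf : f ∈ R.facts (Set.Iio n)) : f.map g ∈ J := by
  rw [h.image]; exact ⟨f, hf, rfl⟩

theorem apply_mem_dom (h : Models X R n g J) {v : Value C N}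
    (hv : v ∈ dom (R.facts (Set.Iio n))) : g v ∈ dom J := by
  obtain ⟨f, hf, p, hp⟩ := mem_dom_iff.1 hv
  exact mem_dom_iff.2 ⟨_, h.map_mem hf, p, RAtom.atPos_map.2 ⟨v, hp, rfl⟩⟩

theorem exists_dom (h : Models X R n g J) {w : Value C N} (hw : w ∈ dom J) :
    ∃ v ∈ dom (R.facts (Set.Iio n)), g v = w := by
  rw [h.image] at hw
  obtain ⟨_, ⟨f, hf, rfl⟩, p, hp⟩ := mem_dom_iff.1 hw
  obtain ⟨v, hv, hvw⟩ := RAtom.atPos_map.1 hp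
  exact ⟨v, mem_dom_iff.2 ⟨f, hf, p, hv⟩, hvw⟩

end Models

/-! ### Extending a run by a chase step -/

namespace IsRun

theorem dom_facts_subset (h : IsRun S X R (Set.Iio n) ∅) :
    dom (R.facts (Set.Iio n)) ⊆ R.names X (Set.Iio n) (Set.Iio n) := by
  have := h.facts_names h.closed_act
  rwa [Set.union_empty] at this

theorem names_finite (h : IsRun S X R int ext) (hX : X.Finite) : (R.names X int P).Finite := by
  have : R.names X int P ⊆ X ∪ ⋃ p ∈ int, R.born p := by
    rintro v (hv | ⟨p, -, hpi, hv⟩)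
    · exact Or.inl hv
    · exact Or.inr (Set.mem_biUnion hpi hv)
  exact (hX.union (h.fin_int.biUnion fun p _ => (R.con p).finite_exVars.image _)).subset this

theorem mem_dom_facts (_h : IsRun S X R (Set.Iio n) ∅)
    (hX : ∀ v ∈ X, v ∈ dom R.init ∨ ∃ c, v = Value.const c) {v : Value C N}
    (hv : v ∈ R.names X (Set.Iio n) (Set.Iio n)) :
    v ∈ dom (R.facts (Set.Iio n)) ∨ ∃ c, v = Value.const c := by
  rcases hv with hv | ⟨p, hp, -, y, hy, rfl⟩
  · refine (hX v hv).imp (fun hv => ?_) id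
    obtain ⟨f, hf, q, hq⟩ := mem_dom_iff.1 hv
    exact mem_dom_iff.2 ⟨f, Or.inl hf, q, hq⟩
  · left
    cases hcon : R.con p with
    | egd e => rw [hcon] at hy; exact hy.elim
    | tgd t =>
      rw [hcon] at hy
      obtain ⟨⟨q, hq⟩, -⟩ := hy
      obtain ⟨a, ha, hya⟩ := occursAt_iff.1 hq
      exact mem_dom_iff.2 ⟨_, Or.inr ⟨p, hp, by rw [hcon]; exact ⟨a, ha, rfl⟩⟩, q,
        RAtom.atPos_map.2 ⟨_, hya, rfl⟩⟩

variable {α : Constraint ar C V} {μ μ' : V → Value C N}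

/-- A chase step only avoids nulls of the current instance and may reuse one that an equation
removed. In a trace names must be new for good, so existential values are renamed to nulls never
used so far. -/
theorem exists_lifts [Infinite N] (h : IsRun S X R (Set.Iio n) ∅) (hX : X.Finite)
    (hg : Models X R n g J) (hb : Holds J α.body μ') : ∃ μ, Lifts X R n g α μ' μ := by
  classical
  have hbody : ∀ x : V, ∃ v, x ∈ vars α.body → v ∈ dom (R.facts (Set.Iio n)) ∧ g v = μ' x := by
    intro x
    by_cases hx : x ∈ vars α.body
    · obtain ⟨p, hp⟩ := hx
      obtain ⟨a, ha, hxa⟩ := occursAt_iff.1 hp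
      obtain ⟨v, hv⟩ := hg.exists_dom (w := μ' x) (mem_dom_iff.2 ⟨_, hb a ha, p,
        RAtom.atPos_map.2 ⟨_, hxa, rfl⟩⟩)
      exact ⟨v, fun _ => hv⟩
    · exact ⟨μ' x, fun hh => absurd hh hx⟩
  choose b hb using hbody
  have hfin : (R.names X (Set.Iio n) (Set.Iio n)).Finite := h.names_finite hX
  have hinf : {i : N | Value.null i ∉ R.names X (Set.Iio n) (Set.Iio n)}.Infinite := by
    refine Set.Finite.infinite_compl
      (s := {i : N | Value.null i ∈ R.names X (Set.Iio n) (Set.Iio n)}) ?_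
    exact hfin.preimage fun i _ j _ hij => Value.null.inj hij
  have := hinf.to_subtype
  let e := Infinite.natEmbedding {i : N | Value.null i ∉ R.names X (Set.Iio n) (Set.Iio n)}
  obtain ⟨φ, hφ⟩ := Set.countable_iff_exists_injOn.1 α.finite_exVars.countable
  refine ⟨fun x => if x ∈ vars α.body then b x else Value.null (e (φ x)), ?_, ?_, ?_, ?_⟩
  · intro x hx
    simp only [if_pos hx]
    exact hb x hx
  · intro y hy
    simp only [if_neg (Constraint.notMem_body_of_exVars hy)]
    exact ⟨_, rfl⟩
  · intro y hy
    simp only [if_neg (Constraint.notMem_body_of_exVars hy)]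
    exact (e (φ y)).2
  · intro y hy y' hy' heq
    simp only [if_neg (Constraint.notMem_body_of_exVars hy),
      if_neg (Constraint.notMem_body_of_exVars hy')] at heq
    exact hφ hy hy' (e.injective (Subtype.ext (Value.null.inj heq)))

theorem extend_names_subset : (R.extend n α μ).names X (Set.Iio (n + 1)) (Set.Iio (n + 1)) ⊆
    R.names X (Set.Iio n) (Set.Iio n) ∪ μ '' α.exVars := by
  rintro v (hv | ⟨p, hp, -, hv⟩)
  · exact Or.inl (Or.inl hv)
  · rcases Nat.lt_succ_iff_lt_or_eq.1 hp with h1 | rfl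
    · rw [extend_born_of_lt h1] at hv
      exact Or.inl (Or.inr ⟨p, h1, h1, hv⟩)
    · unfold born at hv
      rw [extend_con_self, extend_val_self] at hv
      exact Or.inr hv

/-- Values that `g` identifies are equivalent in the trace, so a match in `J` lifts to a match up to
equivalence. -/
theorem enables_extend (h : IsRun S X R (Set.Iio n) ∅) (hg : Models X R n g J)
    (hl : Lifts X R n g α μ' μ) (hb : Holds J α.body μ') :
    (R.extend n α μ).Enables (Set.Iio n) n := by
  have hagree : ∀ p ∈ Set.Iio n, R.con p = (R.extend n α μ).con p ∧
    R.val p = (R.extend n α μ).val p := fun p hp => extend_of_mem hp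
  unfold Enables
  rw [← facts_congr (R := R) (R' := R.extend n α μ) rfl hagree, ← eqv_congr hagree,
    extend_con_self, extend_val_self]
  intro a ha
  have hmem := hb a ha
  rw [← hg.map_eval a (μ := μ) (fun p x hx => (hl.body x (mem_vars_of_atPos ha hx)).2),
    hg.image] at hmem
  obtain ⟨f, hf, hfa⟩ := hmem
  refine ⟨f, hf, ?_⟩
  obtain ⟨r, u⟩ := f
  obtain ⟨r', u'⟩ := a
  obtain ⟨rfl, h2⟩ := RAtom.mk.inj hfa
  have h2 := eq_of_heq h2
  refine ⟨r, u, fun i => Term.eval μ (u' i), rfl, rfl, fun i => ?_⟩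
  refine hg.eqv_of_eq _ _ (Or.inl (h.dom_facts_subset ⟨_, hf, i, rfl⟩)) ?_ (congrFun h2 i)
  change Term.eval μ (u' i) ∈ _ ∨ ∃ c, Term.eval μ (u' i) = Value.const c
  cases hu : u' i with
  | const c => exact Or.inr ⟨c, rfl⟩
  | var x => exact Or.inl (h.dom_facts_subset (hl.body x ⟨_, _, ha, i, rfl, hu⟩).1)

/-- Conversely, applying `g` to a match of the head in the trace would give one in `J`. -/
theorem violated_extend (hg : Models X R n g J) (hl : Lifts X R n g α μ' μ)
    (hsat : ¬ Sat J α μ') : (R.extend n α μ).Violated (Set.Iio n) n := by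
  have hagree : ∀ p ∈ Set.Iio n, R.con p = (R.extend n α μ).con p ∧
    R.val p = (R.extend n α μ).val p := fun p hp => extend_of_mem hp
  unfold Violated
  rw [← facts_congr (R := R) (R' := R.extend n α μ) rfl hagree, ← eqv_congr hagree,
    extend_con_self, extend_val_self]
  cases α with
  | tgd t =>
    intro ν hν hh
    refine hsat fun _ => ⟨g ∘ ν, fun x hx => ?_, fun a ha => ?_⟩
    · exact (hg.eq_of_eqv _ _ (hν x hx)).trans (hl.body x hx).2
    · obtain ⟨f, hf, hs⟩ := hh a ha
      rw [← hg.map_eval a (μ := ν) (ν := g ∘ ν) (fun _ _ _ => rfl),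
        ← RAtom.Sim.map_eq (g := g) hg.eq_of_eqv hs]
      exact hg.map_mem hf
  | egd e =>
    refine fun hh => hsat fun _ => ?_
    have := hg.eq_of_eqv _ _ hh
    rwa [(hl.body _ e.lhs_mem).2, (hl.body _ e.rhs_mem).2] at this

/-- The map `g'` for the next instance is needed only for consistency: it fixes constants and is
constant on the classes of the extended equivalence. -/
theorem extend (h : IsRun S X R (Set.Iio n) ∅) (hconst : ∀ α ∈ S, ∀ c ∈ α.headConsts,
    Value.const c ∈ X) (hg : Models X R n g J) (hα : α ∈ S) (hl : Lifts X R n g α μ' μ)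
    (hb : Holds J α.body μ') (hsat : ¬ Sat J α μ') {g' : Value C N → Value C N}
    (hg'c : ∀ c, g' (Value.const c) = Value.const c)
    (hg' : ∀ v w, (R.extend n α μ).eqv (Set.Iio (n + 1)) v w → g' v = g' w) :
    IsRun S X (R.extend n α μ) (Set.Iio (n + 1)) ∅ := by
  have hborn : (R.extend n α μ).born n = μ '' α.exVars := by
    unfold born; rw [extend_con_self, extend_val_self]
  have hnew : ∀ v ∈ (R.extend n α μ).born n, v ∉ R.names X (Set.Iio n) (Set.Iio n) := by
    rw [hborn]
    rintro _ ⟨y, hy, rfl⟩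
    exact hl.new y hy
  have hcases : ∀ m ∈ Set.Iio (n + 1), m = n ∨ m ∈ Set.Iio n := fun m hm =>
    (Nat.lt_succ_iff_lt_or_eq.1 hm).symm
  refine { fin_int := Set.finite_Iio _
           fin_ext := Set.finite_empty
           disj := Set.disjoint_empty _
           init_fin := h.init_fin
           init_sub := h.init_sub
           ext_facts := fun m hm => hm.elim
           ext_univ := fun m hm => hm.elim
           con_mem := fun m hm => ?_
           const_mem := fun m hm => ?_
           null := fun m hm => ?_
           inj := fun m hm => ?_
           new := fun m hm v hv => ?_
           unique := fun m hm m' hm' v hv hv' => ?_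
           enabled := fun m hm => ?_
           violated := fun m hm => ?_
           consistent := fun c c' hcc => ?_ }
  · rcases hcases m hm with rfl | hm
    · rwa [extend_con_self]
    · rw [← (extend_of_mem hm).1]; exact h.con_mem m hm
  · rcases hcases m hm with rfl | hm
    · rw [extend_con_self]; exact hconst α hα
    · rw [← (extend_of_mem hm).1]; exact h.const_mem m hm
  · rcases hcases m hm with rfl | hm
    · rw [extend_con_self, extend_val_self]; exact hl.null
    · rw [← (extend_of_mem hm).1, ← (extend_of_mem hm).2]; exact h.null m hm
  · rcases hcases m hm with rfl | hm
    · rw [extend_con_self, extend_val_self]; exact hl.inj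
    · rw [← (extend_of_mem hm).1, ← (extend_of_mem hm).2]; exact h.inj m hm
  · rcases hcases m hm with rfl | hm
    · exact fun hX => hnew v hv (Or.inl hX)
    · rw [extend_born_of_lt hm] at hv; exact h.new m hm v hv
  · rcases hcases m hm with rfl | hm <;> rcases hcases m' hm' with rfl | hm'
    · rfl
    · rw [extend_born_of_lt hm'] at hv'
      exact absurd (Or.inr ⟨m', hm', hm', hv'⟩) (hnew v hv)
    · rw [extend_born_of_lt hm] at hv
      exact absurd (Or.inr ⟨m, hm, hm, hv⟩) (hnew v hv')
    · rw [extend_born_of_lt hm] at hv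
      rw [extend_born_of_lt hm'] at hv'
      exact h.unique m hm m' hm' v hv hv'
  · rw [before_Iio (le_of_lt hm)]
    rcases hcases m hm with rfl | hm
    · exact h.enables_extend hg hl hb
    · have := h.enabled m hm
      rw [before_Iio (le_of_lt hm)] at this
      exact this.congr (R := R) (R' := R.extend n α μ) rfl
        (fun p hp => extend_of_mem (lt_trans (Set.mem_Iio.1 hp) hm)) (extend_of_mem hm)
  · rw [before_Iio (le_of_lt hm)]
    rcases hcases m hm with rfl | hm
    · exact violated_extend hg hl hsat
    · have := h.violated m hm
      rw [before_Iio (le_of_lt hm)] at this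
      exact this.congr (R := R) (R' := R.extend n α μ) rfl
        (fun p hp => extend_of_mem (lt_trans (Set.mem_Iio.1 hp) hm)) (extend_of_mem hm)
  · rw [Set.union_empty] at hcc
    have := hg' _ _ hcc
    rw [hg'c, hg'c] at this
    exact Value.const.inj this

theorem extend_eqv_cases {r : Value C N → Value C N → Prop} (hr : Equivalence r)
    (hold : ∀ v w, R.eqv (Set.Iio n) v w → r v w) (hnew : ∀ v w, α.Equates μ v w → r v w)
    {v w : Value C N} (hvw : (R.extend n α μ).eqv (Set.Iio (n + 1)) v w) : r v w := by
  refine eqv_induction hr (fun p hp v w he => ?_) hvw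
  rcases Nat.lt_succ_iff_lt_or_eq.1 hp with h1 | rfl
  · refine hold v w (eqv_of_equates (Set.mem_Iio.2 h1) ?_)
    rwa [(extend_of_mem (R := R) (α := α) (μ := μ) h1).1,
      (extend_of_mem (R := R) (α := α) (μ := μ) h1).2]
  · rw [extend_con_self, extend_val_self] at he
    exact hnew v w he

theorem extend_eqv_of_eqv {v w : Value C N} (hvw : R.eqv (Set.Iio n) v w) :
    (R.extend n α μ).eqv (Set.Iio (n + 1)) v w := by
  rw [eqv_congr (R' := R.extend n α μ) fun p hp => extend_of_mem hp] at hvw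
  exact eqv_mono (Set.Iio_subset_Iio (Nat.le_succ n)) hvw

end IsRun

theorem exists_models_tgd (h : IsRun S X R (Set.Iio n) ∅)
    (hX : ∀ v ∈ X, v ∈ dom R.init ∨ ∃ c, v = Value.const c) (hg : Models X R n g J)
    {t : TGD ar C V} {s : Step ar C N V} (hs : s.constraint = .tgd t) (hen : s.Enabled J)
    {μ : V → Value C N} (hl : Lifts X R n g (.tgd t) s.val μ) :
    ∃ g', Models X (R.extend n (.tgd t) μ) (n + 1) g' (s.apply J) := by
  classical
  obtain ⟨hfresh, hen⟩ := hen
  unfold Step.Fresh at hfresh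
  rw [hs] at hfresh hen
  obtain ⟨hb, hnull, hinj⟩ := hen
  let g' : Value C N → Value C N := fun v =>
    if hv : ∃ y, y ∈ t.exVars ∧ μ y = v then s.val hv.choose else g v
  have hg'new : ∀ y ∈ t.exVars, g' (μ y) = s.val y := by
    intro y hy
    have hex : ∃ z, z ∈ t.exVars ∧ μ z = μ y := ⟨y, hy, rfl⟩
    simp only [g', dif_pos hex]
    rw [hl.inj hex.choose_spec.1 hy hex.choose_spec.2]
  have hg'old : ∀ v, (v ∈ R.names X (Set.Iio n) (Set.Iio n) ∨ ∃ c, v = Value.const c) →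
      g' v = g v := by
    rintro v hv
    refine dif_neg ?_
    rintro ⟨y, hy, rfl⟩
    rcases hv with hv | ⟨c, hc⟩
    · exact hl.new y hy hv
    · obtain ⟨i, hi⟩ := hl.null y hy
      rw [hi] at hc
      cases hc
  have hg'c : ∀ c, g' (Value.const c) = Value.const c := fun c =>
    (hg'old _ (Or.inr ⟨c, rfl⟩)).trans (hg.const c)
  -- A null created by the chase differs from the values of all known names: such a name occurs in a
  -- fact, so its value occurs in `J`, or it is a constant. Here `hX` matters, as it excludes nulls
  -- in `X` that occur nowhere.
  have hne : ∀ y ∈ t.exVars, ∀ v, (v ∈ R.names X (Set.Iio n) (Set.Iio n) ∨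
      ∃ c, v = Value.const c) → s.val y ≠ g v := by
    intro y hy v hv heq
    have hv' : v ∈ dom (R.facts (Set.Iio n)) ∨ ∃ c, v = Value.const c :=
      hv.elim (h.mem_dom_facts hX) Or.inr
    rcases hv' with hv' | ⟨c, rfl⟩
    · exact hfresh y hy (heq ▸ hg.apply_mem_dom hv')
    · obtain ⟨i, hi⟩ := hnull y hy
      rw [hi, hg.const] at heq
      cases heq
  refine ⟨g', hg'c, ?_, ?_, ?_⟩
  · have happ : s.apply J = J ∪ {f | ∃ a ∈ t.head, f = a.map (Term.eval s.val)} := by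
      unfold Step.apply; rw [hs]
    rw [happ, extend_facts, Set.image_union]
    have h1 : J = RAtom.map g' '' R.facts (Set.Iio n) := by
      rw [hg.image]
      refine Set.image_congr fun f hf => RAtom.map_congr f fun p v hv => (hg'old v (Or.inl ?_)).symm
      exact h.dom_facts_subset (mem_dom_iff.2 ⟨f, hf, p, hv⟩)
    have hmap : ∀ a ∈ t.head, (a.map (Term.eval μ)).map g' = a.map (Term.eval s.val) := by
      intro a ha
      rw [RAtom.map_map]
      refine RAtom.map_congr a fun p u hu => ?_
      cases u with
      | const c => exact hg'c c
      | var x =>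
        by_cases hxb : x ∈ vars t.body
        · obtain ⟨h2, h3⟩ := hl.body x hxb
          exact (hg'old _ (Or.inl (h.dom_facts_subset h2))).trans h3
        · exact hg'new x ⟨mem_vars_of_atPos ha hu, hxb⟩
    rw [← h1]
    congr 1
    ext f
    constructor
    · rintro ⟨a, ha, rfl⟩
      exact ⟨_, ⟨a, ha, rfl⟩, hmap a ha⟩
    · rintro ⟨_, ⟨a, ha, rfl⟩, rfl⟩
      exact ⟨a, ha, hmap a ha⟩
  · have hcases : ∀ v, (v ∈ (R.extend n (.tgd t) μ).names X (Set.Iio (n + 1)) (Set.Iio (n + 1)) ∨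
        ∃ c, v = Value.const c) → (v ∈ R.names X (Set.Iio n) (Set.Iio n) ∨
        ∃ c, v = Value.const c) ∨ ∃ y ∈ t.exVars, μ y = v := by
      rintro v (hv | hv)
      · exact (IsRun.extend_names_subset hv).imp Or.inl id
      · exact Or.inl (Or.inr hv)
    intro v w hv hw heq
    rcases hcases v hv with hv | ⟨y, hy, rfl⟩ <;> rcases hcases w hw with hw | ⟨z, hz, rfl⟩
    · rw [hg'old v hv, hg'old w hw] at heq
      exact IsRun.extend_eqv_of_eqv (hg.eqv_of_eq v w hv hw heq)
    · rw [hg'old v hv, hg'new z hz] at heq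
      exact absurd heq.symm (hne z hz v hv)
    · rw [hg'old w hw, hg'new y hy] at heq
      exact absurd heq (hne y hy w hw)
    · rw [hg'new y hy, hg'new z hz] at heq
      rw [hinj hy hz heq]
      exact eqv_refl _ _
  · intro v w hvw
    refine IsRun.extend_eqv_cases (α := .tgd t) (μ := μ) (r := fun v w => g' v = g' w)
      ⟨fun _ => rfl, Eq.symm, Eq.trans⟩
      (fun v w hvw => ?_) (fun v w he => he.elim) hvw
    have := h.eqv_names h.closed_act (v := v) (w := w) (by rwa [Set.union_empty])
    rw [Set.union_empty] at this
    rcases this with rfl | ⟨h1, h2⟩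
    · rfl
    · rw [hg'old v (Or.inl h1), hg'old w (Or.inl h2)]
      exact hg.eq_of_eqv v w hvw

/-- The replacement is composed with `g`. It identifies exactly two values, and names `a` and `b`
for them are made equivalent by the new equation. -/
theorem exists_models_egd (h : IsRun S X R (Set.Iio n) ∅) (hg : Models X R n g J)
    {e : EGD ar C V} {s : Step ar C N V} (hs : s.constraint = .egd e) (hen : s.Enabled J)
    {μ : V → Value C N} (hl : Lifts X R n g (.egd e) s.val μ) :
    ∃ g', Models X (R.extend n (.egd e) μ) (n + 1) g' (s.apply J) := by
  classical
  obtain ⟨-, hen⟩ := hen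
  rw [hs] at hen
  obtain ⟨hb, hne, i, hi⟩ := hen
  obtain ⟨hl1, hl2⟩ := hl.body _ e.lhs_mem
  obtain ⟨hr1, hr2⟩ := hl.body _ e.rhs_mem
  have heqv : (R.extend n (.egd e) μ).eqv (Set.Iio (n + 1)) (μ e.lhs) (μ e.rhs) :=
    eqv_of_equates (Set.mem_Iio.2 (Nat.lt_succ_self n))
      (by rw [extend_con_self, extend_val_self]; exact ⟨rfl, rfl⟩)
  obtain ⟨a, b, ha1, hb1, ha2, hb2, hab⟩ : ∃ a b, a ∈ dom (R.facts (Set.Iio n)) ∧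
      b ∈ dom (R.facts (Set.Iio n)) ∧ g a = e.old s.val s.swap ∧ g b = e.new s.val s.swap ∧
      (R.extend n (.egd e) μ).eqv (Set.Iio (n + 1)) a b := by
    cases s.swap with
    | false => exact ⟨_, _, hr1, hl1, hr2, hl2, eqv_symm heqv⟩
    | true => exact ⟨_, _, hl1, hr1, hl2, hr2, heqv⟩
  set u := e.old s.val s.swap with hu
  set w₀ := e.new s.val s.swap with hw₀
  have hlr : (s.val e.lhs = u ∧ s.val e.rhs = w₀) ∨ (s.val e.lhs = w₀ ∧ s.val e.rhs = u) := by
    rw [hu, hw₀]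
    cases s.swap with
    | false => exact Or.inr ⟨rfl, rfl⟩
    | true => exact Or.inl ⟨rfl, rfl⟩
  have ha1' := h.dom_facts_subset ha1
  have hb1' := h.dom_facts_subset hb1
  refine ⟨fun v => if g v = u then w₀ else g v, fun c => ?_, ?_, ?_, ?_⟩
  · simp only [hg.const, hi]
    exact if_neg (by intro hh; cases hh)
  · have happ : s.apply J = replaceValue u w₀ J := by
      unfold Step.apply; rw [hs]
    have hempty : (Constraint.egd e).headFacts μ = (∅ : Inst ar C N) := rfl
    rw [happ, extend_facts, hempty, Set.union_empty, hg.image]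
    unfold replaceValue
    rw [Set.image_image]
    rfl
  · have hcases : ∀ v, (v ∈ (R.extend n (.egd e) μ).names X (Set.Iio (n + 1)) (Set.Iio (n + 1)) ∨
        ∃ c, v = Value.const c) → (v ∈ R.names X (Set.Iio n) (Set.Iio n) ∨
        ∃ c, v = Value.const c) := by
      rintro v (hv | hv)
      · rcases IsRun.extend_names_subset hv with hv | ⟨y, hy, -⟩
        · exact Or.inl hv
        · exact hy.elim
      · exact Or.inr hv
    have hold : ∀ v w, (v ∈ R.names X (Set.Iio n) (Set.Iio n) ∨ ∃ c, v = Value.const c) →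
        (w ∈ R.names X (Set.Iio n) (Set.Iio n) ∨ ∃ c, w = Value.const c) → g v = g w →
        (R.extend n (.egd e) μ).eqv (Set.Iio (n + 1)) v w := fun v w hv hw hvw =>
      IsRun.extend_eqv_of_eqv (hg.eqv_of_eq v w hv hw hvw)
    intro v w hv hw heq
    have hv := hcases v hv
    have hw := hcases w hw
    by_cases h1 : g v = u <;> by_cases h2 : g w = u
    · exact hold v w hv hw (h1.trans h2.symm)
    · simp only [if_pos h1, if_neg h2] at heq
      exact eqv_trans (hold v a hv (Or.inl ha1') (h1.trans ha2.symm)) (eqv_trans hab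
        (hold b w (Or.inl hb1') hw (hb2.trans heq)))
    · simp only [if_neg h1, if_pos h2] at heq
      exact eqv_trans (hold v b hv (Or.inl hb1') (heq.trans hb2.symm)) (eqv_trans (eqv_symm hab)
        (hold a w (Or.inl ha1') hw (ha2.trans h2.symm)))
    · simp only [if_neg h1, if_neg h2] at heq
      exact hold v w hv hw heq
  · intro v w hvw
    refine IsRun.extend_eqv_cases (r := fun v w => (if g v = u then w₀ else g v) =
      (if g w = u then w₀ else g w)) ⟨fun _ => rfl, Eq.symm, Eq.trans⟩
      (fun v w hvw => by simp only [hg.eq_of_eqv v w hvw]) ?_ hvw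
    rintro _ _ ⟨rfl, rfl⟩
    rw [hl2, hr2]
    rcases hlr with ⟨h1, h2⟩ | ⟨h1, h2⟩ <;> rw [h1, h2] <;> split_ifs <;> simp_all

/-- Every finite chase sequence is described by a run. -/
theorem exists_run_of_chase [Infinite N] {I : Inst ar C N} (hI : I.Finite) (hX : X.Finite)
    (hIX : dom I ⊆ X) (hXI : ∀ v ∈ X, v ∈ dom I ∨ ∃ c, v = Value.const c)
    (hconst : ∀ α ∈ S, ∀ c ∈ α.headConsts, Value.const c ∈ X) (α₀ : Constraint ar C V)
    {run : ℕ → Inst ar C N} (h0 : run 0 = I) (n : ℕ)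
    (hrun : ∀ i < n, ChaseStep N S (run i) (run (i + 1))) :
    ∃ (R : Trace ar C N V) (g : Value C N → Value C N), R.init = I ∧
      IsRun S X R (Set.Iio n) ∅ ∧ Models X R n g (run n) := by
  induction n with
  | zero =>
    have hempty : Set.Iio (0 : ℕ) = ∅ := by ext; simp
    have heqv : ∀ (R : Trace ar C N V) v w, R.eqv ∅ v w → v = w := fun R v w hvw =>
      eqv_induction ⟨fun _ => rfl, Eq.symm, Eq.trans⟩ (fun p hp => hp.elim) hvw
    -- A filler: without any steps, the constraints and parameters of the trace are irrelevant.
    let v₀ : Value C N := Value.null (Classical.arbitrary N)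
    refine ⟨⟨I, fun _ => α₀, fun _ _ => v₀⟩, id, rfl, ?_, fun c => rfl, ?_, ?_, ?_⟩
    · rw [hempty]
      refine { fin_int := Set.finite_empty
               fin_ext := Set.finite_empty
               disj := Set.disjoint_empty _
               init_fin := hI
               init_sub := hIX
               ext_facts := fun m hm => hm.elim
               ext_univ := fun m hm => hm.elim
               con_mem := fun m hm => hm.elim
               const_mem := fun m hm => hm.elim
               null := fun m hm => hm.elim
               inj := fun m hm => hm.elim
               new := fun m hm => hm.elim
               unique := fun m hm => hm.elim
               enabled := fun m hm => hm.elim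
               violated := fun m hm => hm.elim
               consistent := fun c c' hcc => ?_ }
      rw [Set.union_empty] at hcc
      exact Value.const.inj (heqv _ _ _ hcc)
    · rw [h0, hempty]
      ext f
      constructor
      · exact fun hf => ⟨f, Or.inl hf, rfl⟩
      · rintro ⟨f, hf | ⟨p, hp, -⟩, rfl⟩
        · exact hf
        · exact hp.elim
    · rintro v w - - hvw
      rw [show v = w from hvw]
      exact eqv_refl _ _
    · intro v w hvw
      rw [hempty] at hvw
      exact heqv _ _ _ hvw
  | succ n ih =>
    obtain ⟨R, g, rfl, h, hg⟩ := ih fun i hi => hrun i (Nat.lt_succ_of_lt hi)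
    obtain ⟨s, hsS, hen, hsat, hJ⟩ := hrun n (Nat.lt_succ_self n)
    have hb : Holds (run n) s.constraint.body s.val := by
      have hen2 := hen.2
      cases hs : s.constraint with
      | tgd t => rw [hs] at hen2; exact hen2.1
      | egd e => rw [hs] at hen2; exact hen2.1
    obtain ⟨μ, hl⟩ := h.exists_lifts hX hg hb
    have hex : ∃ g', Models X (R.extend n s.constraint μ) (n + 1) g' (s.apply (run n)) := by
      cases hs : s.constraint with
      | tgd t => rw [hs] at hl; exact exists_models_tgd h hXI hg hs hen hl
      | egd e => rw [hs] at hl; exact exists_models_egd h hg hs hen hl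
    obtain ⟨g', hg'⟩ := hex
    refine ⟨R.extend n s.constraint μ, g', rfl,
      h.extend hconst hg hsS hl hb hsat hg'.const hg'.eq_of_eqv, ?_⟩
    rw [hJ]
    exact hg'

theorem Constraint.finite_headConsts (α : Constraint ar C V) : α.headConsts.Finite := by
  cases α with
  | egd e => exact Set.finite_empty
  | tgd t =>
    have : (Constraint.tgd t).headConsts ⊆
        ⋃ a ∈ {a | a ∈ t.head}, ⋃ i : Fin (ar a.rel), {c | a.args i = Term.const c} := by
      rintro c ⟨a, ha, p, i, -, hi⟩
      exact Set.mem_biUnion ha (Set.mem_iUnion.2 ⟨i, hi⟩)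
    refine (Set.Finite.biUnion t.head.finite_toSet fun a _ => Set.finite_iUnion fun i => ?_).subset
      this
    refine Set.Subsingleton.finite fun x hx y hy => ?_
    exact Term.const.inj (hx.symm.trans hy)

theorem finite_dom {I : Inst ar C N} (hI : I.Finite) : (dom I).Finite := by
  have : dom I = ⋃ a ∈ I, Set.range a.args := by
    ext v; simp [dom]
  rw [this]
  exact hI.biUnion fun a _ => Set.finite_range _

/-- The base values are those of `I` and the constants in heads. The latter are a fixed finite
number, which is absorbed into the polynomial. -/
theorem chasePolynomiallyBounded_of_good [Infinite N] (hS : S.Finite) (h : Good N S) :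
    ChasePolynomiallyBounded N S := by
  obtain ⟨Q, hQ⟩ := h
  set consts : Set (Value C N) := ⋃ α ∈ S, Value.const '' α.headConsts with hc
  have hcfin : consts.Finite := hS.biUnion fun α _ => α.finite_headConsts.image _
  refine ⟨Q.comp (Polynomial.X + Polynomial.C consts.ncard), fun I hI L run hrun => ?_⟩
  rw [Polynomial.eval_comp, Polynomial.eval_add, Polynomial.eval_X, Polynomial.eval_C]
  obtain ⟨h0, hstep⟩ := hrun
  have hbound : ∀ n : ℕ, (n : ℕ∞) ≤ L → n ≤ Q.eval ((dom I).ncard + consts.ncard) := by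
    intro n hn
    rcases Nat.eq_zero_or_pos n with rfl | hpos
    · exact Nat.zero_le _
    have hst : ∀ i < n, ChaseStep N S (run i) (run (i + 1)) := fun i hi =>
      hstep i (lt_of_lt_of_le (Nat.cast_lt.2 hi) hn)
    -- The constraint of the first step fills the unused indices of the trace; this is why `n = 0`
    -- was treated separately.
    obtain ⟨s, -⟩ := hst 0 hpos
    have hfin : (dom I ∪ consts).Finite := (finite_dom hI).union hcfin
    obtain ⟨R, g, -, hR, -⟩ := exists_run_of_chase (S := S) hI hfin Set.subset_union_left
      (by
        rintro v (hv | hv)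
        · exact Or.inl hv
        · obtain ⟨α, -, c, -, rfl⟩ := Set.mem_iUnion₂.1 hv
          exact Or.inr ⟨c, rfl⟩)
      (fun α hα c hc => Or.inr (Set.mem_biUnion hα ⟨c, hc, rfl⟩)) s.constraint h0 n hst
    have := hQ _ R _ _ hfin hR
    rw [Set.ncard_eq_toFinset_card', Set.toFinset_Iio, Nat.card_Iio] at this
    exact this.trans (eval_le_eval Q (Set.ncard_union_le _ _))
  -- Bounding every natural number below `L` also rules out `L = ⊤`.
  refine ENat.forall_natCast_le_iff_le.1 fun n hn => ?_
  exact Nat.cast_le.2 (hbound n hn)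

end Chase

theorem mainTheorem1 {Rel C N V : Type*} [Finite Rel] [Infinite C] [Infinite N] [Infinite V]
    (ar : Rel → ℕ) (S : Set (Constraint ar C V)) (hS : S.Finite) :
    (∀ k : ℕ, 2 ≤ k → InT N k S → ChasePolynomiallyBounded N S) ∧
      (InductivelyRestricted N S → ChasePolynomiallyBounded N S) := by
  refine ⟨?_, fun h => chasePolynomiallyBounded_of_good hS (good_of_inPart le_rfl hS h)⟩
  rintro k - ⟨k', hk', -, h⟩
  exact chasePolynomiallyBounded_of_good hS (good_of_inPart hk' hS h)
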